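/- **Setting.** All tensor products of $C^*$-algebras are minimal. A compact quantum group $G=(\mathcal A,\Delta)$ is a unital $C^*$-algebra $\mathcal A\neq 0$ with a unital $*$-homomorphism $\Delta:\mathcal A\to\mathcal A\otimes\mathcal A$ such that $(\Delta\otimes\iota)\Delta=(\iota\otimes\Delta)\Delta$ and the linear spans of $\{(b\otimes I)\Delta(c)\}$ and of $\{(I\otimes b)\Delta(c)\}$, $b,c\in\mathcal A$, are dense in $\mathcal A\otimes\mathcal A$. $\mathrm{Rep}(G)$ is the category of unitary representations of $G$ on finite dimensional Hilbert spaces: an object is a linear map $u:H_u\to H_u\otimes\mathcal A$, with coefficients $u_{\varphi,\psi}\in\mathcal A$ obtained by applying $\langle\varphi,\cdot\rangle\otimes\iota$ to $u(\psi)$, such that for one (equivalently any) orthonormal basis $(e_i)$ of $H_u$ the matrix $(u_{e_i,e_j})$ is unitary and $\Delta(u_{e_i,e_j})=\sum_k u_{e_i,e_k}\otimes u_{e_k,e_j}$. The arrows $(u,v)$ are the linear maps $T:H_u\to H_v$ with $(T\otimes I)u=vT$, the $*$-operation is the Hilbert space adjoint, $u\otimes v$ acts on $H_u\otimes H_v$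 with coefficients $u_{\varphi,\psi}v_{\varphi',\psi'}$, and $\iota$ is the trivial representation on $\mathbb C$. A representation $\bar u\in\mathrm{Rep}(G)$ is a conjugate of $u$ if there is an antilinear invertible map $j:H_u\to H_{\bar u}$ such that $\bar u_{j\varphi,\,j^{*-1}\psi}=(u_{\varphi,\psi})^*$ for all $\varphi,\psi\in H_u$, where $\langle j\varphi,\chi\rangle=\langle j^*\chi,\varphi\rangle$. Let $\eta:\mathcal B\to\mathcal B\otimes\mathcal A$ be an action of $G$ on a unital $C^*$-algebra $\mathcal B\neq0$, that is, a unital $*$-homomorphism with $(\eta\otimes\iota)\eta=(\iota\otimes\Delta)\eta$. Assume that $\eta$ is nondegenerate (the linear span of $\eta(\mathcal B)(I\otimes\mathcal A)$ is dense in $\mathcal B\otimes\mathcal A$) and ergodic ($\eta(b)=b\otimes I$ implies $b\in\mathbb C I$). For $u\in\mathrm{Rep}(G)$ let $L_u$ be the space of linear maps $T:H_u\to\mathcal B$ with $\eta\circ T=(T\otimes\iota)\circ u$. It is a Hilbert space with inner product (linear in the second variable) given by $\langle S,T\rangle I=\sum_i T(e_i)S(e_i)^*$, for any orthonormal basis $(e_i)$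 of $H_u$. Let $\overline L_u$ be its complex conjugate Hilbert space, with elements $\overline S$, $S\in L_u$; and for $T\in(u,v)$ let $\overline L_T:\overline L_u\to\overline L_v$ be the map $\overline S\mapsto\overline{S\circ T^*}$. A $*$-functor $F$ from $\mathrm{Rep}(G)$ to the category of Hilbert spaces and bounded linear maps is called *quasitensor* if, up to a unitary identification, $F(\iota)=\mathbb C$, and there are isometries $S_{u,v}:F(u)\otimes F(v)\to F(u\otimes v)$, $u,v\in\mathrm{Rep}(G)$, on the Hilbert space tensor products such that, with the canonical unit and associativity isomorphisms of tensor products understood, 1. $S_{u,\iota}=S_{\iota,u}=1_{F(u)}$; 2. $S_{u\otimes v,w}\circ(S_{u,v}\otimes 1_{F(w)})=S_{u,v\otimes w}\circ(1_{F(u)}\otimes S_{v,w})=:S_{u,v,w}$; 3. $E_{u\otimes v,w}\circ E_{u,v\otimes w}\le E_{u,v,w}$, where $E_{u,v}$ and $E_{u,v,w}$ are the range projections of $S_{u,v}$ and $S_{u,v,w}$; 4. $F(T\otimes T')\circ S_{u,v}=S_{u',v'}\circ(F(T)\otimes F(T'))$ for all arrows $T\in(u,u')$, $T'\in(v,v')$.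 **Theorem 7.3.** The assignment $u\mapsto\overline L_u$, $T\mapsto\overline L_T$ is a quasitensor $*$-functor from $\mathrm{Rep}(G)$ to the category of Hilbert spaces. Moreover, for every $u\in\mathrm{Rep}(G)$ the space $\overline L_u$ is finite dimensional, and $\dim\overline L_u=\dim\overline L_{\bar u}$ for every conjugate $\bar u$ of $u$. -/

import Mathlib

open scoped TensorProduct InnerProductSpace ComplexConjugate

noncomputable section

/-! ### The Hilbert space tensor product -/

/-- The tensor product of two Hilbert spaces: the completion of the algebraic tensor product. -/
def HTensor (H K : Type*) [NormedAddCommGroup H] [InnerProductSpace ℂ H]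
    [NormedAddCommGroup K] [InnerProductSpace ℂ K] : Type _ :=
  UniformSpace.Completion (H ⊗[ℂ] K)

namespace HTensor

variable {H K H' K' H'' K'' : Type*}
  [NormedAddCommGroup H] [InnerProductSpace ℂ H] [NormedAddCommGroup K] [InnerProductSpace ℂ K]
  [NormedAddCommGroup H'] [InnerProductSpace ℂ H'] [NormedAddCommGroup K'] [InnerProductSpace ℂ K']
  [NormedAddCommGroup H''] [InnerProductSpace ℂ H'']
  [NormedAddCommGroup K''] [InnerProductSpace ℂ K'']

instance : NormedAddCommGroup (HTensor H K) :=
  inferInstanceAs (NormedAddCommGroup (UniformSpace.Completion (H ⊗[ℂ] K)))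
instance : InnerProductSpace ℂ (HTensor H K) :=
  inferInstanceAs (InnerProductSpace ℂ (UniformSpace.Completion (H ⊗[ℂ] K)))
instance : CompleteSpace (HTensor H K) :=
  inferInstanceAs (CompleteSpace (UniformSpace.Completion (H ⊗[ℂ] K)))

/-- The inclusion of the algebraic tensor product, an isometry with dense range. -/
def incl : H ⊗[ℂ] K →ₗᵢ[ℂ] HTensor H K :=
  UniformSpace.Completion.toComplₗᵢ (𝕜 := ℂ) (E := H ⊗[ℂ] K)

lemma denseRange_incl : DenseRange (incl : H ⊗[ℂ] K → HTensor H K) :=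
  UniformSpace.Completion.denseRange_coe (α := H ⊗[ℂ] K)

/-- The elementary tensor `h ⊗ k`, as an element of the Hilbert space tensor product. -/
def tmul (h : H) (k : K) : HTensor H K := incl (h ⊗ₜ[ℂ] k)

/-- The tensor product `S ⊗ T` of two bounded operators. -/
def map (S : H →L[ℂ] H') (T : K →L[ℂ] K') : HTensor H K →L[ℂ] HTensor H' K' :=
  (TensorProduct.mapL S T).completion

@[simp] lemma map_incl (S : H →L[ℂ] H') (T : K →L[ℂ] K') (x : H ⊗[ℂ] K) :
    map S T (incl x) = incl (TensorProduct.mapL S T x) :=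
  (TensorProduct.mapL S T).completion_apply_coe x

@[simp] lemma map_tmul (S : H →L[ℂ] H') (T : K →L[ℂ] K') (h : H) (k : K) :
    map S T (tmul h k) = tmul (S h) (T k) := by
  simp [tmul]

lemma ext_incl {E : Type*} [TopologicalSpace E] [T2Space E] [AddCommMonoid E] [Module ℂ E]
    {S T : HTensor H K →L[ℂ] E} (h : ∀ x : H ⊗[ℂ] K, S (incl x) = T (incl x)) : S = T :=
  ContinuousLinearMap.ext fun x =>
    congrFun (denseRange_incl.equalizer S.continuous T.continuous (funext h)) x

lemma map_comp (S : H →L[ℂ] H') (T : K →L[ℂ] K') (S' : H' →L[ℂ] H'') (T' : K' →L[ℂ] K'') :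
    map (S' ∘L S) (T' ∘L T) = map S' T' ∘L map S T :=
  ext_incl fun x => by simp [TensorProduct.mapL_comp]

lemma map_mul (S S' : H →L[ℂ] H) (T T' : K →L[ℂ] K) :
    map (S * S') (T * T') = map S T * map S' T' := map_comp S' T' S T

lemma map_one : map (1 : H →L[ℂ] H) (1 : K →L[ℂ] K) = 1 :=
  ext_incl fun x => (map_incl _ _ x).trans <| by
    rw [ContinuousLinearMap.one_def, ContinuousLinearMap.one_def, TensorProduct.mapL_id_id]; rfl

lemma map_add_left (S S' : H →L[ℂ] H') (T : K →L[ℂ] K') :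
    map (S + S') T = map S T + map S' T :=
  ext_incl fun x => by simp [TensorProduct.mapL_add_left]

lemma map_add_right (S : H →L[ℂ] H') (T T' : K →L[ℂ] K') :
    map S (T + T') = map S T + map S T' :=
  ext_incl fun x => by simp [TensorProduct.mapL_add_right]

lemma map_smul_left (c : ℂ) (S : H →L[ℂ] H') (T : K →L[ℂ] K') :
    map (c • S) T = c • map S T :=
  ext_incl fun x => by simp [TensorProduct.mapL_smul_left]

lemma map_smul_right (c : ℂ) (S : H →L[ℂ] H') (T : K →L[ℂ] K') :
    map S (c • T) = c • map S T :=
  ext_incl fun x => by simp [TensorProduct.mapL_smul_right]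

lemma inner_mapL_left [CompleteSpace H] [CompleteSpace H'] [CompleteSpace K] [CompleteSpace K']
    (S : H →L[ℂ] H') (T : K →L[ℂ] K') (x : H' ⊗[ℂ] K') (y : H ⊗[ℂ] K) :
    ⟪TensorProduct.mapL S.adjoint T.adjoint x, y⟫_ℂ = ⟪x, TensorProduct.mapL S T y⟫_ℂ := by
  induction x with
  | zero => simp
  | add x x' hx hx' => simp only [map_add, inner_add_left, hx, hx']
  | tmul a b =>
    induction y with
    | zero => simp
    | add y y' hy hy' => simp only [map_add, inner_add_right, hy, hy']
    | tmul c d => simp [ContinuousLinearMap.adjoint_inner_left]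

lemma adjoint_map [CompleteSpace H] [CompleteSpace H'] [CompleteSpace K] [CompleteSpace K']
    (S : H →L[ℂ] H') (T : K →L[ℂ] K') :
    (map S T).adjoint = map S.adjoint T.adjoint := by
  symm
  rw [ContinuousLinearMap.eq_adjoint_iff]
  intro x y
  induction x using denseRange_incl.induction_on with
  | hp => exact isClosed_eq (by fun_prop) (by fun_prop)
  | ih x =>
    induction y using denseRange_incl.induction_on with
    | hp => exact isClosed_eq (by fun_prop) (by fun_prop)
    | ih y => simp only [map_incl, LinearIsometry.inner_map_map, inner_mapL_left]

end HTensor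

/-! ### The universal representation of a C*-algebra -/

section Universal

attribute [local instance] CStarAlgebra.spectralOrder CStarAlgebra.spectralOrderedRing
open scoped ComplexOrder


variable (A : Type*) [CStarAlgebra A]

/-- The Hilbert space of the universal representation: the direct sum of the GNS spaces of all
positive functionals. -/
def UnivSpace : Type _ := lp (fun φ : A →ₚ[ℂ] ℂ => φ.GNS) 2

instance : NormedAddCommGroup (UnivSpace A) :=
  inferInstanceAs (NormedAddCommGroup (lp (fun φ : A →ₚ[ℂ] ℂ => φ.GNS) 2))
instance : InnerProductSpace ℂ (UnivSpace A) :=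
  inferInstanceAs (InnerProductSpace ℂ (lp (fun φ : A →ₚ[ℂ] ℂ => φ.GNS) 2))
instance : CompleteSpace (UnivSpace A) :=
  inferInstanceAs (CompleteSpace (lp (fun φ : A →ₚ[ℂ] ℂ => φ.GNS) 2))

variable {A}

lemma gns_norm_apply_le (a : A) (φ : A →ₚ[ℂ] ℂ) (x : φ.GNS) :
    ‖φ.gnsStarAlgHom a x‖ ≤ ‖a‖ * ‖x‖ :=
  ((φ.gnsStarAlgHom a).le_opNorm x).trans
    (mul_le_mul_of_nonneg_right (NonUnitalStarAlgHom.norm_apply_le φ.gnsStarAlgHom a)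
      (norm_nonneg x))

/-- The block diagonal operator with blocks `π_φ a`. -/
def univOp (a : A) : UnivSpace A →L[ℂ] UnivSpace A :=
  LinearMap.mkContinuous
    { toFun := fun x => (⟨fun φ => φ.gnsStarAlgHom a (x.1 φ), by
        have hx : Memℓp x.1 2 := x.2
        exact (hx.norm.const_mul (‖a‖ : ℝ)).mono' fun φ => by
          have := gns_norm_apply_le a φ (x.1 φ)
          simpa using this⟩ : lp (fun φ : A →ₚ[ℂ] ℂ => φ.GNS) 2)
      map_add' := fun x y => Subtype.ext (funext fun φ => map_add (φ.gnsStarAlgHom a) _ _)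
      map_smul' := fun c x => Subtype.ext (funext fun φ => map_smul (φ.gnsStarAlgHom a) _ _) }
    ‖a‖ fun x => by
      refine lp.norm_le_of_forall_sum_le (by norm_num) (by positivity) fun s => ?_
      have h2 := lp.sum_rpow_le_norm_rpow (p := 2) (by norm_num)
        (show lp (fun φ : A →ₚ[ℂ] ℂ => φ.GNS) 2 from x) s
      simp only [ENNReal.toReal_ofNat, Real.rpow_ofNat] at h2 ⊢
      calc _ ≤ ∑ φ ∈ s, ‖a‖ ^ 2 * ‖x.1 φ‖ ^ 2 := by
            refine Finset.sum_le_sum fun φ _ => ?_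
            rw [← mul_pow]
            exact pow_le_pow_left₀ (norm_nonneg _) (gns_norm_apply_le a φ (x.1 φ)) 2
        _ = ‖a‖ ^ 2 * ∑ φ ∈ s, ‖x.1 φ‖ ^ 2 := by rw [Finset.mul_sum]
        _ ≤ ‖a‖ ^ 2 * ‖x‖ ^ 2 := mul_le_mul_of_nonneg_left h2 (by positivity)
        _ = _ := by rw [← mul_pow]

lemma univOp_apply (a : A) (x : UnivSpace A) (φ : A →ₚ[ℂ] ℂ) :
    (univOp a x).1 φ = φ.gnsStarAlgHom a (x.1 φ) := rfl

variable (A) in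
/-- The universal representation: the direct sum of the GNS representations of all positive
functionals.  It is faithful. -/
def univRep : A →⋆ₐ[ℂ] (UnivSpace A →L[ℂ] UnivSpace A) where
  toFun := univOp
  map_one' := by
    ext x; refine Subtype.ext (funext fun φ => ?_)
    rw [univOp_apply, map_one]; rfl
  map_mul' a b := by
    ext x; refine Subtype.ext (funext fun φ => ?_)
    rw [univOp_apply, map_mul]; rfl
  map_zero' := by
    ext x; refine Subtype.ext (funext fun φ => ?_)
    rw [univOp_apply, map_zero]; rfl
  map_add' a b := by
    ext x; refine Subtype.ext (funext fun φ => ?_)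
    rw [univOp_apply, map_add]; rfl
  commutes' c := by
    ext x; refine Subtype.ext (funext fun φ => ?_)
    rw [univOp_apply, AlgHomClass.commutes]; rfl
  map_star' a := by
    rw [ContinuousLinearMap.star_eq_adjoint, ContinuousLinearMap.eq_adjoint_iff]
    intro x y
    refine (lp.inner_eq_tsum (𝕜 := ℂ) _ _).trans ((tsum_congr fun φ => ?_).trans
      (lp.inner_eq_tsum (𝕜 := ℂ) _ _).symm)
    change ⟪φ.gnsStarAlgHom (star a) (x.1 φ), y.1 φ⟫_ℂ = ⟪x.1 φ, φ.gnsStarAlgHom a (y.1 φ)⟫_ℂ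
    rw [map_star, ContinuousLinearMap.star_eq_adjoint, ContinuousLinearMap.adjoint_inner_left]

end Universal

/-! ### The minimal tensor product -/

section Spatial

variable {A B : Type*} [CStarAlgebra A] [CStarAlgebra B]
variable {H K : Type*} [NormedAddCommGroup H] [InnerProductSpace ℂ H] [CompleteSpace H]
  [NormedAddCommGroup K] [InnerProductSpace ℂ K] [CompleteSpace K]

/-- The tensor product `a ⊗ b ↦ σ a ⊗ τ b` of two representations, on the algebraic tensor
product of the two C*-algebras. -/
def spatialHom (σ : A →⋆ₐ[ℂ] (H →L[ℂ] H)) (τ : B →⋆ₐ[ℂ] (K →L[ℂ] K)) :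
    A ⊗[ℂ] B →⋆ₐ[ℂ] (HTensor H K →L[ℂ] HTensor H K) :=
  { Algebra.TensorProduct.algHomOfLinearMapTensorProduct
      (TensorProduct.lift (LinearMap.mk₂ ℂ (fun a b => HTensor.map (σ a) (τ b))
        (fun _ _ _ => by simp [HTensor.map_add_left])
        (fun _ _ _ => by simp [HTensor.map_smul_left])
        (fun _ _ _ => by simp [HTensor.map_add_right])
        (fun _ _ _ => by simp [HTensor.map_smul_right])))
      (fun a a' b b' => by
        simpa using HTensor.map_mul (σ a) (σ a') (τ b) (τ b'))
      (by simpa using HTensor.map_one) with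
    map_star' := fun x => by
      induction x with
      | zero => simp
      | add x y hx hy => simp_all
      | tmul a b =>
        simp [ContinuousLinearMap.star_eq_adjoint, HTensor.adjoint_map, map_star] }

@[simp] lemma spatialHom_tmul (σ : A →⋆ₐ[ℂ] (H →L[ℂ] H)) (τ : B →⋆ₐ[ℂ] (K →L[ℂ] K))
    (a : A) (b : B) : spatialHom σ τ (a ⊗ₜ b) = HTensor.map (σ a) (τ b) := rfl

end Spatial

section MinTensor

variable (A B : Type*) [CStarAlgebra A] [CStarAlgebra B]

/-- The minimal (spatial) tensor product of two unital C*-algebras: the norm closure of the image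
of the algebraic tensor product under the tensor product of the two universal (hence faithful)
representations. -/
def minTensorSubalgebra :
    StarSubalgebra ℂ (HTensor (UnivSpace A) (UnivSpace B) →L[ℂ]
      HTensor (UnivSpace A) (UnivSpace B)) :=
  (spatialHom (univRep A) (univRep B)).range.topologicalClosure

/-- The minimal (spatial) tensor product of two unital C*-algebras. -/
abbrev MinTensor : Type _ := minTensorSubalgebra A B

instance : IsClosed (minTensorSubalgebra A B : Set (HTensor (UnivSpace A) (UnivSpace B) →L[ℂ]
      HTensor (UnivSpace A) (UnivSpace B))) :=
  StarSubalgebra.isClosed_topologicalClosure _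

instance : CStarAlgebra (MinTensor A B) :=
  StarSubalgebra.cstarAlgebra (minTensorSubalgebra A B)

variable {A B}

/-- The canonical map from the algebraic to the minimal tensor product. -/
def toMin : A ⊗[ℂ] B →⋆ₐ[ℂ] MinTensor A B :=
  (spatialHom (univRep A) (univRep B)).codRestrict (minTensorSubalgebra A B)
    fun x => StarSubalgebra.le_topologicalClosure _ ⟨x, rfl⟩

end MinTensor

/-! ### The spatial norm dominates all tensor products of representations -/

section Domination

attribute [local instance] CStarAlgebra.spectralOrder CStarAlgebra.spectralOrderedRing
open scoped ComplexOrder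

variable {A B : Type*} [CStarAlgebra A] [CStarAlgebra B]
variable {H K : Type*} [NormedAddCommGroup H] [InnerProductSpace ℂ H] [CompleteSpace H]
  [NormedAddCommGroup K] [InnerProductSpace ℂ K] [CompleteSpace K]

lemma HTensor.norm_map_isometry {H₁ : Type*} [NormedAddCommGroup H₁] [InnerProductSpace ℂ H₁]
    (W : H₁ →ₗᵢ[ℂ] H) (z : HTensor H₁ K) :
    ‖HTensor.map W.toContinuousLinearMap (1 : K →L[ℂ] K) z‖ = ‖z‖ := by
  induction z using HTensor.denseRange_incl.induction_on with
  | hp => exact isClosed_eq (by fun_prop) (by fun_prop)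
  | ih z =>
    have : TensorProduct.mapL W.toContinuousLinearMap (1 : K →L[ℂ] K) z =
      TensorProduct.mapIsometry W (LinearIsometry.id : K →ₗᵢ[ℂ] K) z := by
      rw [TensorProduct.mapL_apply, TensorProduct.mapIsometry_apply]
      rfl
    rw [HTensor.map_incl, LinearIsometry.norm_map, this, LinearIsometry.norm_map,
      LinearIsometry.norm_map]

lemma spatialHom_intertwine {H₁ : Type*} [NormedAddCommGroup H₁] [InnerProductSpace ℂ H₁]
    [CompleteSpace H₁] (σ₁ : A →⋆ₐ[ℂ] (H₁ →L[ℂ] H₁)) (σ : A →⋆ₐ[ℂ] (H →L[ℂ] H))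
    (τ : B →⋆ₐ[ℂ] (K →L[ℂ] K)) (W : H₁ →L[ℂ] H) (hW : ∀ a, W ∘L σ₁ a = σ a ∘L W)
    (x : A ⊗[ℂ] B) :
    HTensor.map W 1 ∘L spatialHom σ₁ τ x = spatialHom σ τ x ∘L HTensor.map W 1 := by
  induction x with
  | zero => simp
  | add x y hx hy =>
    rw [map_add, map_add, ContinuousLinearMap.comp_add, ContinuousLinearMap.add_comp, hx, hy]
  | tmul a b =>
    rw [spatialHom_tmul, spatialHom_tmul, ← HTensor.map_comp, ← HTensor.map_comp, hW]
    rfl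

open scoped Classical in
/-- The inclusion of one GNS space into the universal Hilbert space. -/
def gnsIncl (φ : A →ₚ[ℂ] ℂ) : φ.GNS →ₗᵢ[ℂ] UnivSpace A :=
  show φ.GNS →ₗᵢ[ℂ] lp (fun φ : A →ₚ[ℂ] ℂ => φ.GNS) 2 from
  { (lp.lsingle (𝕜 := ℂ) (E := fun φ : A →ₚ[ℂ] ℂ => φ.GNS) 2 φ) with
    norm_map' := fun x => lp.norm_single (E := fun φ : A →ₚ[ℂ] ℂ => φ.GNS) (by norm_num) φ x }

lemma gnsIncl_intertwine (φ : A →ₚ[ℂ] ℂ) (a : A) :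
    (gnsIncl φ).toContinuousLinearMap ∘L φ.gnsStarAlgHom a =
      univRep A a ∘L (gnsIncl φ).toContinuousLinearMap := by
  classical
  ext g
  refine Subtype.ext (funext fun ψ => ?_)
  change (lp.single (E := fun φ : A →ₚ[ℂ] ℂ => φ.GNS) 2 φ (φ.gnsStarAlgHom a g)) ψ =
    ψ.gnsStarAlgHom a ((lp.single (E := fun φ : A →ₚ[ℂ] ℂ => φ.GNS) 2 φ g) ψ)
  by_cases h : ψ = φ
  · subst h; rw [lp.single_apply_self, lp.single_apply_self]
  · rw [lp.single_apply_ne _ _ _ h, lp.single_apply_ne _ _ _ h, map_zero]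

/-- A vector in the space of a representation generates a copy of a GNS space. -/
lemma exists_gns_isometry (σ : A →⋆ₐ[ℂ] (H →L[ℂ] H)) (ξ : H) :
    ∃ (φ : A →ₚ[ℂ] ℂ) (W : φ.GNS →ₗᵢ[ℂ] H),
      (∀ a, W.toContinuousLinearMap ∘L φ.gnsStarAlgHom a = σ a ∘L W.toContinuousLinearMap) ∧
      ∃ g, W g = ξ := by
  let φ : A →ₚ[ℂ] ℂ := PositiveLinearMap.mk₀
    { toFun := fun a => ⟪ξ, σ a ξ⟫_ℂ
      map_add' := fun a b => by simp
      map_smul' := fun c a => by simp } (by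
      intro a ha
      obtain ⟨b, rfl⟩ := CStarAlgebra.nonneg_iff_eq_star_mul_self.mp ha
      change 0 ≤ ⟪ξ, σ (star b * b) ξ⟫_ℂ
      rw [map_mul, map_star, ContinuousLinearMap.star_eq_adjoint, mul_apply_eq_comp,
        ContinuousLinearMap.adjoint_inner_right]
      rw [inner_self_eq_norm_sq_to_K, ← RCLike.ofReal_pow]
      exact RCLike.ofReal_nonneg.mpr (sq_nonneg ‖σ b ξ‖))
  have hφ : ∀ a, φ a = ⟪ξ, σ a ξ⟫_ℂ := fun a => rfl
  have hin : ∀ a b : φ.PreGNS, ⟪σ (φ.ofPreGNS a) ξ, σ (φ.ofPreGNS b) ξ⟫_ℂ = ⟪a, b⟫_ℂ := by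
    intro a b
    rw [PositiveLinearMap.preGNS_inner_def, hφ, map_mul, map_star,
      ContinuousLinearMap.star_eq_adjoint, mul_apply_eq_comp,
      ContinuousLinearMap.adjoint_inner_right]
  have hn : ∀ a : φ.PreGNS, ‖σ (φ.ofPreGNS a) ξ‖ = ‖a‖ := by
    intro a
    have := hin a a
    rw [inner_self_eq_norm_sq_to_K, inner_self_eq_norm_sq_to_K] at this
    exact (sq_eq_sq₀ (norm_nonneg _) (norm_nonneg _)).mp (by exact_mod_cast this)
  let W₀ : φ.PreGNS →L[ℂ] H := LinearMap.mkContinuous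
    { toFun := fun a => σ (φ.ofPreGNS a) ξ
      map_add' := fun a b => by simp
      map_smul' := fun c a => by simp } 1 (fun a => by simp [hn])
  have hW₀ : ∀ a, W₀ a = σ (φ.ofPreGNS a) ξ := fun a => rfl
  let W₁ : φ.GNS →L[ℂ] H := W₀.fromCompletion
  have hW₁ : ∀ a : φ.PreGNS, W₁ a = σ (φ.ofPreGNS a) ξ := fun a =>
    W₀.fromCompletion_apply_coe a
  let W : φ.GNS →ₗᵢ[ℂ] H :=
    { W₁.toLinearMap with
      norm_map' := fun g => by
        change ‖W₁ g‖ = ‖g‖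
        induction g using UniformSpace.Completion.induction_on with
        | hp => exact isClosed_eq (by fun_prop) (by fun_prop)
        | ih a => rw [hW₁, hn, UniformSpace.Completion.norm_coe] }
  refine ⟨φ, W, fun a => ?_, ((φ.toPreGNS 1 : φ.PreGNS) : φ.GNS), ?_⟩
  · ext g
    change W₁ (φ.gnsStarAlgHom a g) = σ a (W₁ g)
    induction g using UniformSpace.Completion.induction_on with
    | hp => exact isClosed_eq (by fun_prop) (by fun_prop)
    | ih b =>
      have : φ.gnsStarAlgHom a (b : φ.GNS) = ((φ.toPreGNS (a * φ.ofPreGNS b) : φ.PreGNS) : φ.GNS) :=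
        φ.gnsNonUnitalStarAlgHom_apply_coe
      rw [this, hW₁, hW₁, PositiveLinearMap.ofPreGNS_toPreGNS, map_mul]
      rfl
  · change W₁ _ = ξ
    rw [hW₁, PositiveLinearMap.ofPreGNS_toPreGNS, map_one]
    rfl

lemma norm_spatialHom_finset_le (σ : A →⋆ₐ[ℂ] (H →L[ℂ] H)) (τ : B →⋆ₐ[ℂ] (K →L[ℂ] K))
    (x : A ⊗[ℂ] B) {ι : Type*} (s : Finset ι) (η : ι → K) (ξ : ι → H) :
    ‖spatialHom σ τ x (∑ i ∈ s, HTensor.tmul (ξ i) (η i))‖ ≤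
      ‖spatialHom (univRep A) τ x‖ * ‖∑ i ∈ s, HTensor.tmul (ξ i) (η i)‖ := by
  classical
  induction s using Finset.induction_on generalizing ξ with
  | empty => simp
  | insert i₀ s hi ih =>
    obtain ⟨φ, W, hW, g, hg⟩ := exists_gns_isometry σ (ξ i₀)
    set X := spatialHom σ τ x with hX
    set z := ∑ i ∈ insert i₀ s, HTensor.tmul (ξ i) (η i) with hz
    let Wc : φ.GNS →L[ℂ] H := W.toContinuousLinearMap
    have hWW : Wc.adjoint ∘L Wc = 1 := by
      ext1 v
      refine ext_inner_left ℂ fun w => ?_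
      rw [ContinuousLinearMap.comp_apply, ContinuousLinearMap.adjoint_inner_right]
      exact W.inner_map_map w v
    let P : H →L[ℂ] H := Wc ∘L Wc.adjoint
    have hPadj : P.adjoint = P := by
      simp [P, ContinuousLinearMap.adjoint_comp]
    have hPP : P ∘L P = P := by
      change (Wc ∘L Wc.adjoint) ∘L (Wc ∘L Wc.adjoint) = Wc ∘L Wc.adjoint
      rw [ContinuousLinearMap.comp_assoc, ← ContinuousLinearMap.comp_assoc Wc.adjoint, hWW]
      rfl
    have hPξ : P (ξ i₀) = ξ i₀ := by
      have : Wc.adjoint (Wc g) = g := congrArg (fun T : φ.GNS →L[ℂ] φ.GNS => T g) hWW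
      rw [← hg]
      change Wc (Wc.adjoint (Wc g)) = Wc g
      rw [this]
    have hWadj : ∀ a, φ.gnsStarAlgHom a ∘L Wc.adjoint = Wc.adjoint ∘L σ a := by
      intro a
      have := congrArg ContinuousLinearMap.adjoint (hW (star a))
      have h1 : φ.gnsStarAlgHom (star a) = (φ.gnsStarAlgHom a).adjoint :=
        map_star φ.gnsStarAlgHom a
      have h2 : σ (star a) = (σ a).adjoint := map_star σ a
      rw [ContinuousLinearMap.adjoint_comp, ContinuousLinearMap.adjoint_comp, h1, h2,
        ContinuousLinearMap.adjoint_adjoint, ContinuousLinearMap.adjoint_adjoint] at this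
      exact this
    have hPc : ∀ a, P ∘L σ a = σ a ∘L P := by
      intro a
      change (Wc ∘L Wc.adjoint) ∘L σ a = σ a ∘L (Wc ∘L Wc.adjoint)
      rw [ContinuousLinearMap.comp_assoc, ← hWadj, ← ContinuousLinearMap.comp_assoc, hW a,
        ContinuousLinearMap.comp_assoc]
    let Q : HTensor H K →L[ℂ] HTensor H K := HTensor.map P 1
    have hQX : Q ∘L X = X ∘L Q := spatialHom_intertwine σ σ τ P hPc x
    have hQadj : Q.adjoint = Q := by
      change (HTensor.map P 1).adjoint = HTensor.map P 1
      rw [HTensor.adjoint_map, hPadj]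
      congr 1
      exact star_one (K →L[ℂ] K)
    have hQQ : Q ∘L Q = Q := by
      change HTensor.map P 1 ∘L HTensor.map P 1 = HTensor.map P 1
      rw [← HTensor.map_comp, hPP]
      rfl
    have hsplit : ∀ v : HTensor H K, ‖v‖ ^ 2 = ‖Q v‖ ^ 2 + ‖v - Q v‖ ^ 2 := by
      intro v
      have horth : ⟪Q v, v - Q v⟫_ℂ = 0 := by
        have h1 : ⟪Q v, v - Q v⟫_ℂ = ⟪v, Q (v - Q v)⟫_ℂ := by
          rw [← ContinuousLinearMap.adjoint_inner_left, hQadj]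
        have h2 : Q (Q v) = Q v := congrArg (fun T : HTensor H K →L[ℂ] HTensor H K => T v) hQQ
        rw [h1, map_sub, h2, sub_self, inner_zero_right]
      have := norm_add_sq_eq_norm_sq_add_norm_sq_of_inner_eq_zero (𝕜 := ℂ) (Q v) (v - Q v) horth
      rw [add_sub_cancel] at this
      nlinarith [this]
    have hXQ : ∀ v, X (Q v) = Q (X v) := fun v =>
      (congrArg (fun T : HTensor H K →L[ℂ] HTensor H K => T v) hQX).symm
    set M := ‖spatialHom (univRep A) τ x‖ with hM
    have h1 : ‖X (Q z)‖ ≤ M * ‖Q z‖ := by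
      have hQz : Q z = HTensor.map Wc 1 (HTensor.map Wc.adjoint (1 : K →L[ℂ] K) z) := by
        rw [← ContinuousLinearMap.comp_apply, ← HTensor.map_comp]
        rfl
      set y := HTensor.map Wc.adjoint (1 : K →L[ℂ] K) z with hy
      have e1 : X (HTensor.map Wc 1 y) = HTensor.map Wc 1 (spatialHom φ.gnsStarAlgHom τ x y) :=
        (congrArg (fun T : HTensor φ.GNS K →L[ℂ] HTensor H K => T y)
          (spatialHom_intertwine φ.gnsStarAlgHom σ τ Wc hW x)).symm
      have e2 : HTensor.map (gnsIncl φ).toContinuousLinearMap 1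
          (spatialHom φ.gnsStarAlgHom τ x y) = spatialHom (univRep A) τ x
            (HTensor.map (gnsIncl φ).toContinuousLinearMap 1 y) :=
        congrArg (fun T : HTensor φ.GNS K →L[ℂ] HTensor (UnivSpace A) K => T y)
          (spatialHom_intertwine φ.gnsStarAlgHom (univRep A) τ _ (gnsIncl_intertwine φ) x)
      rw [hQz, e1, HTensor.norm_map_isometry, HTensor.norm_map_isometry,
        ← HTensor.norm_map_isometry (gnsIncl φ) (spatialHom φ.gnsStarAlgHom τ x y), e2]
      refine (ContinuousLinearMap.le_opNorm _ _).trans ?_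
      rw [HTensor.norm_map_isometry]
    have h2 : ‖X (z - Q z)‖ ≤ M * ‖z - Q z‖ := by
      have : z - Q z = ∑ i ∈ s, HTensor.tmul (ξ i - P (ξ i)) (η i) := by
        have hQt : ∀ i, HTensor.tmul (ξ i) (η i) - Q (HTensor.tmul (ξ i) (η i)) =
            HTensor.tmul (ξ i - P (ξ i)) (η i) := by
          intro i
          change HTensor.tmul (ξ i) (η i) - HTensor.map P 1 (HTensor.tmul (ξ i) (η i)) = _
          rw [HTensor.map_tmul]
          simp [HTensor.tmul, TensorProduct.sub_tmul]
        rw [hz, map_sum, ← Finset.sum_sub_distrib, Finset.sum_insert hi, hQt, hPξ, sub_self]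
        simp only [hQt]
        simp [HTensor.tmul]
      rw [this]
      exact ih _
    have h3 : ‖X z‖ ^ 2 ≤ (M * ‖z‖) ^ 2 := by
      have e : X (z - Q z) = X z - Q (X z) := by rw [map_sub, hXQ]
      rw [hsplit (X z), ← hXQ, mul_pow, hsplit z, mul_add, ← mul_pow, ← mul_pow, hXQ, ← e, ← hXQ]
      exact add_le_add (pow_le_pow_left₀ (norm_nonneg _) h1 2)
        (pow_le_pow_left₀ (norm_nonneg _) h2 2)
    exact (sq_le_sq₀ (norm_nonneg _) (by positivity)).mp h3

lemma norm_spatialHom_le_left (σ : A →⋆ₐ[ℂ] (H →L[ℂ] H)) (τ : B →⋆ₐ[ℂ] (K →L[ℂ] K))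
    (x : A ⊗[ℂ] B) : ‖spatialHom σ τ x‖ ≤ ‖spatialHom (univRep A) τ x‖ := by
  refine ContinuousLinearMap.opNorm_le_bound _ (norm_nonneg _) fun z => ?_
  induction z using HTensor.denseRange_incl.induction_on with
  | hp => exact isClosed_le (by fun_prop) (by fun_prop)
  | ih z =>
    obtain ⟨s, rfl⟩ := TensorProduct.exists_finset z
    rw [map_sum]
    exact norm_spatialHom_finset_le σ τ x s (fun i => i.2) (fun i => i.1)

/-- The flip of the two factors of a Hilbert space tensor product. -/
def HTensor.swap : HTensor H K →L[ℂ] HTensor K H :=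
  ((TensorProduct.commIsometry ℂ H K).toLinearIsometry.toContinuousLinearMap).completion

lemma HTensor.swap_incl (z : H ⊗[ℂ] K) :
    (HTensor.swap (incl z) : HTensor K H) = incl (TensorProduct.comm ℂ H K z) :=
  ((TensorProduct.commIsometry ℂ H K).toLinearIsometry.toContinuousLinearMap
    ).completion_apply_coe z

lemma HTensor.norm_swap (z : HTensor H K) : ‖(HTensor.swap z : HTensor K H)‖ = ‖z‖ := by
  induction z using HTensor.denseRange_incl.induction_on with
  | hp => exact isClosed_eq (by fun_prop) (by fun_prop)
  | ih z => rw [swap_incl, LinearIsometry.norm_map, LinearIsometry.norm_map,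
      TensorProduct.norm_comm]

lemma HTensor.swap_swap (z : HTensor H K) : HTensor.swap (HTensor.swap z : HTensor K H) = z := by
  induction z using HTensor.denseRange_incl.induction_on with
  | hp => exact isClosed_eq (by fun_prop) (by fun_prop)
  | ih z => rw [swap_incl, swap_incl]; simp

lemma HTensor.swap_map (S : H →L[ℂ] H) (T : K →L[ℂ] K) (z : HTensor H K) :
    HTensor.swap (HTensor.map S T z) = HTensor.map T S (HTensor.swap z : HTensor K H) := by
  induction z using HTensor.denseRange_incl.induction_on with
  | hp => exact isClosed_eq (by fun_prop) (by fun_prop)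
  | ih z =>
    rw [map_incl, swap_incl, swap_incl, map_incl]
    congr 1
    simp [TensorProduct.map_comm]

lemma spatialHom_comm (σ : A →⋆ₐ[ℂ] (H →L[ℂ] H)) (τ : B →⋆ₐ[ℂ] (K →L[ℂ] K))
    (x : A ⊗[ℂ] B) (z : HTensor H K) :
    spatialHom τ σ (TensorProduct.comm ℂ A B x) (HTensor.swap z : HTensor K H) =
      HTensor.swap (spatialHom σ τ x z) := by
  induction x with
  | zero => simp
  | add x y hx hy => simp only [map_add, add_apply, hx, hy]
  | tmul a b => rw [TensorProduct.comm_tmul, spatialHom_tmul, spatialHom_tmul, HTensor.swap_map]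

lemma norm_spatialHom_comm (σ : A →⋆ₐ[ℂ] (H →L[ℂ] H)) (τ : B →⋆ₐ[ℂ] (K →L[ℂ] K))
    (x : A ⊗[ℂ] B) :
    ‖spatialHom τ σ (TensorProduct.comm ℂ A B x)‖ = ‖spatialHom σ τ x‖ := by
  refine le_antisymm ?_ ?_
  · refine ContinuousLinearMap.opNorm_le_bound _ (norm_nonneg _) fun z => ?_
    rw [← HTensor.swap_swap z, spatialHom_comm, HTensor.norm_swap, HTensor.norm_swap]
    exact ContinuousLinearMap.le_opNorm _ _
  · refine ContinuousLinearMap.opNorm_le_bound _ (norm_nonneg _) fun z => ?_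
    rw [← HTensor.norm_swap, ← spatialHom_comm, ← HTensor.norm_swap z]
    exact ContinuousLinearMap.le_opNorm _ _

/-- The norm of the minimal tensor product dominates the norm coming from any pair of
representations. -/
lemma norm_spatialHom_le (σ : A →⋆ₐ[ℂ] (H →L[ℂ] H)) (τ : B →⋆ₐ[ℂ] (K →L[ℂ] K))
    (x : A ⊗[ℂ] B) : ‖spatialHom σ τ x‖ ≤ ‖toMin x‖ := by
  refine (norm_spatialHom_le_left σ τ x).trans ?_
  rw [← norm_spatialHom_comm]
  refine (norm_spatialHom_le_left τ (univRep A) _).trans ?_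
  rw [norm_spatialHom_comm]
  rfl

lemma denseRange_toMin : DenseRange (toMin : A ⊗[ℂ] B → MinTensor A B) := by
  intro y
  rw [closure_subtype]
  have h : (Subtype.val '' Set.range (toMin : A ⊗[ℂ] B → MinTensor A B)) =
      ((spatialHom (univRep A) (univRep B)).range : Set _) := by
    ext T; constructor
    · rintro ⟨_, ⟨x, rfl⟩, rfl⟩; exact ⟨x, rfl⟩
    · rintro ⟨x, rfl⟩; exact ⟨_, ⟨x, rfl⟩, rfl⟩
  rw [h]
  exact y.2

/-- The tensor product `σ ⊗ τ` of two representations, on the minimal tensor product: the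
continuous extension of `a ⊗ b ↦ σ a ⊗ τ b`. -/
def minRep (σ : A →⋆ₐ[ℂ] (H →L[ℂ] H)) (τ : B →⋆ₐ[ℂ] (K →L[ℂ] K)) :
    MinTensor A B →L[ℂ] (HTensor H K →L[ℂ] HTensor H K) :=
  (spatialHom σ τ).toLinearMap.extendOfNorm (toMin : A ⊗[ℂ] B →⋆ₐ[ℂ] MinTensor A B).toLinearMap

lemma minRep_toMin (σ : A →⋆ₐ[ℂ] (H →L[ℂ] H)) (τ : B →⋆ₐ[ℂ] (K →L[ℂ] K))
    (x : A ⊗[ℂ] B) : minRep σ τ (toMin x) = spatialHom σ τ x :=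
  LinearMap.extendOfNorm_eq denseRange_toMin
    ⟨1, fun x => by rw [one_mul]; exact norm_spatialHom_le σ τ x⟩ x

end Domination

/-! ### Compact quantum groups and their actions -/

section QuantumGroups

/-- The coaction identity `(η ⊗ ι) ∘ η = (ι ⊗ Δ) ∘ η`.  Both sides take values in the minimal
tensor product `B ⊗ A ⊗ A`, represented faithfully on the tensor product of the universal Hilbert
spaces; the two bounded operators are compared through their matrix elements between elementary
tensors, under the canonical identification of `(h ⊗ k) ⊗ l` with `h ⊗ (k ⊗ l)`. -/
def IsCoaction {A B : Type*} [CStarAlgebra A] [CStarAlgebra B]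
    (Δ : A →⋆ₐ[ℂ] MinTensor A A) (η : B →⋆ₐ[ℂ] MinTensor B A) : Prop :=
  ∀ (b : B) (h h' : UnivSpace B) (k k' l l' : UnivSpace A),
    ⟪HTensor.tmul (HTensor.tmul h k) l,
      minRep ((minTensorSubalgebra B A).subtype.comp η) (univRep A) (η b)
        (HTensor.tmul (HTensor.tmul h' k') l')⟫_ℂ =
    ⟪HTensor.tmul h (HTensor.tmul k l),
      minRep (univRep B) ((minTensorSubalgebra A A).subtype.comp Δ) (η b)
        (HTensor.tmul h' (HTensor.tmul k' l'))⟫_ℂ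

/-- A compact quantum group `G = (A, Δ)` in the sense of Woronowicz. -/
structure CompactQuantumGroup (A : Type*) [CStarAlgebra A] where
  /-- the coproduct, a unital *-homomorphism -/
  comul : A →⋆ₐ[ℂ] MinTensor A A
  coassoc : IsCoaction comul comul
  dense_left : Dense (Submodule.span ℂ
    {x : MinTensor A A | ∃ b c : A, x = toMin (b ⊗ₜ[ℂ] (1 : A)) * comul c} : Set (MinTensor A A))
  dense_right : Dense (Submodule.span ℂ
    {x : MinTensor A A | ∃ b c : A, x = toMin ((1 : A) ⊗ₜ[ℂ] b) * comul c} : Set (MinTensor A A))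

variable {A : Type*} [CStarAlgebra A]

/-- An action `η : B → B ⊗ A` of a compact quantum group on a unital C*-algebra. -/
structure QAction (G : CompactQuantumGroup A) (B : Type*) [CStarAlgebra B] where
  /-- the underlying unital *-homomorphism -/
  toHom : B →⋆ₐ[ℂ] MinTensor B A
  coaction : IsCoaction G.comul toHom

namespace QAction

variable {G : CompactQuantumGroup A} {B : Type*} [CStarAlgebra B]

/-- The action is nondegenerate: `η(B)(1 ⊗ A)` spans a dense subspace of `B ⊗ A`. -/
def IsNondegenerate (η : QAction G B) : Prop :=
  Dense (Submodule.span ℂ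
    {x : MinTensor B A | ∃ (b : B) (a : A), x = η.toHom b * toMin ((1 : B) ⊗ₜ[ℂ] a)} :
      Set (MinTensor B A))

/-- The action is ergodic: the only fixed points are the scalars. -/
class IsErgodic (η : QAction G B) : Prop where
  fixed_scalar : ∀ b : B, η.toHom b = toMin (b ⊗ₜ[ℂ] (1 : A)) → ∃ c : ℂ, b = c • (1 : B)

end QAction

/-! ### Finite dimensional unitary representations -/

section Coeff

variable {H : Type*} [NormedAddCommGroup H] [InnerProductSpace ℂ H]

/-- The map `ℓ_φ^* : H ⊗ A → A`, `ψ ⊗ a ↦ ⟪φ, ψ⟫ a`. -/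
def slice (φ : H) : H ⊗[ℂ] A →ₗ[ℂ] A :=
  (TensorProduct.lid ℂ A).toLinearMap ∘ₗ (innerₛₗ ℂ φ).rTensor A

@[simp] lemma slice_tmul (φ ψ : H) (a : A) : slice φ (ψ ⊗ₜ[ℂ] a) = ⟪φ, ψ⟫_ℂ • a := rfl

lemma slice_add (φ φ' : H) (x : H ⊗[ℂ] A) : slice (φ + φ') x = slice φ x + slice φ' x := by
  induction x with
  | zero => simp
  | add x y hx hy => simp only [map_add, hx, hy]; abel
  | tmul ψ a => simp [add_smul]

lemma slice_smul (c : ℂ) (φ : H) (x : H ⊗[ℂ] A) : slice (c • φ) x = conj c • slice φ x := by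
  induction x with
  | zero => simp
  | add x y hx hy => simp only [map_add, hx, hy, smul_add]
  | tmul ψ a => rw [slice_tmul, slice_tmul, inner_smul_left, mul_smul]

/-- The matrix coefficient `u_{φ,ψ} = ℓ_φ^* u(ψ)`, antilinear in `φ` and linear in `ψ`. -/
def coeff (u : H →ₗ[ℂ] H ⊗[ℂ] A) (φ ψ : H) : A := slice φ (u ψ)

lemma eq_sum_slice {ι : Type*} [Fintype ι] (e : OrthonormalBasis ι ℂ H) (x : H ⊗[ℂ] A) :
    x = ∑ i, e i ⊗ₜ[ℂ] slice (e i) x := by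
  induction x with
  | zero => simp
  | add x y hx hy =>
    conv_lhs => rw [hx, hy]
    simp [TensorProduct.tmul_add, Finset.sum_add_distrib]
  | tmul ψ a =>
    conv_lhs => rw [← e.sum_repr' ψ]
    simp [TensorProduct.sum_tmul, TensorProduct.smul_tmul]

lemma ext_slice [FiniteDimensional ℂ H] {x y : H ⊗[ℂ] A} (h : ∀ φ : H, slice φ x = slice φ y) :
    x = y := by
  rw [eq_sum_slice (stdOrthonormalBasis ℂ H) x, eq_sum_slice (stdOrthonormalBasis ℂ H) y]
  simp only [h]

lemma slice_rTensor {K : Type*} [NormedAddCommGroup K] [InnerProductSpace ℂ K]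
    [FiniteDimensional ℂ H] [FiniteDimensional ℂ K]
    (T : H →ₗ[ℂ] K) (φ : K) (x : H ⊗[ℂ] A) :
    slice φ (T.rTensor A x) = slice (T.adjoint φ) x := by
  induction x with
  | zero => simp
  | add x y hx hy => simp only [map_add, hx, hy]
  | tmul ψ a => simp [LinearMap.adjoint_inner_left]

/-- Sums of sesquilinear expressions over an orthonormal basis do not depend on the basis. -/
lemma sum_onb_eq {M : Type*} [AddCommGroup M] [Module ℂ M] (F : H → H → M)
    (hadd₁ : ∀ x x' y, F (x + x') y = F x y + F x' y)
    (hsmul₁ : ∀ (c : ℂ) x y, F (c • x) y = conj c • F x y)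
    (hadd₂ : ∀ x y y', F x (y + y') = F x y + F x y')
    (hsmul₂ : ∀ (c : ℂ) x y, F x (c • y) = c • F x y)
    {ι κ : Type*} [Fintype ι] [Fintype κ] (e : OrthonormalBasis ι ℂ H)
    (f : OrthonormalBasis κ ℂ H) : ∑ i, F (e i) (e i) = ∑ j, F (f j) (f j) := by
  let Φ : H →ₗ⋆[ℂ] H →ₗ[ℂ] M := LinearMap.mk₂'ₛₗ _ _ F hadd₁ hsmul₁ hadd₂ hsmul₂
  have hΦ : ∀ x y, F x y = Φ x y := fun _ _ => rfl
  simp only [hΦ]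
  calc ∑ i, Φ (e i) (e i) = ∑ i, ∑ j, ⟪f j, e i⟫_ℂ • Φ (e i) (f j) := by
        refine Finset.sum_congr rfl fun i _ => ?_
        conv_lhs => rw [← f.sum_repr' (e i)]
        rw [map_sum]
        simp only [map_smul]
        rw [f.sum_repr' (e i)]
    _ = ∑ j, Φ (∑ i, ⟪e i, f j⟫_ℂ • e i) (f j) := by
        rw [Finset.sum_comm]
        refine Finset.sum_congr rfl fun j _ => ?_
        rw [map_sum, LinearMap.sum_apply]
        refine Finset.sum_congr rfl fun i _ => ?_
        rw [LinearMap.map_smulₛₗ, LinearMap.smul_apply, inner_conj_symm]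
    _ = _ := by simp only [e.sum_repr']

variable (u : H →ₗ[ℂ] H ⊗[ℂ] A)

lemma coeff_add_left (φ φ' ψ : H) : coeff u (φ + φ') ψ = coeff u φ ψ + coeff u φ' ψ :=
  slice_add _ _ _
lemma coeff_smul_left (c : ℂ) (φ ψ : H) : coeff u (c • φ) ψ = conj c • coeff u φ ψ :=
  slice_smul _ _ _
lemma coeff_add_right (φ ψ ψ' : H) : coeff u φ (ψ + ψ') = coeff u φ ψ + coeff u φ ψ' := by
  simp [coeff]
lemma coeff_smul_right (c : ℂ) (φ ψ : H) : coeff u φ (c • ψ) = c • coeff u φ ψ := by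
  simp [coeff]

variable {ι κ : Type*} [Fintype ι] [Fintype κ] (e : OrthonormalBasis ι ℂ H)
    (f : OrthonormalBasis κ ℂ H)

lemma coeff_expand_left (φ ψ : H) : coeff u φ ψ = ∑ i, ⟪φ, e i⟫_ℂ • coeff u (e i) ψ := by
  let L : H →ₗ⋆[ℂ] A :=
    { toFun := fun x => coeff u x ψ
      map_add' := fun x y => coeff_add_left u x y ψ
      map_smul' := fun c x => coeff_smul_left u c x ψ }
  change L φ = _
  conv_lhs => rw [← e.sum_repr' φ]
  rw [map_sum]
  refine Finset.sum_congr rfl fun i _ => ?_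
  rw [LinearMap.map_smulₛₗ, inner_conj_symm]
  rfl

lemma coeff_expand_right (φ ψ : H) : coeff u φ ψ = ∑ i, ⟪e i, ψ⟫_ℂ • coeff u φ (e i) := by
  let L : H →ₗ[ℂ] A := slice φ ∘ₗ u
  change L ψ = ∑ i, _ • L (e i)
  conv_lhs => rw [← e.sum_repr' ψ]
  rw [map_sum]
  simp only [map_smul]

lemma sum_isometry_eq (φ ψ : H) :
    ∑ i, star (coeff u (e i) φ) * coeff u (e i) ψ =
      ∑ j, star (coeff u (f j) φ) * coeff u (f j) ψ :=
  sum_onb_eq (fun x y => star (coeff u y φ) * coeff u x ψ)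
    (by intros; simp only [coeff_add_left, mul_add])
    (by intros; simp only [coeff_smul_left, mul_smul_comm])
    (by intros; simp only [coeff_add_left, star_add, add_mul])
    (by intros; simp only [coeff_smul_left, star_smul, smul_mul_assoc]; simp) e f

lemma sum_coisometry_eq (φ ψ : H) :
    ∑ i, coeff u φ (e i) * star (coeff u ψ (e i)) =
      ∑ j, coeff u φ (f j) * star (coeff u ψ (f j)) :=
  sum_onb_eq (fun x y => coeff u φ y * star (coeff u ψ x))
    (by intros; simp only [coeff_add_right, star_add, mul_add])
    (by intros; simp only [coeff_smul_right, star_smul, mul_smul_comm]; rfl)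
    (by intros; simp only [coeff_add_right, add_mul])
    (by intros; simp only [coeff_smul_right, smul_mul_assoc]) e f

lemma sum_comul_eq (φ ψ : H) :
    ∑ i, (toMin (coeff u φ (e i) ⊗ₜ[ℂ] coeff u (e i) ψ) : MinTensor A A) =
      ∑ j, toMin (coeff u φ (f j) ⊗ₜ[ℂ] coeff u (f j) ψ) :=
  sum_onb_eq (fun x y => (toMin (coeff u φ y ⊗ₜ[ℂ] coeff u x ψ) : MinTensor A A))
    (by intros; simp only [coeff_add_left, TensorProduct.tmul_add, map_add])
    (by intros; simp only [coeff_smul_left, TensorProduct.tmul_smul, map_smul])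
    (by intros; simp only [coeff_add_right, TensorProduct.add_tmul, map_add])
    (by intros; simp only [coeff_smul_right, ← TensorProduct.smul_tmul', map_smul]) e f

end Coeff

/-- An object of `Rep(G)`: a unitary representation `u : H → H ⊗ A` on a finite dimensional
Hilbert space.  In terms of an orthonormal basis `(e_i)`, the matrix of coefficients `(u_{ij})` is
unitary and `Δ(u_{ij}) = ∑ u_{ik} ⊗ u_{kj}`. -/
structure UnitaryRep (G : CompactQuantumGroup A) where
  /-- the Hilbert space of the representation -/
  H : Type
  [instN : NormedAddCommGroup H]
  [instI : InnerProductSpace ℂ H]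
  [instF : FiniteDimensional ℂ H]
  /-- the coaction on the Hilbert space -/
  u : H →ₗ[ℂ] H ⊗[ℂ] A
  isometry : ∀ φ ψ : H, ∑ i, star (coeff u (stdOrthonormalBasis ℂ H i) φ) *
    coeff u (stdOrthonormalBasis ℂ H i) ψ = ⟪φ, ψ⟫_ℂ • (1 : A)
  coisometry : ∀ φ ψ : H, ∑ i, coeff u φ (stdOrthonormalBasis ℂ H i) *
    star (coeff u ψ (stdOrthonormalBasis ℂ H i)) = ⟪φ, ψ⟫_ℂ • (1 : A)
  comul_coeff : ∀ φ ψ : H, G.comul (coeff u φ ψ) =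
    ∑ i, toMin (coeff u φ (stdOrthonormalBasis ℂ H i) ⊗ₜ[ℂ]
      coeff u (stdOrthonormalBasis ℂ H i) ψ)

attribute [instance] UnitaryRep.instN UnitaryRep.instI UnitaryRep.instF

namespace UnitaryRep

variable {G : CompactQuantumGroup A}

section
variable (u : UnitaryRep G) {ι : Type*} [Fintype ι] (e : OrthonormalBasis ι ℂ u.H) (φ ψ : u.H)

lemma sum_isometry : ∑ i, star (coeff u.u (e i) φ) * coeff u.u (e i) ψ = ⟪φ, ψ⟫_ℂ • (1 : A) :=
  (sum_isometry_eq u.u e _ φ ψ).trans (u.isometry φ ψ)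

lemma sum_coisometry : ∑ i, coeff u.u φ (e i) * star (coeff u.u ψ (e i)) = ⟪φ, ψ⟫_ℂ • (1 : A) :=
  (sum_coisometry_eq u.u e _ φ ψ).trans (u.coisometry φ ψ)

lemma sum_comul : G.comul (coeff u.u φ ψ) =
    ∑ i, toMin (coeff u.u φ (e i) ⊗ₜ[ℂ] coeff u.u (e i) ψ) :=
  (u.comul_coeff φ ψ).trans (sum_comul_eq u.u e _ φ ψ).symm

end

/-- The trivial representation `ι`, on the Hilbert space `ℂ`. -/
abbrev trivial (G : CompactQuantumGroup A) : UnitaryRep G where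
  H := ℂ
  u := (TensorProduct.mk ℂ ℂ A).flip 1
  isometry φ ψ := by
    rw [sum_isometry_eq _ _ (OrthonormalBasis.singleton (Fin 1) ℂ)]
    simp [coeff, smul_smul]
  coisometry φ ψ := by
    rw [sum_coisometry_eq _ _ (OrthonormalBasis.singleton (Fin 1) ℂ)]
    simp [coeff, smul_smul]
  comul_coeff φ ψ := by
    rw [sum_comul_eq _ _ (OrthonormalBasis.singleton (Fin 1) ℂ)]
    have h1 : (toMin ((1 : A) ⊗ₜ[ℂ] (1 : A)) : MinTensor A A) = 1 := map_one toMin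
    simp [coeff, TensorProduct.tmul_smul, ← TensorProduct.smul_tmul', h1, smul_smul]

section Tensor

variable {H K : Type*} [NormedAddCommGroup H] [InnerProductSpace ℂ H]
  [NormedAddCommGroup K] [InnerProductSpace ℂ K]

/-- The multiplication `(ψ ⊗ a) ⊗ (ψ' ⊗ b) ↦ (ψ ⊗ ψ') ⊗ a b`. -/
def mulLegs (H K A : Type*) [AddCommGroup H] [Module ℂ H] [AddCommGroup K] [Module ℂ K]
    [Ring A] [Algebra ℂ A] :
    (H ⊗[ℂ] A) ⊗[ℂ] (K ⊗[ℂ] A) →ₗ[ℂ] (H ⊗[ℂ] K) ⊗[ℂ] A :=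
  (LinearMap.mul' ℂ A).lTensor (H ⊗[ℂ] K) ∘ₗ
    (TensorProduct.tensorTensorTensorComm ℂ H A K A).toLinearMap

@[simp] lemma mulLegs_tmul (h : H) (k : K) (a b : A) :
    mulLegs H K A ((h ⊗ₜ a) ⊗ₜ (k ⊗ₜ b)) = (h ⊗ₜ k) ⊗ₜ (a * b) := rfl

lemma slice_mulLegs (φ : H) (φ' : K) (x : H ⊗[ℂ] A) (y : K ⊗[ℂ] A) :
    slice (φ ⊗ₜ[ℂ] φ') (mulLegs H K A (x ⊗ₜ y)) = slice φ x * slice φ' y := by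
  induction x with
  | zero => simp
  | add x x' hx hx' => simp only [TensorProduct.add_tmul, map_add, hx, hx', add_mul]
  | tmul h a =>
    induction y with
    | zero => simp
    | add y y' hy hy' => simp only [TensorProduct.tmul_add, map_add, hy, hy', mul_add]
    | tmul k b => simp [smul_smul, mul_comm]

lemma rTensor_map_mulLegs {H' K' : Type*} [NormedAddCommGroup H'] [InnerProductSpace ℂ H']
    [NormedAddCommGroup K'] [InnerProductSpace ℂ K'] (S : H →ₗ[ℂ] H') (T : K →ₗ[ℂ] K')
    (x : H ⊗[ℂ] A) (y : K ⊗[ℂ] A) :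
    (TensorProduct.map S T).rTensor A (mulLegs H K A (x ⊗ₜ y)) =
      mulLegs H' K' A (S.rTensor A x ⊗ₜ T.rTensor A y) := by
  induction x with
  | zero => simp
  | add x x' hx hx' => simp only [TensorProduct.add_tmul, map_add, hx, hx']
  | tmul h a =>
    induction y with
    | zero => simp
    | add y y' hy hy' => simp only [TensorProduct.tmul_add, map_add, hy, hy']
    | tmul k b => simp

lemma rTensor_assoc_mulLegs {L : Type*} [NormedAddCommGroup L] [InnerProductSpace ℂ L]
    (x : H ⊗[ℂ] A) (y : K ⊗[ℂ] A) (z : L ⊗[ℂ] A) :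
    (TensorProduct.assoc ℂ H K L).toLinearMap.rTensor A
      (mulLegs (H ⊗[ℂ] K) L A (mulLegs H K A (x ⊗ₜ y) ⊗ₜ z)) =
    mulLegs H (K ⊗[ℂ] L) A (x ⊗ₜ mulLegs K L A (y ⊗ₜ z)) := by
  induction x with
  | zero => simp
  | add x x' hx hx' => simp only [TensorProduct.add_tmul, map_add, hx, hx']
  | tmul h a =>
    induction y with
    | zero => simp
    | add y y' hy hy' => simp only [TensorProduct.add_tmul, TensorProduct.tmul_add, map_add, hy, hy']
    | tmul k b =>
      induction z with
      | zero => simp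
      | add z z' hz hz' => simp only [TensorProduct.tmul_add, map_add, hz, hz']
      | tmul l c => simp [mul_assoc]

/-- The map underlying a tensor product representation. -/
def tensorCoact (u : H →ₗ[ℂ] H ⊗[ℂ] A) (v : K →ₗ[ℂ] K ⊗[ℂ] A) :
    H ⊗[ℂ] K →ₗ[ℂ] (H ⊗[ℂ] K) ⊗[ℂ] A :=
  mulLegs H K A ∘ₗ TensorProduct.map u v

@[simp] lemma coeff_tensorCoact (u : H →ₗ[ℂ] H ⊗[ℂ] A) (v : K →ₗ[ℂ] K ⊗[ℂ] A)
    (φ ψ : H) (φ' ψ' : K) :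
    coeff (tensorCoact u v) (φ ⊗ₜ φ') (ψ ⊗ₜ ψ') = coeff u φ ψ * coeff v φ' ψ' :=
  slice_mulLegs _ _ _ _

end Tensor

/-- The tensor product representation, with coefficients
`(u ⊗ v)_{φ ⊗ φ', ψ ⊗ ψ'} = u_{φ,ψ} v_{φ',ψ'}`. -/
abbrev tensor (u v : UnitaryRep G) : UnitaryRep G where
  H := u.H ⊗[ℂ] v.H
  u := tensorCoact u.u v.u
  isometry φ ψ := by
    rw [sum_isometry_eq _ _ ((stdOrthonormalBasis ℂ u.H).tensorProduct (stdOrthonormalBasis ℂ v.H))]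
    induction φ with
    | zero => simp [coeff]
    | add φ φ' h h' =>
      simp only [coeff_add_right, star_add, add_mul, Finset.sum_add_distrib, h, h',
        inner_add_left, add_smul]
    | tmul φ φ' =>
      induction ψ with
      | zero => simp [coeff]
      | add ψ ψ' h h' =>
        simp only [coeff_add_right, mul_add, Finset.sum_add_distrib, h, h',
          inner_add_right, add_smul]
      | tmul ψ ψ' =>
        rw [Fintype.sum_prod_type_right]
        simp only [OrthonormalBasis.tensorProduct_apply, coeff_tensorCoact, star_mul,
          TensorProduct.inner_tmul]
        calc _ = ∑ j, star (coeff v.u (stdOrthonormalBasis ℂ v.H j) φ') *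
              (∑ i, star (coeff u.u (stdOrthonormalBasis ℂ u.H i) φ) *
                coeff u.u (stdOrthonormalBasis ℂ u.H i) ψ) *
              coeff v.u (stdOrthonormalBasis ℂ v.H j) ψ' := by
              simp only [Finset.mul_sum, Finset.sum_mul, mul_assoc]
          _ = _ := by
              simp only [u.isometry, mul_smul_comm, mul_one, smul_mul_assoc, ← Finset.smul_sum,
                v.isometry, smul_smul]
  coisometry φ ψ := by
    rw [sum_coisometry_eq _ _
      ((stdOrthonormalBasis ℂ u.H).tensorProduct (stdOrthonormalBasis ℂ v.H))]
    induction φ with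
    | zero => simp [coeff, slice]
    | add φ φ' h h' =>
      simp only [coeff_add_left, add_mul, Finset.sum_add_distrib, h, h',
        inner_add_left, add_smul]
    | tmul φ φ' =>
      induction ψ with
      | zero => simp [coeff, slice]
      | add ψ ψ' h h' =>
        simp only [coeff_add_left, star_add, mul_add, Finset.sum_add_distrib, h, h',
          inner_add_right, add_smul]
      | tmul ψ ψ' =>
        rw [Fintype.sum_prod_type]
        simp only [OrthonormalBasis.tensorProduct_apply, coeff_tensorCoact, star_mul,
          TensorProduct.inner_tmul]
        calc _ = ∑ i, coeff u.u φ (stdOrthonormalBasis ℂ u.H i) *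
              (∑ j, coeff v.u φ' (stdOrthonormalBasis ℂ v.H j) *
                star (coeff v.u ψ' (stdOrthonormalBasis ℂ v.H j))) *
              star (coeff u.u ψ (stdOrthonormalBasis ℂ u.H i)) := by
              simp only [Finset.mul_sum, Finset.sum_mul, mul_assoc]
          _ = _ := by
              simp only [v.coisometry, mul_smul_comm, mul_one, smul_mul_assoc, ← Finset.smul_sum,
                u.coisometry, smul_smul, mul_comm]
  comul_coeff φ ψ := by
    rw [sum_comul_eq _ _
      ((stdOrthonormalBasis ℂ u.H).tensorProduct (stdOrthonormalBasis ℂ v.H))]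
    induction φ with
    | zero => simp [coeff, slice]
    | add φ φ' h h' =>
      simp only [coeff_add_left, map_add, TensorProduct.add_tmul, Finset.sum_add_distrib, h, h']
    | tmul φ φ' =>
      induction ψ with
      | zero => simp [coeff]
      | add ψ ψ' h h' =>
        simp only [coeff_add_right, map_add, TensorProduct.tmul_add, Finset.sum_add_distrib, h, h']
      | tmul ψ ψ' =>
        rw [Fintype.sum_prod_type]
        simp only [OrthonormalBasis.tensorProduct_apply, coeff_tensorCoact, map_mul,
          u.comul_coeff, v.comul_coeff, Finset.sum_mul, Finset.mul_sum]
        rw [Finset.sum_comm]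
        refine Finset.sum_congr rfl fun i _ => ?_
        refine Finset.sum_congr rfl fun j _ => ?_
        rw [← map_mul, Algebra.TensorProduct.tmul_mul_tmul]

/-- The arrows of `Rep(G)`: the space `(u, v)` of linear maps `T` with `(T ⊗ I) ∘ u = v ∘ T`. -/
def Hom (u v : UnitaryRep G) : Submodule ℂ (u.H →ₗ[ℂ] v.H) where
  carrier := {T | T.rTensor A ∘ₗ u.u = v.u ∘ₗ T}
  add_mem' {S T} hS hT := by
    change (S + T).rTensor A ∘ₗ u.u = v.u ∘ₗ (S + T)
    rw [LinearMap.rTensor_add, LinearMap.add_comp, LinearMap.comp_add, hS, hT]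
  zero_mem' := by
    change LinearMap.rTensor A (0 : u.H →ₗ[ℂ] v.H) ∘ₗ u.u = v.u ∘ₗ (0 : u.H →ₗ[ℂ] v.H)
    rw [LinearMap.rTensor_zero, LinearMap.zero_comp, LinearMap.comp_zero]
  smul_mem' c {T} hT := by
    change (c • T).rTensor A ∘ₗ u.u = v.u ∘ₗ (c • T)
    rw [LinearMap.rTensor_smul, LinearMap.smul_comp, LinearMap.comp_smul, hT]

namespace Hom

variable {u v w z u' v' : UnitaryRep G}

lemma mem_iff {T : u.H →ₗ[ℂ] v.H} : T ∈ Hom u v ↔ T.rTensor A ∘ₗ u.u = v.u ∘ₗ T := Iff.rfl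

lemma mem_iff_coeff {T : u.H →ₗ[ℂ] v.H} :
    T ∈ Hom u v ↔ ∀ (φ : v.H) (ψ : u.H), coeff u.u (T.adjoint φ) ψ = coeff v.u φ (T ψ) := by
  rw [mem_iff]
  constructor
  · intro h φ ψ
    rw [coeff, ← slice_rTensor]
    exact congrArg (fun S : u.H →ₗ[ℂ] v.H ⊗[ℂ] A => slice φ (S ψ)) h
  · intro h
    ext1 ψ
    refine ext_slice fun φ => ?_
    rw [LinearMap.comp_apply, slice_rTensor]
    exact h φ ψ

/-- The identity arrow. -/
def id (u : UnitaryRep G) : Hom u u := ⟨LinearMap.id, by simp [mem_iff]⟩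

/-- Composition of arrows. -/
def comp (S : Hom v w) (T : Hom u v) : Hom u w := ⟨S.1 ∘ₗ T.1, by
  rw [mem_iff, LinearMap.rTensor_comp, LinearMap.comp_assoc, T.2, ← LinearMap.comp_assoc, S.2]
  rfl⟩

/-- The *-operation on arrows: the Hilbert space adjoint. -/
def adj (T : Hom u v) : Hom v u := ⟨T.1.adjoint, by
  rw [mem_iff_coeff]
  intro φ ψ
  rw [LinearMap.adjoint_adjoint]
  let e := stdOrthonormalBasis ℂ u.H
  let f := stdOrthonormalBasis ℂ v.H
  have hT := mem_iff_coeff.mp T.2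
  calc coeff v.u (T.1 φ) ψ = ∑ m, ⟪T.1 φ, f m⟫_ℂ • coeff v.u (f m) ψ := coeff_expand_left _ f _ _
    _ = ∑ m, (∑ i, coeff u.u φ (e i) * star (coeff u.u (T.1.adjoint (f m)) (e i))) *
          coeff v.u (f m) ψ := by
        refine Finset.sum_congr rfl fun m _ => ?_
        rw [u.sum_coisometry e, LinearMap.adjoint_inner_right, smul_mul_assoc, one_mul]
    _ = ∑ i, coeff u.u φ (e i) *
          ∑ m, star (coeff v.u (f m) (T.1 (e i))) * coeff v.u (f m) ψ := by
        simp only [Finset.sum_mul, Finset.mul_sum, hT, mul_assoc]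
        exact Finset.sum_comm
    _ = ∑ i, ⟪e i, T.1.adjoint ψ⟫_ℂ • coeff u.u φ (e i) := by
        refine Finset.sum_congr rfl fun i _ => ?_
        rw [v.sum_isometry f, LinearMap.adjoint_inner_right, mul_smul_comm, mul_one]
    _ = coeff u.u φ (T.1.adjoint ψ) := (coeff_expand_right _ e _ _).symm⟩

/-- The tensor product of arrows. -/
def tensor (S : Hom u u') (T : Hom v v') : Hom (u.tensor v) (u'.tensor v') :=
  ⟨TensorProduct.map S.1 T.1, by
    rw [mem_iff]
    refine TensorProduct.ext' fun ψ ψ' => ?_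
    change (TensorProduct.map S.1 T.1).rTensor A (mulLegs _ _ _ (u.u ψ ⊗ₜ v.u ψ')) =
      mulLegs _ _ _ (u'.u (S.1 ψ) ⊗ₜ v'.u (T.1 ψ'))
    rw [rTensor_map_mulLegs]
    congr 2
    · exact LinearMap.congr_fun S.2 ψ
    · exact LinearMap.congr_fun T.2 ψ'⟩

/-- The associativity constraint of `Rep(G)`. -/
def assoc (u v w : UnitaryRep G) : Hom ((u.tensor v).tensor w) (u.tensor (v.tensor w)) :=
  ⟨(TensorProduct.assoc ℂ u.H v.H w.H).toLinearMap, by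
    rw [mem_iff]
    refine TensorProduct.ext_threefold fun ψ ψ' ψ'' => ?_
    exact rTensor_assoc_mulLegs (u.u ψ) (v.u ψ') (w.u ψ'')⟩

/-- The left unit constraint of `Rep(G)`. -/
def lunit (u : UnitaryRep G) : Hom ((trivial G).tensor u) u :=
  ⟨(TensorProduct.lid ℂ u.H).toLinearMap, by
    rw [mem_iff]
    refine TensorProduct.ext' fun (c : ℂ) ψ => ?_
    change (TensorProduct.lid ℂ u.H).toLinearMap.rTensor A
      (mulLegs ℂ u.H A ((c ⊗ₜ 1) ⊗ₜ u.u ψ)) = u.u (c • ψ)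
    rw [map_smul]
    induction u.u ψ with
    | zero => simp
    | add x y hx hy => simp only [TensorProduct.tmul_add, map_add, hx, hy, smul_add]
    | tmul h a => simp [TensorProduct.smul_tmul']⟩

/-- The right unit constraint of `Rep(G)`. -/
def runit (u : UnitaryRep G) : Hom (u.tensor (trivial G)) u :=
  ⟨(TensorProduct.rid ℂ u.H).toLinearMap, by
    rw [mem_iff]
    refine TensorProduct.ext' fun ψ (c : ℂ) => ?_
    change (TensorProduct.rid ℂ u.H).toLinearMap.rTensor A
      (mulLegs u.H ℂ A (u.u ψ ⊗ₜ (c ⊗ₜ 1))) = u.u (c • ψ)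
    rw [map_smul]
    induction u.u ψ with
    | zero => simp
    | add x y hx hy => simp only [TensorProduct.add_tmul, map_add, hx, hy, smul_add]
    | tmul h a => simp [TensorProduct.smul_tmul']⟩

end Hom
end UnitaryRep
end QuantumGroups

/-! ### The complex conjugate of a Hilbert space -/

section ConjSpace

/-- The complex conjugate of a complex Hilbert space: same vectors, with `c • x̄` the conjugate of
`c̄ • x` and inner product `⟪x̄, ȳ⟫ = ⟪y, x⟫`. -/
def ConjSpace (E : Type*) : Type _ := E

namespace ConjSpace

variable {E : Type*} [NormedAddCommGroup E] [InnerProductSpace ℂ E]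

/-- The canonical antilinear bijection `x ↦ x̄`. -/
def mk : E ≃ ConjSpace E := Equiv.refl E

instance : NormedAddCommGroup (ConjSpace E) := inferInstanceAs (NormedAddCommGroup E)

instance : Module ℂ (ConjSpace E) := Module.compHom E (starRingEnd ℂ)

lemma smul_mk (c : ℂ) (x : E) : c • (mk x : ConjSpace E) = mk (conj c • x) := rfl
lemma add_mk (x y : E) : (mk x : ConjSpace E) + mk y = mk (x + y) := rfl
lemma norm_mk (x : E) : ‖(mk x : ConjSpace E)‖ = ‖x‖ := rfl

instance : InnerProductSpace ℂ (ConjSpace E) where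
  norm_smul_le c x := by
    refine (norm_smul_le (conj c) (mk.symm x)).trans ?_
    rw [RCLike.norm_conj]
    rfl
  inner x y := ⟪mk.symm y, mk.symm x⟫_ℂ
  norm_sq_eq_re_inner x := norm_sq_eq_re_inner (𝕜 := ℂ) (mk.symm x)
  conj_inner_symm x y := inner_conj_symm (mk.symm y) (mk.symm x)
  add_left x y z := inner_add_right (mk.symm z) (mk.symm x) (mk.symm y)
  smul_left x y c := inner_smul_right (mk.symm y) (mk.symm x) (conj c)

lemma inner_mk (x y : E) : ⟪(mk x : ConjSpace E), mk y⟫_ℂ = ⟪y, x⟫_ℂ := rfl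

instance [CompleteSpace E] : CompleteSpace (ConjSpace E) := inferInstanceAs (CompleteSpace E)

end ConjSpace

end ConjSpace

/-! ### Spectral spaces of an ergodic action -/

namespace QAction

variable {A B : Type*} [CStarAlgebra A] [CStarAlgebra B] {G : CompactQuantumGroup A}
variable (η : QAction G B) (u : UnitaryRep G)

/-- The space `L_u` of linear maps `T : H_u → B` intertwining `u` with `η`:
`η ∘ T = (T ⊗ ι) ∘ u`. -/
def L : Submodule ℂ (u.H →ₗ[ℂ] B) where
  carrier := {T | ∀ ψ, η.toHom (T ψ) = toMin (T.rTensor A (u.u ψ))}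
  add_mem' {S T} hS hT ψ := by
    rw [LinearMap.add_apply, map_add, hS ψ, hT ψ, LinearMap.rTensor_add, LinearMap.add_apply,
      map_add]
  zero_mem' ψ := by simp
  smul_mem' c {T} hT ψ := by
    rw [LinearMap.smul_apply, map_smul, hT ψ, LinearMap.rTensor_smul, LinearMap.smul_apply,
      map_smul]

variable {η u}

lemma rTensor_eq_sum {ι : Type*} [Fintype ι] (e : OrthonormalBasis ι ℂ u.H) (T : u.H →ₗ[ℂ] B)
    (ψ : u.H) : T.rTensor A (u.u ψ) = ∑ i, T (e i) ⊗ₜ[ℂ] coeff u.u (e i) ψ := by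
  conv_lhs => rw [eq_sum_slice e (u.u ψ)]
  simp [coeff]

lemma L.apply_eq {ι : Type*} [Fintype ι] (e : OrthonormalBasis ι ℂ u.H) (T : η.L u) (ψ : u.H) :
    η.toHom (T.1 ψ) = ∑ i, toMin (T.1 (e i) ⊗ₜ[ℂ] coeff u.u (e i) ψ) := by
  rw [T.2 ψ, rTensor_eq_sum e, map_sum]

/-- The element `∑ T(e_i) S(e_i)^*` of `B`. -/
def L.pairing (S T : η.L u) : B :=
  ∑ i, T.1 (stdOrthonormalBasis ℂ u.H i) * star (S.1 (stdOrthonormalBasis ℂ u.H i))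

lemma L.pairing_eq {ι : Type*} [Fintype ι] (e : OrthonormalBasis ι ℂ u.H) (S T : η.L u) :
    L.pairing S T = ∑ i, T.1 (e i) * star (S.1 (e i)) :=
  sum_onb_eq (fun x y => T.1 y * star (S.1 x))
    (by intros; simp only [map_add, star_add, mul_add])
    (by intros; simp only [map_smul, star_smul, mul_smul_comm]; rfl)
    (by intros; simp only [map_add, add_mul])
    (by intros; simp only [map_smul, smul_mul_assoc]) _ e

lemma L.pairing_fixed (S T : η.L u) :
    η.toHom (L.pairing S T) = toMin (L.pairing S T ⊗ₜ[ℂ] (1 : A)) := by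
  let e := stdOrthonormalBasis ℂ u.H
  have hstar : ∀ x : B ⊗[ℂ] A, star (toMin x : MinTensor B A) = toMin (star x) := fun x =>
    (map_star toMin x).symm
  calc η.toHom (L.pairing S T)
      = ∑ i, ∑ k, ∑ l, toMin ((T.1 (e k) * star (S.1 (e l))) ⊗ₜ[ℂ]
          (coeff u.u (e k) (e i) * star (coeff u.u (e l) (e i)))) := by
        rw [L.pairing, map_sum]
        refine Finset.sum_congr rfl fun i _ => ?_
        rw [map_mul, map_star, L.apply_eq e T, L.apply_eq e S, star_sum, Finset.sum_mul_sum]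
        refine Finset.sum_congr rfl fun k _ => ?_
        refine Finset.sum_congr rfl fun l _ => ?_
        rw [hstar, ← map_mul, TensorProduct.star_tmul, Algebra.TensorProduct.tmul_mul_tmul]
    _ = ∑ k, ∑ l, toMin ((T.1 (e k) * star (S.1 (e l))) ⊗ₜ[ℂ]
          ∑ i, (coeff u.u (e k) (e i) * star (coeff u.u (e l) (e i)))) := by
        rw [Finset.sum_comm]
        refine Finset.sum_congr rfl fun k _ => ?_
        rw [Finset.sum_comm]
        refine Finset.sum_congr rfl fun l _ => ?_
        rw [TensorProduct.tmul_sum, map_sum]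
    _ = ∑ k, toMin ((T.1 (e k) * star (S.1 (e k))) ⊗ₜ[ℂ] (1 : A)) := by
        refine Finset.sum_congr rfl fun k _ => ?_
        rw [Finset.sum_eq_single k]
        · rw [u.sum_coisometry e, e.inner_eq_one, one_smul]
        · intro l _ hl
          rw [u.sum_coisometry e, e.inner_eq_zero hl.symm, zero_smul, TensorProduct.tmul_zero,
            map_zero]
        · simp
    _ = _ := by rw [L.pairing, TensorProduct.sum_tmul, map_sum]

lemma smul_one_inj [Nontrivial B] {c d : ℂ} (h : c • (1 : B) = d • (1 : B)) : c = d :=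
  smul_left_injective ℂ one_ne_zero h

section Order

attribute [local instance] CStarAlgebra.spectralOrder CStarAlgebra.spectralOrderedRing

lemma L.pairing_self_nonneg (T : η.L u) : (0 : B) ≤ L.pairing T T :=
  Finset.sum_nonneg fun _ _ => mul_star_self_nonneg _

lemma L.norm_apply_sq_le (T : η.L u) (i) :
    ‖T.1 (stdOrthonormalBasis ℂ u.H i)‖ ^ 2 ≤ ‖L.pairing T T‖ := by
  rw [sq, ← CStarRing.norm_self_mul_star]
  refine CStarAlgebra.norm_le_norm_of_nonneg_of_le (mul_star_self_nonneg _) ?_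
  exact Finset.single_le_sum
    (f := fun i => T.1 (stdOrthonormalBasis ℂ u.H i) * star (T.1 (stdOrthonormalBasis ℂ u.H i)))
    (fun _ _ => mul_star_self_nonneg _) (Finset.mem_univ i)

lemma nonneg_of_smul_one_nonneg [Nontrivial B] {r : ℝ} (h : (0 : B) ≤ (r : ℂ) • (1 : B)) :
    0 ≤ r := by
  by_contra hr
  push Not at hr
  have h1 : (0 : B) ≤ ((-r : ℝ) : ℂ) • (1 : B) := by
    have h2 : (((-r : ℝ) : ℂ) • (1 : B)) =
        star (((Real.sqrt (-r) : ℝ) : ℂ) • (1 : B)) * (((Real.sqrt (-r) : ℝ) : ℂ) • (1 : B)) := by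
      rw [star_smul, star_one, smul_mul_smul_comm, one_mul]
      congr 1
      simp only [RCLike.star_def, Complex.conj_ofReal]
      rw [← Complex.ofReal_mul, Real.mul_self_sqrt (by linarith)]
    rw [h2]
    exact star_mul_self_nonneg _
  have h3 : (r : ℂ) • (1 : B) = 0 := by
    refine le_antisymm ?_ h
    rw [Complex.ofReal_neg, neg_smul] at h1
    exact neg_nonneg.mp h1
  have h4 : (r : ℂ) = 0 := smul_one_inj (B := B) (by rw [h3, zero_smul])
  exact hr.ne (by exact_mod_cast h4)

end Order

lemma L.ext_std {S T : η.L u}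
    (h : ∀ i, S.1 (stdOrthonormalBasis ℂ u.H i) = T.1 (stdOrthonormalBasis ℂ u.H i)) : S = T :=
  Subtype.ext ((stdOrthonormalBasis ℂ u.H).toBasis.ext fun i => by simpa using h i)

lemma L.eq_zero_of_pairing {T : η.L u} (h : L.pairing T T = 0) : T = 0 := by
  refine L.ext_std fun i => ?_
  have := L.norm_apply_sq_le T i
  rw [h, norm_zero] at this
  have h0 : ‖T.1 (stdOrthonormalBasis ℂ u.H i)‖ = 0 := by
    nlinarith [norm_nonneg (T.1 (stdOrthonormalBasis ℂ u.H i))]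
  simpa using h0

lemma L.star_pairing (S T : η.L u) : star (L.pairing S T) = L.pairing T S := by
  simp [L.pairing, star_sum]

lemma L.pairing_add_left (S S' T : η.L u) :
    L.pairing (S + S') T = L.pairing S T + L.pairing S' T := by
  simp [L.pairing, mul_add, Finset.sum_add_distrib]

lemma L.pairing_smul_left (c : ℂ) (S T : η.L u) :
    L.pairing (c • S) T = conj c • L.pairing S T := by
  simp [L.pairing, Finset.smul_sum]

variable [η.IsErgodic]

lemma L.exists_scalar (S T : η.L u) : ∃ c : ℂ, L.pairing S T = c • (1 : B) :=
  IsErgodic.fixed_scalar _ (L.pairing_fixed S T)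

/-- The inner product of `L_u`, determined by `⟪S, T⟫ I = ∑ T(e_i) S(e_i)^*`. -/
instance : Inner ℂ (η.L u) where
  inner S T := Classical.choose (L.exists_scalar S T)

lemma L.inner_smul_one (S T : η.L u) : ⟪S, T⟫_ℂ • (1 : B) = L.pairing S T :=
  (Classical.choose_spec (L.exists_scalar S T)).symm

variable [Nontrivial B]

lemma L.inner_symm (S T : η.L u) : conj ⟪T, S⟫_ℂ = ⟪S, T⟫_ℂ := by
  refine smul_one_inj (B := B) ?_
  rw [L.inner_smul_one, ← L.star_pairing, ← L.inner_smul_one T S, star_smul, star_one]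
  rfl

/-- The inner product axioms for `L_u`. -/
instance L.core : InnerProductSpace.Core ℂ (η.L u) where
  conj_inner_symm := L.inner_symm
  re_inner_nonneg T := by
    have him : ((⟪T, T⟫_ℂ).re : ℂ) = ⟪T, T⟫_ℂ := Complex.conj_eq_iff_re.mp (L.inner_symm T T)
    refine nonneg_of_smul_one_nonneg (B := B) (r := (⟪T, T⟫_ℂ).re) ?_
    rw [him, L.inner_smul_one]
    exact L.pairing_self_nonneg T
  add_left S S' T := by
    refine smul_one_inj (B := B) ?_
    rw [add_smul, L.inner_smul_one, L.inner_smul_one, L.inner_smul_one, L.pairing_add_left]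
  smul_left S T c := by
    refine smul_one_inj (B := B) ?_
    rw [mul_smul, L.inner_smul_one, L.inner_smul_one, L.pairing_smul_left]
  definite T h := by
    refine L.eq_zero_of_pairing ?_
    rw [← L.inner_smul_one, h, zero_smul]

instance : NormedAddCommGroup (η.L u) := InnerProductSpace.Core.toNormedAddCommGroup (cd := L.core)
instance : InnerProductSpace ℂ (η.L u) := InnerProductSpace.ofCore L.core.toCore

lemma L.norm_sq (T : η.L u) : ‖T‖ ^ 2 = ‖L.pairing T T‖ := by
  rw [← L.inner_smul_one, norm_smul, norm_one, mul_one, inner_self_eq_norm_sq_to_K]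
  simp

lemma L.norm_apply_le (T : η.L u) (i) : ‖T.1 (stdOrthonormalBasis ℂ u.H i)‖ ≤ ‖T‖ := by
  have := L.norm_apply_sq_le T i
  rw [← L.norm_sq] at this
  exact (sq_le_sq₀ (norm_nonneg _) (norm_nonneg _)).mp this

lemma L.norm_sq_le (T : η.L u) : ‖T‖ ^ 2 ≤ ∑ i, ‖T.1 (stdOrthonormalBasis ℂ u.H i)‖ ^ 2 := by
  rw [L.norm_sq]
  refine (norm_sum_le _ _).trans (Finset.sum_le_sum fun i _ => ?_)
  rw [sq, CStarRing.norm_self_mul_star]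

lemma L.norm_apply_le' (T : η.L u) (ψ : u.H) :
    ‖T.1 ψ‖ ≤ (∑ i, ‖⟪stdOrthonormalBasis ℂ u.H i, ψ⟫_ℂ‖) * ‖T‖ := by
  conv_lhs => rw [← (stdOrthonormalBasis ℂ u.H).sum_repr' ψ]
  rw [map_sum, Finset.sum_mul]
  refine (norm_sum_le _ _).trans (Finset.sum_le_sum fun i _ => ?_)
  rw [map_smul, norm_smul]
  exact mul_le_mul_of_nonneg_left (L.norm_apply_le T i) (norm_nonneg _)

instance : CompleteSpace (η.L u) := by
  refine Metric.complete_of_cauchySeq_tendsto fun T hT => ?_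
  let e := stdOrthonormalBasis ℂ u.H
  have hc : ∀ i, CauchySeq fun n => (T n).1 (e i) := by
    intro i
    rw [Metric.cauchySeq_iff] at hT ⊢
    intro ε hε
    obtain ⟨N, hN⟩ := hT ε hε
    refine ⟨N, fun m hm n hn => lt_of_le_of_lt ?_ (hN m hm n hn)⟩
    rw [dist_eq_norm, dist_eq_norm]
    exact L.norm_apply_le (T m - T n) i
  choose b hb using fun i => cauchySeq_tendsto_of_complete (hc i)
  let T₀ : u.H →ₗ[ℂ] B := e.toBasis.constr ℂ b
  have hT₀ : ∀ i, T₀ (e i) = b i := fun i => by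
    have := e.toBasis.constr_basis ℂ b i
    rwa [e.coe_toBasis] at this
  have hexp : ∀ (S : u.H →ₗ[ℂ] B) ψ, S ψ = ∑ i, ⟪e i, ψ⟫_ℂ • S (e i) := by
    intro S ψ
    conv_lhs => rw [← e.sum_repr' ψ]
    rw [map_sum]
    simp only [map_smul]
  have hη : Continuous η.toHom :=
    AddMonoidHomClass.continuous_of_bound η.toHom 1 fun x => by
      rw [one_mul]; exact NonUnitalStarAlgHom.norm_apply_le η.toHom x
  let R : B →⋆ₐ[ℂ] MinTensor B A :=
    toMin.comp { (Algebra.TensorProduct.includeLeft : B →ₐ[ℂ] B ⊗[ℂ] A) with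
      map_star' := fun x => by simp [TensorProduct.star_tmul] }
  have hR : Continuous R :=
    AddMonoidHomClass.continuous_of_bound R 1 fun x => by
      rw [one_mul]; exact NonUnitalStarAlgHom.norm_apply_le R x
  have hmin : ∀ (x : B) (a : A), (toMin (x ⊗ₜ[ℂ] a) : MinTensor B A) =
      R x * toMin ((1 : B) ⊗ₜ[ℂ] a) := by
    intro x a
    change _ = toMin (x ⊗ₜ[ℂ] (1 : A)) * toMin ((1 : B) ⊗ₜ[ℂ] a)
    rw [← map_mul, Algebra.TensorProduct.tmul_mul_tmul, mul_one, one_mul]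
  have hmem : T₀ ∈ η.L u := by
    intro ψ
    have h1 : Filter.Tendsto (fun n => η.toHom ((T n).1 ψ)) Filter.atTop (nhds (η.toHom (T₀ ψ))) := by
      refine (hη.tendsto _).comp ?_
      have h0 : (fun n => (T n).1 ψ) = fun n => ∑ i, ⟪e i, ψ⟫_ℂ • (T n).1 (e i) :=
        funext fun n => hexp (T n).1 ψ
      rw [h0, hexp T₀ ψ]
      simp only [hT₀]
      exact tendsto_finsetSum _ fun i _ => (hb i).const_smul _
    have h2 : Filter.Tendsto (fun n => η.toHom ((T n).1 ψ)) Filter.atTop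
        (nhds (toMin (T₀.rTensor A (u.u ψ)))) := by
      have h0 : (fun n => η.toHom ((T n).1 ψ)) = fun n => ∑ i, R ((T n).1 (e i)) *
          toMin ((1 : B) ⊗ₜ[ℂ] coeff u.u (e i) ψ) := by
        funext n
        rw [L.apply_eq e (T n) ψ]
        exact Finset.sum_congr rfl fun i _ => hmin _ _
      have h0' : (toMin (T₀.rTensor A (u.u ψ)) : MinTensor B A) = ∑ i, R (b i) *
          toMin ((1 : B) ⊗ₜ[ℂ] coeff u.u (e i) ψ) := by
        rw [rTensor_eq_sum e T₀, map_sum]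
        refine Finset.sum_congr rfl fun i _ => ?_
        rw [hmin, hT₀]
      rw [h0, h0']
      exact tendsto_finsetSum _ fun i _ => ((hR.tendsto _).comp (hb i)).mul_const _
    exact tendsto_nhds_unique h1 h2
  refine ⟨⟨T₀, hmem⟩, ?_⟩
  rw [tendsto_iff_norm_sub_tendsto_zero]
  have h3 : Filter.Tendsto (fun n => ∑ i, ‖(T n).1 (e i) - b i‖ ^ 2) Filter.atTop (nhds 0) := by
    have : (0 : ℝ) = ∑ i : Fin (Module.finrank ℂ u.H), ‖b i - b i‖ ^ 2 := by simp
    rw [this]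
    exact tendsto_finsetSum _ fun i _ => (((hb i).sub_const _).norm.pow 2)
  have h4 : Filter.Tendsto (fun n => ‖T n - ⟨T₀, hmem⟩‖ ^ 2) Filter.atTop (nhds 0) := by
    refine squeeze_zero (fun n => by positivity) (fun n => ?_) h3
    refine (L.norm_sq_le _).trans_eq (Finset.sum_congr rfl fun i _ => ?_)
    rw [← hT₀ i]
    rfl
  have h5 := (Real.continuous_sqrt.tendsto 0).comp h4
  simpa [Function.comp_def, Real.sqrt_sq] using h5

/-! ### The spectral functor -/

variable (η u) in
/-- The spectral space `L̄_u`: the complex conjugate of the Hilbert space `L_u`. -/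
abbrev Lbar : Type _ := ConjSpace (η.L u)

variable {v w : UnitaryRep G}

/-- The map `L_T : L_v → L_u`, `S ↦ S ∘ T`, for an arrow `T ∈ (u, v)`. -/
def L.map (T : UnitaryRep.Hom u v) : η.L v →ₗ[ℂ] η.L u where
  toFun S := ⟨S.1 ∘ₗ T.1, fun ψ => by
    rw [LinearMap.comp_apply, S.2 (T.1 ψ), LinearMap.rTensor_comp, LinearMap.comp_apply]
    exact congrArg (fun x => toMin (S.1.rTensor A x)) (LinearMap.congr_fun T.2 ψ).symm⟩
  map_add' _ _ := rfl
  map_smul' _ _ := rfl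

lemma L.map_apply (T : UnitaryRep.Hom u v) (S : η.L v) (ψ : u.H) :
    (L.map T S).1 ψ = S.1 (T.1 ψ) := rfl

lemma L.exists_map_bound (T : UnitaryRep.Hom u v) :
    ∃ C, ∀ S : η.L v, ‖L.map T S‖ ≤ C * ‖S‖ := by
  let c : Fin (Module.finrank ℂ u.H) → ℝ := fun j =>
    ∑ i, ‖⟪stdOrthonormalBasis ℂ v.H i, T.1 (stdOrthonormalBasis ℂ u.H j)⟫_ℂ‖
  refine ⟨Real.sqrt (∑ j, c j ^ 2), fun S => ?_⟩
  have hc : (0 : ℝ) ≤ ∑ j, c j ^ 2 := Finset.sum_nonneg fun j _ => sq_nonneg _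
  refine (sq_le_sq₀ (norm_nonneg _) (by positivity)).mp ?_
  rw [mul_pow, Real.sq_sqrt hc, Finset.sum_mul]
  refine (L.norm_sq_le _).trans (Finset.sum_le_sum fun j _ => ?_)
  rw [← mul_pow]
  exact pow_le_pow_left₀ (norm_nonneg _) (L.norm_apply_le' S _) 2

/-- The adjoint of `L_T` is `L_{T^*}`. -/
lemma L.inner_map_left (T : UnitaryRep.Hom u v) (S : η.L v) (R : η.L u) :
    ⟪L.map T S, R⟫_ℂ = ⟪S, L.map (UnitaryRep.Hom.adj T) R⟫_ℂ := by
  let e := stdOrthonormalBasis ℂ u.H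
  let f := stdOrthonormalBasis ℂ v.H
  refine smul_one_inj (B := B) ?_
  rw [L.inner_smul_one, L.inner_smul_one]
  calc L.pairing (L.map T S) R
      = ∑ i, ∑ j, ⟪T.1 (e i), f j⟫_ℂ • (R.1 (e i) * star (S.1 (f j))) := by
        refine Finset.sum_congr rfl fun i _ => ?_
        have h : (L.map T S).1 (e i) = ∑ j, ⟪f j, T.1 (e i)⟫_ℂ • S.1 (f j) := by
          rw [L.map_apply]
          conv_lhs => rw [← f.sum_repr' (T.1 (e i))]
          rw [map_sum]
          simp only [map_smul]
        rw [h, star_sum, Finset.mul_sum]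
        refine Finset.sum_congr rfl fun j _ => ?_
        rw [star_smul, mul_smul_comm, ← inner_conj_symm (T.1 (e i)) (f j)]
        rfl
    _ = ∑ j, ∑ i, ⟪e i, T.1.adjoint (f j)⟫_ℂ • (R.1 (e i) * star (S.1 (f j))) := by
        rw [Finset.sum_comm]
        simp only [LinearMap.adjoint_inner_right]
    _ = L.pairing S (L.map (UnitaryRep.Hom.adj T) R) := by
        refine Finset.sum_congr rfl fun j _ => ?_
        have h : (L.map (UnitaryRep.Hom.adj T) R).1 (f j) = ∑ i, ⟪e i, T.1.adjoint (f j)⟫_ℂ • R.1 (e i) := by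
          rw [L.map_apply]
          change R.1 (T.1.adjoint (f j)) = _
          conv_lhs => rw [← e.sum_repr' (T.1.adjoint (f j))]
          rw [map_sum]
          simp only [map_smul]
        rw [h, Finset.sum_mul]
        refine Finset.sum_congr rfl fun i _ => ?_
        rw [smul_mul_assoc]

/-- The map `L̄_T : L̄_u → L̄_v`, for an arrow `T ∈ (u, v)`, obtained from `L_T` by passing to the
dual spaces; it sends `S̄` to the conjugate of `L_{T^*}(S) = S ∘ T^*`. -/
def Lbar.map (T : UnitaryRep.Hom u v) : Lbar η u →L[ℂ] Lbar η v :=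
  LinearMap.mkContinuousOfExistsBound
    { toFun := fun S => ConjSpace.mk (L.map (UnitaryRep.Hom.adj T) (ConjSpace.mk.symm S))
      map_add' := fun S R => (L.map (UnitaryRep.Hom.adj T)).map_add (ConjSpace.mk.symm S) (ConjSpace.mk.symm R)
      map_smul' := fun c S => (L.map (UnitaryRep.Hom.adj T)).map_smul (conj c) (ConjSpace.mk.symm S) }
    (L.exists_map_bound (UnitaryRep.Hom.adj T))

lemma Lbar.map_mk (T : UnitaryRep.Hom u v) (S : η.L u) :
    Lbar.map T (ConjSpace.mk S : Lbar η u) = ConjSpace.mk (L.map (UnitaryRep.Hom.adj T) S) := rfl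

/-- The defining property of `L̄_T` as a map of dual spaces: under the identification of `S̄` with
the functional `⟪S, ·⟫` on `L_u`, it is the composition with `L_T`. -/
lemma Lbar.inner_map (T : UnitaryRep.Hom u v) (S : Lbar η u) (R : η.L v) :
    ⟪ConjSpace.mk.symm (Lbar.map T S), R⟫_ℂ = ⟪ConjSpace.mk.symm S, L.map T R⟫_ℂ := by
  change ⟪L.map (UnitaryRep.Hom.adj T) (ConjSpace.mk.symm S), R⟫_ℂ = _
  rw [L.inner_map_left]
  congr 1
  refine Subtype.ext (LinearMap.ext fun ψ => ?_)
  change R.1 (T.1.adjoint.adjoint ψ) = R.1 (T.1 ψ)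
  rw [LinearMap.adjoint_adjoint]

end QAction

/-! ### Quasitensor functors -/

/-- A *-functor from `Rep(G)` to the category of Hilbert spaces and bounded operators. -/
structure HilbFunctor {A : Type*} [CStarAlgebra A] (G : CompactQuantumGroup A) where
  /-- the Hilbert space of an object -/
  obj : UnitaryRep G → Type*
  [instN : ∀ u, NormedAddCommGroup (obj u)]
  [instI : ∀ u, InnerProductSpace ℂ (obj u)]
  [instC : ∀ u, CompleteSpace (obj u)]
  /-- the linear action on arrows -/
  map : ∀ {u v : UnitaryRep G}, UnitaryRep.Hom u v →ₗ[ℂ] (obj u →L[ℂ] obj v)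
  map_id : ∀ u : UnitaryRep G, map (UnitaryRep.Hom.id u) = .id ℂ (obj u)
  map_comp : ∀ {u v w : UnitaryRep G} (S : UnitaryRep.Hom v w) (T : UnitaryRep.Hom u v),
    map (UnitaryRep.Hom.comp S T) = map S ∘L map T
  map_adj : ∀ {u v : UnitaryRep G} (T : UnitaryRep.Hom u v), map (UnitaryRep.Hom.adj T) = (map T).adjoint

attribute [instance] HilbFunctor.instN HilbFunctor.instI HilbFunctor.instC

/-- The range projection `V V^*` of an isometry `V`. -/
def rangeProj {H K : Type*} [NormedAddCommGroup H] [InnerProductSpace ℂ H] [CompleteSpace H]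
    [NormedAddCommGroup K] [InnerProductSpace ℂ K] [CompleteSpace K] (V : H →L[ℂ] K) :
    K →L[ℂ] K := V ∘L V.adjoint

/-- A quasitensor structure on a *-functor `F : Rep(G) → Hilb`.  As the tensor products of spaces
are not strictly associative and unital here, the canonical constraints of `Rep(G)` appear
explicitly in the axioms. -/
structure QuasitensorStructure {A : Type*} [CStarAlgebra A] {G : CompactQuantumGroup A}
    (F : HilbFunctor G) where
  /-- the identification `F(ι) = ℂ` -/
  unit : ℂ ≃ₗᵢ[ℂ] F.obj (.trivial G)
  /-- the isometries `S_{u,v} : F(u) ⊗ F(v) → F(u ⊗ v)` -/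
  S : ∀ u v : UnitaryRep G, HTensor (F.obj u) (F.obj v) →ₗᵢ[ℂ] F.obj (u.tensor v)
  /-- `S_{u,ι} = 1` -/
  S_unit_right : ∀ (u : UnitaryRep G) (x : F.obj u) (c : ℂ),
    F.map (UnitaryRep.Hom.runit u) (S u (.trivial G) (HTensor.tmul x (unit c))) = c • x
  /-- `S_{ι,u} = 1` -/
  S_unit_left : ∀ (u : UnitaryRep G) (x : F.obj u) (c : ℂ),
    F.map (UnitaryRep.Hom.lunit u) (S (.trivial G) u (HTensor.tmul (unit c) x)) = c • x
  /-- `S_{u⊗v,w} ∘ (S_{u,v} ⊗ 1) = S_{u,v⊗w} ∘ (1 ⊗ S_{v,w})` -/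
  S_assoc : ∀ (u v w : UnitaryRep G) (x : F.obj u) (y : F.obj v) (z : F.obj w),
    F.map (UnitaryRep.Hom.assoc u v w) (S (u.tensor v) w (HTensor.tmul (S u v (HTensor.tmul x y)) z)) =
      S u (v.tensor w) (HTensor.tmul x (S v w (HTensor.tmul y z)))
  /-- `E_{u⊗v,w} ∘ E_{u,v⊗w} ≤ E_{u,v,w}`, where `E` denotes range projections and
  `S_{u,v,w} = S_{u⊗v,w} ∘ (S_{u,v} ⊗ 1)`; all are operators on `F((u ⊗ v) ⊗ w)` -/
  proj_le : ∀ u v w : UnitaryRep G,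
    (rangeProj ((S (u.tensor v) w).toContinuousLinearMap ∘L
        HTensor.map (S u v).toContinuousLinearMap (.id ℂ (F.obj w))) -
      rangeProj (S (u.tensor v) w).toContinuousLinearMap ∘L
        ((F.map (UnitaryRep.Hom.assoc u v w)).adjoint ∘L
          rangeProj (S u (v.tensor w)).toContinuousLinearMap ∘L
            F.map (UnitaryRep.Hom.assoc u v w))).IsPositive
  /-- `F(T ⊗ T') ∘ S_{u,v} = S_{u',v'} ∘ (F(T) ⊗ F(T'))` -/
  natural : ∀ {u u' v v' : UnitaryRep G} (T : UnitaryRep.Hom u u') (T' : UnitaryRep.Hom v v'),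
    F.map (UnitaryRep.Hom.tensor T T') ∘L (S u v).toContinuousLinearMap =
      (S u' v').toContinuousLinearMap ∘L HTensor.map (F.map T) (F.map T')

/-- A *-functor from `Rep(G)` to Hilbert spaces is quasitensor if it admits a quasitensor
structure. -/
def HilbFunctor.IsQuasitensor {A : Type*} [CStarAlgebra A] {G : CompactQuantumGroup A}
    (F : HilbFunctor G) : Prop :=
  Nonempty (QuasitensorStructure F)

/-- The spectral functor `u ↦ L̄_u`, `T ↦ L̄_T` of an ergodic action. -/
def QAction.spectralFunctor {A B : Type*} [CStarAlgebra A] [CStarAlgebra B] [Nontrivial B]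
    {G : CompactQuantumGroup A} (η : QAction G B) [η.IsErgodic] : HilbFunctor G where
  obj u := η.Lbar u
  map :=
    { toFun := fun T => QAction.Lbar.map T
      map_add' := fun S T => by
        ext R
        refine congrArg ConjSpace.mk (Subtype.ext (LinearMap.ext fun ψ => ?_))
        change (ConjSpace.mk.symm R).1 ((S.1 + T.1).adjoint ψ) =
          (ConjSpace.mk.symm R).1 (S.1.adjoint ψ) + (ConjSpace.mk.symm R).1 (T.1.adjoint ψ)
        rw [map_add, LinearMap.add_apply, map_add]
      map_smul' := fun c T => by
        ext R
        refine congrArg ConjSpace.mk (Subtype.ext (LinearMap.ext fun ψ => ?_))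
        change (ConjSpace.mk.symm R).1 ((c • T.1).adjoint ψ) =
          conj c • (ConjSpace.mk.symm R).1 (T.1.adjoint ψ)
        rw [LinearEquiv.map_smulₛₗ, LinearMap.smul_apply, map_smul] }
  map_id u := by
    ext R
    refine congrArg ConjSpace.mk (Subtype.ext (LinearMap.ext fun ψ => ?_))
    change (ConjSpace.mk.symm R).1 (LinearMap.id.adjoint ψ) = (ConjSpace.mk.symm R).1 ψ
    rw [LinearMap.adjoint_id]
    rfl
  map_comp S T := by
    ext R
    refine congrArg ConjSpace.mk (Subtype.ext (LinearMap.ext fun ψ => ?_))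
    change (ConjSpace.mk.symm R).1 ((S.1 ∘ₗ T.1).adjoint ψ) =
      (ConjSpace.mk.symm R).1 (T.1.adjoint (S.1.adjoint ψ))
    rw [LinearMap.adjoint_comp]
    rfl
  map_adj T := by
    rw [ContinuousLinearMap.eq_adjoint_iff]
    intro x y
    change ⟪ConjSpace.mk.symm y, QAction.L.map (UnitaryRep.Hom.adj (UnitaryRep.Hom.adj T))
      (ConjSpace.mk.symm x)⟫_ℂ =
      ⟪QAction.L.map (UnitaryRep.Hom.adj T) (ConjSpace.mk.symm y), ConjSpace.mk.symm x⟫_ℂ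
    rw [QAction.L.inner_map_left]

/-- `ubar` is a conjugate of the representation `u`: there is an antilinear invertible map
`j : H_u → H_ubar`, with adjoint `j^*` given by `⟪j φ, χ⟫ = ⟪j^* χ, φ⟫`, such that
`ubar_{jφ, j^{*-1}ψ} = (u_{φ,ψ})^*`. -/
def UnitaryRep.IsConjugate {A : Type*} [CStarAlgebra A] {G : CompactQuantumGroup A}
    (u ubar : UnitaryRep G) : Prop :=
  ∃ (j : u.H ≃ₛₗ[starRingEnd ℂ] ubar.H) (jstar : ubar.H ≃ₛₗ[starRingEnd ℂ] u.H),
    (∀ (φ : u.H) (χ : ubar.H), ⟪j φ, χ⟫_ℂ = ⟪jstar χ, φ⟫_ℂ) ∧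
    ∀ φ ψ : u.H, coeff ubar.u (j φ) (jstar.symm ψ) = star (coeff u.u φ ψ)

end

/-! The isometries are given by multiplication in `B`: from S in L_u and T in L_v one gets ψ ⊗ ψ' ↦
S(ψ)T(ψ') in L_{u⊗v}. By ergodicity the inner sum ∑ T(f_j)T'(f_j)^* is a scalar, which can be pulled
out of the sum over a basis of H_u, so inner products multiply (`L.inner_mul`). Associativity and
the unit conditions come from the product of `B`, the latter together with the fact that L_ι
consists of the maps c ↦ c d I, again by ergodicity. Naturality holds because arrows act by
composition.

The projection condition holds with equality (`rangeProj_mulIsometry`). The adjoint of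
multiplication by L_w is a contraction, Y ↦ ∑ Y(ψ ⊗ g_k)Z(g_k)^*. Contracting a product of X in L_u
and Y in L_{v⊗w} against Z in L_w only affects Y, so the result is X times an element of L_v and
lies in the range of S_{u,v} (`L.inner_mul_map_assoc`, `adjoint_mulIsometry_bar`). The rest is the
Hilbert space lemma `rangeProj_comp_eq`.

Finite dimensionality needs a second scalar attached to T, with the factors in the order T^*T. The
plain sum ∑ T(e_i)^*T(e_i) need not be fixed by η, but Woronowicz' orthogonality relations
(`UnitaryRep.exists_weights`) give an orthonormal basis and weights f_i > 0 for which ∑ f_i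
T(e_i)^*T(e_i) is fixed, hence equal to some c(T) I. For orthonormal T_1, …, T_N each c(T_n) is at
least 1/∑ f_i^{-1}, whereas ∑ c(T_n) ≤ ∑ f_i because ∑_n T_n(e_i)^*T_n(e_i) is a diagonal entry of a
projection. Hence N ≤ (∑ f_i^{-1})(∑ f_i).

The orthogonality relations rest on the Haar state (`CompactQuantumGroup.exists_haar`). Cesàro means
of convolution powers produce a state invariant under one given state; invariance passes to all
states it dominates (`invariant_of_dominated`); a limit along an ultrafilter of ever more dominating
states is invariant under all of them.

Finally, T ↦ (T ∘ j^*)^* is an antilinear bijection from L_u onto the space of a conjugate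
representation, so the dimensions agree. -/

noncomputable section

/-! ### Functionals on a C*-algebra -/

section Functionals

attribute [local instance] CStarAlgebra.spectralOrder CStarAlgebra.spectralOrderedRing
open scoped ComplexOrder

variable {A B : Type*} [CStarAlgebra A] [CStarAlgebra B]

/-- A functional is positive if it is nonnegative on the elements `a^* a`. -/
def IsPosFunctional (f : A →L[ℂ] ℂ) : Prop := ∀ a, 0 ≤ f (star a * a)

/-- A functional is a vector functional if it is a matrix element of the universal
representation. -/
def IsVecFunctional (f : A →L[ℂ] ℂ) : Prop :=
  ∃ ξ ξ' : UnivSpace A, ∀ a, f a = ⟪ξ, univRep A a ξ'⟫_ℂ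

/-- A state is a positive functional with value `1` at the unit. -/
def IsState (f : A →L[ℂ] ℂ) : Prop := f 1 = 1 ∧ IsPosFunctional f

/-- The vector is the class of the unit in the GNS space of φ, placed in the summand of the
universal space indexed by φ. -/
lemma PositiveLinearMap.exists_univRep_vector (φ : A →ₚ[ℂ] ℂ) :
    ∃ ξ : UnivSpace A, ∀ a, φ a = ⟪ξ, univRep A a ξ⟫_ℂ := by
  refine ⟨gnsIncl φ ((φ.toPreGNS 1 : φ.PreGNS) : φ.GNS), fun a => ?_⟩
  have h := congrArg (fun T : φ.GNS →L[ℂ] UnivSpace A =>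
    T ((φ.toPreGNS 1 : φ.PreGNS) : φ.GNS)) (gnsIncl_intertwine φ a)
  have h' : univRep A a (gnsIncl φ ((φ.toPreGNS 1 : φ.PreGNS) : φ.GNS)) =
      gnsIncl φ (φ.gnsStarAlgHom a ((φ.toPreGNS 1 : φ.PreGNS) : φ.GNS)) := h.symm
  rw [h', LinearIsometry.inner_map_map]
  have : φ.gnsStarAlgHom a ((φ.toPreGNS 1 : φ.PreGNS) : φ.GNS) =
      ((φ.toPreGNS (a * 1) : φ.PreGNS) : φ.GNS) := φ.gnsNonUnitalStarAlgHom_apply_coe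
  rw [this, UniformSpace.Completion.inner_coe, PositiveLinearMap.preGNS_inner_def]
  simp

lemma IsPosFunctional.exists_vector {f : A →L[ℂ] ℂ} (hf : IsPosFunctional f) :
    ∃ ξ : UnivSpace A, ∀ a, f a = ⟪ξ, univRep A a ξ⟫_ℂ := by
  let φ : A →ₚ[ℂ] ℂ := PositiveLinearMap.mk₀ f.toLinearMap fun a ha => by
    obtain ⟨b, rfl⟩ := CStarAlgebra.nonneg_iff_eq_star_mul_self.mp ha
    exact hf b
  exact φ.exists_univRep_vector

lemma IsPosFunctional.isVecFunctional {f : A →L[ℂ] ℂ} (hf : IsPosFunctional f) :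
    IsVecFunctional f :=
  let ⟨ξ, h⟩ := hf.exists_vector
  ⟨ξ, ξ, h⟩

lemma IsState.isVecFunctional {f : A →L[ℂ] ℂ} (hf : IsState f) : IsVecFunctional f :=
  hf.2.isVecFunctional

lemma IsPosFunctional.apply_star {f : A →L[ℂ] ℂ} (hf : IsPosFunctional f) (a : A) :
    f (star a) = conj (f a) := by
  obtain ⟨ξ, h⟩ := hf.exists_vector
  rw [h, h, inner_conj_symm, map_star, ContinuousLinearMap.star_eq_adjoint,
    ContinuousLinearMap.adjoint_inner_right]

/-- Cauchy–Schwarz in vector form: f(y^*y) = ‖yξ‖², so its vanishing means yξ = 0, and then zyξ = 0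
for every z. -/
lemma IsPosFunctional.mul_eq_zero {f : A →L[ℂ] ℂ} (hf : IsPosFunctional f) {y : A}
    (hy : f (star y * y) = 0) (z : A) : f (z * y) = 0 := by
  obtain ⟨ξ, h⟩ := hf.exists_vector
  have h0 : univRep A y ξ = 0 := by
    rw [h, map_mul, map_star, ContinuousLinearMap.star_eq_adjoint, mul_apply_eq_comp,
      ContinuousLinearMap.adjoint_inner_right, inner_self_eq_zero] at hy
    exact hy
  rw [h, map_mul, mul_apply_eq_comp, h0, map_zero, inner_zero_right]

lemma IsPosFunctional.add {f g : A →L[ℂ] ℂ} (hf : IsPosFunctional f) (hg : IsPosFunctional g) :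
    IsPosFunctional (f + g) := fun a => add_nonneg (hf a) (hg a)

lemma IsPosFunctional.smul {f : A →L[ℂ] ℂ} (hf : IsPosFunctional f) {c : ℂ} (hc : 0 ≤ c) :
    IsPosFunctional (c • f) := fun a => mul_nonneg hc (hf a)

lemma IsState.norm_apply_le {f : A →L[ℂ] ℂ} (hf : IsState f) (a : A) : ‖f a‖ ≤ ‖a‖ := by
  obtain ⟨ξ, h⟩ := hf.2.exists_vector
  have h1 : ‖ξ‖ * ‖ξ‖ = 1 := by
    have := hf.1
    rw [h, map_one, one_apply_eq_self, inner_self_eq_norm_sq_to_K,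
      RCLike.ofReal_eq_complex_ofReal] at this
    rw [← sq]
    exact_mod_cast this
  rw [h]
  calc ‖⟪ξ, univRep A a ξ⟫_ℂ‖ ≤ ‖ξ‖ * (‖a‖ * ‖ξ‖) := by
        refine (norm_inner_le_norm _ _).trans ?_
        gcongr
        refine (ContinuousLinearMap.le_opNorm _ _).trans ?_
        gcongr
        exact NonUnitalStarAlgHom.norm_apply_le (univRep A) a
    _ = ‖a‖ := by rw [mul_left_comm, h1, mul_one]

/-- Positive functionals separate the points of a C*-algebra. -/
lemma exists_posFunctional_ne_zero {a : A} (ha : a ≠ 0) :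
    ∃ f : A →L[ℂ] ℂ, IsPosFunctional f ∧ f (star a * a) ≠ 0 := by
  -- The positive cone is closed and meets its negative only in 0, so −a^*a can be separated from
  -- it.
  have hna : -(star a * a) ∉ ProperCone.positive ℝ A := by
    rw [ProperCone.mem_positive, neg_nonneg]
    intro h
    have h0 := le_antisymm h (star_mul_self_nonneg a)
    exact ha (CStarRing.star_mul_self_eq_zero_iff a |>.mp h0)
  obtain ⟨f, hf, hfa⟩ := (ProperCone.positive ℝ A).hyperplane_separation_point hna
  let s : A →L[ℝ] A := (starL' ℝ : A ≃L[ℝ] A).toContinuousLinearMap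
  -- The separating functional is only real linear. After symmetrisation under the involution, its
  -- complex extension equals 2f on self-adjoint elements, so positivity carries over.
  let fr : StrongDual ℝ A := f + f ∘L s
  have hfr : ∀ x, fr x = f x + f (star x) := fun x => rfl
  let g : A →L[ℂ] ℂ := fr.extendRCLike
  have hg : ∀ x, g x = (fr x : ℂ) - Complex.I * fr (Complex.I • x) := fun x => rfl
  have hsa : ∀ x : A, IsSelfAdjoint x → g x = ((2 * f x : ℝ) : ℂ) := by
    intro x hx
    rw [hg, hfr, hfr, star_smul, hx.star_eq]
    simp
    ring
  refine ⟨g, fun b => ?_, ?_⟩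
  · rw [hsa _ (.star_mul_self b)]
    have := hf (star b * b) (by
      change _ ∈ ProperCone.positive ℝ A
      rw [ProperCone.mem_positive]; exact star_mul_self_nonneg b)
    exact_mod_cast mul_nonneg zero_le_two this
  · rw [hsa _ (.star_mul_self a)]
    rw [map_neg] at hfa
    have hpos : 0 < f (star a * a) := by linarith
    have : 2 * f (star a * a) ≠ 0 := by positivity
    exact_mod_cast this

/-- A functional that is nonzero at a^*a comes from a vector ξ with aξ ≠ 0. Faithfulness makes the
representation isometric, so bounds on matrix elements become norm bounds in the algebra. -/
lemma univRep_injective : Function.Injective (univRep A) := by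
  refine (injective_iff_map_eq_zero (univRep A)).mpr fun a ha => ?_
  by_contra h
  obtain ⟨f, hf, hfa⟩ := exists_posFunctional_ne_zero h
  obtain ⟨ξ, hξ⟩ := hf.exists_vector
  exact hfa (by rw [hξ, map_mul, ha, mul_zero, zero_apply, inner_zero_right])

lemma norm_univRep (a : A) : ‖univRep A a‖ = ‖a‖ :=
  NonUnitalStarAlgHom.norm_map (univRep A) univRep_injective a

/-- Vector functionals separate points. -/
lemma ext_vecFunctional {a b : A} (h : ∀ f : A →L[ℂ] ℂ, IsVecFunctional f → f a = f b) :
    a = b := by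
  by_contra hab
  obtain ⟨f, hf, hfa⟩ := exists_posFunctional_ne_zero (sub_ne_zero.mpr hab)
  refine hfa ?_
  have hpos : ∀ x, f (star (a - b) * x) = f.comp (ContinuousLinearMap.mul ℂ A (star (a - b))) x :=
    fun x => rfl
  -- The functional x ↦ f((a − b)^*x) is the matrix element between (a − b)ξ and ξ, so the
  -- hypothesis applies to it.
  obtain ⟨ξ, hξ⟩ := hf.exists_vector
  rw [hpos, map_sub, sub_eq_zero]
  refine h _ ⟨univRep A (a - b) ξ, ξ, fun x => ?_⟩
  rw [← hpos, hξ, map_mul, map_star, ContinuousLinearMap.star_eq_adjoint, mul_apply_eq_comp,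
    ContinuousLinearMap.adjoint_inner_right]

/-- States separate points. -/
lemma ext_state {a b : A} (h : ∀ f : A →L[ℂ] ℂ, IsState f → f a = f b) : a = b := by
  have hvec : ∀ ξ : UnivSpace A, ⟪ξ, univRep A (a - b) ξ⟫_ℂ = 0 := by
    intro ξ
    by_cases hξ : ξ = 0
    · simp [hξ]
    have hn : (‖ξ‖ : ℂ) ≠ 0 := by exact_mod_cast norm_ne_zero_iff.mpr hξ
    -- Dividing by ‖ξ‖² turns the functional of a nonzero vector into a state.
    let f : A →L[ℂ] ℂ := LinearMap.mkContinuous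
      { toFun := fun x => ((‖ξ‖ : ℂ) ^ 2)⁻¹ * ⟪ξ, univRep A x ξ⟫_ℂ
        map_add' := fun x y => by rw [map_add, add_apply, inner_add_right, mul_add]
        map_smul' := fun c x => by
          rw [map_smul, smul_apply, inner_smul_right, RingHom.id_apply, smul_eq_mul]; ring }
      (‖((‖ξ‖ : ℂ) ^ 2)⁻¹‖ * (‖ξ‖ * ‖ξ‖)) fun x => by
        change ‖((‖ξ‖ : ℂ) ^ 2)⁻¹ * ⟪ξ, univRep A x ξ⟫_ℂ‖ ≤ _
        rw [norm_mul, mul_assoc]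
        gcongr
        refine (norm_inner_le_norm _ _).trans ?_
        rw [mul_assoc]
        gcongr
        refine (ContinuousLinearMap.le_opNorm _ _).trans_eq ?_
        rw [norm_univRep, mul_comm]
    have hf : ∀ x, f x = ((‖ξ‖ : ℂ) ^ 2)⁻¹ * ⟪ξ, univRep A x ξ⟫_ℂ := fun x => rfl
    have hs : IsState f := by
      constructor
      · rw [hf, map_one, one_apply_eq_self, inner_self_eq_norm_sq_to_K]
        exact inv_mul_cancel₀ (pow_ne_zero 2 hn)
      · intro x
        rw [hf, map_mul, map_star, ContinuousLinearMap.star_eq_adjoint, mul_apply_eq_comp,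
          ContinuousLinearMap.adjoint_inner_right, inner_self_eq_norm_sq_to_K,
          RCLike.ofReal_eq_complex_ofReal]
        have : (0 : ℝ) ≤ (‖ξ‖ ^ 2)⁻¹ * ‖univRep A x ξ‖ ^ 2 := by positivity
        exact_mod_cast this
    have := h f hs
    rw [← sub_eq_zero, ← map_sub, hf, mul_eq_zero] at this
    exact this.resolve_left (inv_ne_zero (pow_ne_zero 2 hn))
  -- Over ℂ, an operator whose quadratic form vanishes is zero, by polarisation.
  have h0 : univRep A (a - b) = 0 := by
    have := (inner_map_self_eq_zero (univRep A (a - b)).toLinearMap).mp fun x => by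
      rw [← inner_conj_symm]; exact (congrArg _ (hvec x)).trans (map_zero _)
    ext x
    exact congrArg (· x) this
  exact sub_eq_zero.mp (univRep_injective (h0.trans (map_zero _).symm))

/-- Multiplication by c can be moved onto one of the two vectors. Functionals such as h(c ·) are not
positive in general, but they stay in this class and can still be sliced with. -/
lemma IsVecFunctional.comp_mul_left {f : A →L[ℂ] ℂ} (hf : IsVecFunctional f) (c : A) :
    IsVecFunctional (f.comp (ContinuousLinearMap.mul ℂ A c)) := by
  obtain ⟨ξ, ξ', h⟩ := hf
  refine ⟨univRep A (star c) ξ, ξ', fun a => ?_⟩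
  rw [map_star, ContinuousLinearMap.star_eq_adjoint, ContinuousLinearMap.adjoint_inner_left,
    ← mul_apply_eq_comp, ← map_mul, ← h]
  rfl

lemma IsVecFunctional.comp_mul_right {f : A →L[ℂ] ℂ} (hf : IsVecFunctional f) (c : A) :
    IsVecFunctional (f.comp ((ContinuousLinearMap.mul ℂ A).flip c)) := by
  obtain ⟨ξ, ξ', h⟩ := hf
  refine ⟨ξ, univRep A c ξ', fun a => ?_⟩
  rw [← mul_apply_eq_comp, ← map_mul, ← h]
  rfl

end Functionals
end

noncomputable section

/-! ### Slice maps on the minimal tensor product -/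

section Slices

attribute [local instance] CStarAlgebra.spectralOrder CStarAlgebra.spectralOrderedRing
open scoped ComplexOrder

variable {A B : Type*} [CStarAlgebra A] [CStarAlgebra B]

lemma HTensor.inner_tmul {H K : Type*} [NormedAddCommGroup H] [InnerProductSpace ℂ H]
    [NormedAddCommGroup K] [InnerProductSpace ℂ K] (h h' : H) (k k' : K) :
    ⟪HTensor.tmul h k, HTensor.tmul h' k'⟫_ℂ = ⟪h, h'⟫_ℂ * ⟪k, k'⟫_ℂ := by
  rw [tmul, tmul, LinearIsometry.inner_map_map, TensorProduct.inner_tmul]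

lemma HTensor.norm_tmul {H K : Type*} [NormedAddCommGroup H] [InnerProductSpace ℂ H]
    [NormedAddCommGroup K] [InnerProductSpace ℂ K] (h : H) (k : K) :
    ‖HTensor.tmul h k‖ = ‖h‖ * ‖k‖ := by
  rw [tmul, LinearIsometry.norm_map, TensorProduct.norm_tmul]

/-- The elementary tensor `a ⊗ b` in the minimal tensor product. -/
def minTmul (a : A) (b : B) : MinTensor A B := toMin (a ⊗ₜ[ℂ] b)

/-- Continuous additive maps on the minimal tensor product agree if they agree on elementary
tensors. -/
lemma MinTensor.eq_of_tmul {E : Type*} [TopologicalSpace E] [T2Space E] [Add E]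
    {F G : MinTensor A B → E} (hF : Continuous F) (hG : Continuous G)
    (hF' : ∀ x y, F (x + y) = F x + F y) (hG' : ∀ x y, G (x + y) = G x + G y)
    (h : ∀ a b, F (minTmul a b) = G (minTmul a b)) (X : MinTensor A B) :
    F X = G X := by
  induction X using denseRange_toMin.induction_on with
  | hp => exact isClosed_eq hF hG
  | ih x =>
    induction x with
    | zero => simpa [minTmul] using h 0 0
    | add x y hx hy => rw [map_add, hF', hG', hx, hy]
    | tmul a b => exact h a b

lemma MinTensor.ext_clm {E : Type*} [TopologicalSpace E] [T2Space E] [AddCommMonoid E] [Module ℂ E]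
    {F G : MinTensor A B →L[ℂ] E}
    (h : ∀ a b, F (minTmul a b) = G (minTmul a b)) : F = G :=
  ContinuousLinearMap.ext <|
    MinTensor.eq_of_tmul F.continuous G.continuous (map_add F) (map_add G) h

/-- The slice map `ι ⊗ g` on the algebraic tensor product. -/
def algSliceR (g : B →L[ℂ] ℂ) : A ⊗[ℂ] B →ₗ[ℂ] A :=
  (TensorProduct.rid ℂ A).toLinearMap ∘ₗ g.toLinearMap.lTensor A

/-- The slice map `f ⊗ ι` on the algebraic tensor product. -/
def algSliceL (f : A →L[ℂ] ℂ) : A ⊗[ℂ] B →ₗ[ℂ] B :=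
  (TensorProduct.lid ℂ B).toLinearMap ∘ₗ f.toLinearMap.rTensor B

/-- The canonical map from the algebraic to the minimal tensor product, as a linear map. -/
def toMinLin : A ⊗[ℂ] B →ₗ[ℂ] MinTensor A B where
  toFun x := toMin x
  map_add' x y := map_add toMin x y
  map_smul' c x := Subtype.ext (map_smul (spatialHom (univRep A) (univRep B)) c x)

/-- The continuous extension of a linear map to the minimal tensor product. -/
def minExtend {F : Type*} [CStarAlgebra F] (f : A ⊗[ℂ] B →ₗ[ℂ] F) : MinTensor A B →L[ℂ] F :=
  f.extendOfNorm toMinLin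

lemma minExtend_toMin {F : Type*} [CStarAlgebra F] {f : A ⊗[ℂ] B →ₗ[ℂ] F}
    (h : ∃ C : ℝ, ∀ x, ‖f x‖ ≤ C * ‖(toMin x : MinTensor A B)‖) (x : A ⊗[ℂ] B) :
    minExtend f (toMin x) = f x :=
  LinearMap.extendOfNorm_eq (e := toMinLin) denseRange_toMin h x

instance {F : Type*} [CStarAlgebra F] :
    CoeFun (MinTensor A B →L[ℂ] F) (fun _ => MinTensor A B → F) := ⟨fun f => f⟩

/-- The slice map `ι ⊗ g` on the minimal tensor product. -/
def sliceR (g : B →L[ℂ] ℂ) : MinTensor A B →L[ℂ] A :=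
  minExtend (algSliceR g)

/-- The slice map `f ⊗ ι` on the minimal tensor product. -/
def sliceL (f : A →L[ℂ] ℂ) : MinTensor A B →L[ℂ] B :=
  minExtend (algSliceL f)

/-- Slicing with a vector functional fixes the vectors of the second leg, so matrix elements of the
slice are matrix elements of x between elementary tensors. The norm bound for slices is read off
from this. -/
lemma inner_algSliceR {g : B →L[ℂ] ℂ} {η η' : UnivSpace B}
    (hg : ∀ b, g b = ⟪η, univRep B b η'⟫_ℂ) (x : A ⊗[ℂ] B) (ζ ζ' : UnivSpace A) :
    ⟪ζ, univRep A (algSliceR g x) ζ'⟫_ℂ =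
      ⟪HTensor.tmul ζ η, (toMin x : MinTensor A B).1 (HTensor.tmul ζ' η')⟫_ℂ := by
  induction x with
  | zero => simp
  | add x y hx hy =>
    rw [map_add, map_add, add_apply, inner_add_right, hx, hy, ← inner_add_right, map_add]
    rfl
  | tmul a b =>
    have h1 : algSliceR g (a ⊗ₜ[ℂ] b) = g b • a := rfl
    have h2 : (toMin (a ⊗ₜ[ℂ] b) : MinTensor A B).1 =
        HTensor.map (univRep A a) (univRep B b) := rfl
    rw [h1, h2, HTensor.map_tmul, HTensor.inner_tmul, map_smul, smul_apply, inner_smul_right, hg,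
      mul_comm]

lemma inner_algSliceL {f : A →L[ℂ] ℂ} {ζ ζ' : UnivSpace A}
    (hf : ∀ a, f a = ⟪ζ, univRep A a ζ'⟫_ℂ) (x : A ⊗[ℂ] B) (η η' : UnivSpace B) :
    ⟪η, univRep B (algSliceL f x) η'⟫_ℂ =
      ⟪HTensor.tmul ζ η, (toMin x : MinTensor A B).1 (HTensor.tmul ζ' η')⟫_ℂ := by
  induction x with
  | zero => simp
  | add x y hx hy =>
    rw [map_add, map_add, add_apply, inner_add_right, hx, hy, ← inner_add_right, map_add]
    rfl
  | tmul a b =>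
    have h1 : algSliceL f (a ⊗ₜ[ℂ] b) = f a • b := rfl
    have h2 : (toMin (a ⊗ₜ[ℂ] b) : MinTensor A B).1 =
        HTensor.map (univRep A a) (univRep B b) := rfl
    rw [h1, h2, HTensor.map_tmul, HTensor.inner_tmul, map_smul, smul_apply, inner_smul_right, hf]

/-- Take ζ = Tζ' and cancel one factor ‖Tζ'‖. -/
lemma opNorm_le_of_inner {H : Type*} [NormedAddCommGroup H] [InnerProductSpace ℂ H]
    {T : H →L[ℂ] H} {C : ℝ} (hC : 0 ≤ C) (h : ∀ ζ ζ', ‖⟪ζ, T ζ'⟫_ℂ‖ ≤ C * ‖ζ‖ * ‖ζ'‖) :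
    ‖T‖ ≤ C := by
  refine T.opNorm_le_bound hC fun ζ' => ?_
  have h1 := h (T ζ') ζ'
  rw [inner_self_eq_norm_sq_to_K, norm_pow, RCLike.norm_ofReal, abs_norm, sq] at h1
  by_cases h0 : ‖T ζ'‖ = 0
  · rw [h0]; positivity
  · have : 0 < ‖T ζ'‖ := lt_of_le_of_ne (norm_nonneg _) (Ne.symm h0)
    nlinarith

/-- The slice is defined for every functional, but it is known to extend the algebraic slice only
under a norm bound. For a vector functional the product of the norms of its two vectors serves as
the constant. -/
lemma sliceR_toMin {g : B →L[ℂ] ℂ} (hg : IsVecFunctional g) (x : A ⊗[ℂ] B) :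
    sliceR g (toMin x) = algSliceR g x := by
  obtain ⟨η, η', hg⟩ := hg
  refine minExtend_toMin ⟨‖η‖ * ‖η'‖, fun x => ?_⟩ x
  rw [← norm_univRep, mul_comm]
  refine opNorm_le_of_inner (by positivity) fun ζ ζ' => ?_
  rw [inner_algSliceR hg]
  refine (norm_inner_le_norm _ _).trans ?_
  calc _ ≤ ‖HTensor.tmul ζ η‖ * (‖(toMin x : MinTensor A B)‖ * ‖HTensor.tmul ζ' η'‖) := by
        gcongr
        exact ContinuousLinearMap.le_opNorm _ _
    _ = _ := by rw [HTensor.norm_tmul, HTensor.norm_tmul]; ring_nf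

lemma sliceL_toMin {f : A →L[ℂ] ℂ} (hf : IsVecFunctional f) (x : A ⊗[ℂ] B) :
    sliceL f (toMin x) = algSliceL f x := by
  obtain ⟨ζ, ζ', hf⟩ := hf
  refine minExtend_toMin ⟨‖ζ‖ * ‖ζ'‖, fun x => ?_⟩ x
  rw [← norm_univRep, mul_comm]
  refine opNorm_le_of_inner (by positivity) fun η η' => ?_
  rw [inner_algSliceL hf]
  refine (norm_inner_le_norm _ _).trans ?_
  calc _ ≤ ‖HTensor.tmul ζ η‖ * (‖(toMin x : MinTensor A B)‖ * ‖HTensor.tmul ζ' η'‖) := by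
        gcongr
        exact ContinuousLinearMap.le_opNorm _ _
    _ = _ := by rw [HTensor.norm_tmul, HTensor.norm_tmul]; ring_nf

lemma sliceR_tmul {g : B →L[ℂ] ℂ} (hg : IsVecFunctional g) (a : A) (b : B) :
    sliceR g (minTmul a b) = g b • a := sliceR_toMin hg _

lemma sliceL_tmul {f : A →L[ℂ] ℂ} (hf : IsVecFunctional f) (a : A) (b : B) :
    sliceL f (minTmul a b) = f a • b := sliceL_toMin hf _

lemma continuous_inner_val (ζ ζ' : HTensor (UnivSpace A) (UnivSpace B)) :
    Continuous fun X : MinTensor A B => ⟪ζ, X.1 ζ'⟫_ℂ := by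
  have : Continuous fun X : MinTensor A B => X.1 := continuous_subtype_val
  fun_prop

/-- This exhibits f ⊗ g as a matrix element between elementary tensors, the form in which positivity
and coassociativity can be checked. -/
lemma apply_sliceR {f : A →L[ℂ] ℂ} {g : B →L[ℂ] ℂ} {ζ ζ' : UnivSpace A} {η η' : UnivSpace B}
    (hf : ∀ a, f a = ⟪ζ, univRep A a ζ'⟫_ℂ) (hg : ∀ b, g b = ⟪η, univRep B b η'⟫_ℂ)
    (X : MinTensor A B) :
    f (sliceR g X) = ⟪HTensor.tmul ζ η, X.1 (HTensor.tmul ζ' η')⟫_ℂ := by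
  refine MinTensor.eq_of_tmul (f.comp (sliceR g)).continuous (continuous_inner_val _ _)
    (map_add (f.comp (sliceR g))) (fun X Y => inner_add_right _ _ _) (fun a b => ?_) X
  change f (sliceR g (minTmul a b)) = ⟪HTensor.tmul ζ η, (minTmul a b).1 (HTensor.tmul ζ' η')⟫_ℂ
  rw [minTmul, sliceR_toMin ⟨η, η', hg⟩, hf, inner_algSliceR hg]

/-- The two ways of applying `f ⊗ g` agree. -/
lemma apply_sliceR_eq_apply_sliceL {f : A →L[ℂ] ℂ} {g : B →L[ℂ] ℂ} (hf : IsVecFunctional f)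
    (hg : IsVecFunctional g) (X : MinTensor A B) : f (sliceR g X) = g (sliceL f X) := by
  refine DFunLike.congr_fun (MinTensor.ext_clm (F := f.comp (sliceR g)) (G := g.comp (sliceL f))
    fun a b => ?_) X
  change f (sliceR g (minTmul a b)) = g (sliceL f (minTmul a b))
  rw [sliceR_tmul hg, sliceL_tmul hf, map_smul, map_smul, smul_eq_mul, smul_eq_mul, mul_comm]

/-- For positive f and g, the functional f ⊗ g is given by the single vector x = ζ ⊗ η, and ⟪x, Y^*Y
x⟫ = ‖Yx‖². -/
lemma isPosFunctional_comp_sliceR {f : A →L[ℂ] ℂ} {g : B →L[ℂ] ℂ} (hf : IsPosFunctional f)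
    (hg : IsPosFunctional g) : IsPosFunctional (f.comp (sliceR g)) := by
  intro Y
  obtain ⟨ζ, hf⟩ := hf.exists_vector
  obtain ⟨η, hg⟩ := hg.exists_vector
  change 0 ≤ f (sliceR g _)
  rw [apply_sliceR hf hg]
  change 0 ≤ ⟪_, (star Y.1 * Y.1) _⟫_ℂ
  rw [ContinuousLinearMap.star_eq_adjoint, mul_apply_eq_comp,
    ContinuousLinearMap.adjoint_inner_right, inner_self_eq_norm_sq_to_K, ← RCLike.ofReal_pow]
  exact RCLike.ofReal_nonneg.mpr (sq_nonneg _)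

lemma isPosFunctional_comp_sliceL {f : A →L[ℂ] ℂ} {g : B →L[ℂ] ℂ} (hf : IsPosFunctional f)
    (hg : IsPosFunctional g) : IsPosFunctional (g.comp (sliceL f)) := by
  have : g.comp (sliceL f) = f.comp (sliceR g) := by
    ext X
    exact (apply_sliceR_eq_apply_sliceL hf.isVecFunctional hg.isVecFunctional X).symm
  rw [this]
  exact isPosFunctional_comp_sliceR hf hg

lemma minTmul_mul (a a' : A) (b b' : B) :
    (minTmul a b * minTmul a' b' : MinTensor A B) =
      minTmul (a * a') (b * b') := by
  rw [minTmul, minTmul, minTmul, ← map_mul, Algebra.TensorProduct.tmul_mul_tmul]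

lemma star_minTmul (a : A) (b : B) :
    (star (minTmul a b) : MinTensor A B) = minTmul (star a) (star b) := by
  rw [minTmul, minTmul, ← map_star, TensorProduct.star_tmul]

/-- The first tensor factor comes out of the slice, while the second is absorbed into the
functional. -/
lemma sliceR_mul_left {g : B →L[ℂ] ℂ} (hg : IsVecFunctional g) (a : A) (b : B) (X : MinTensor A B) :
    sliceR g (minTmul a b * X) = a * sliceR (g.comp (ContinuousLinearMap.mul ℂ B b)) X := by
  refine MinTensor.eq_of_tmul
    (F := fun X => sliceR g (minTmul a b * X))
    (G := fun X => a * sliceR (g.comp (ContinuousLinearMap.mul ℂ B b)) X)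
    (by fun_prop) (by fun_prop) (fun X Y => by simp only [mul_add, map_add])
    (fun X Y => by simp only [map_add, mul_add]) (fun a' b' => ?_) X
  rw [minTmul_mul, sliceR_tmul hg, sliceR_tmul (hg.comp_mul_left b), mul_smul_comm]
  rfl

lemma sliceR_mul_right {g : B →L[ℂ] ℂ} (hg : IsVecFunctional g)
    (a : A) (b : B) (X : MinTensor A B) :
    sliceR g (X * minTmul a b) =
      sliceR (g.comp ((ContinuousLinearMap.mul ℂ B).flip b)) X * a := by
  refine MinTensor.eq_of_tmul
    (F := fun X => sliceR g (X * minTmul a b))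
    (G := fun X => sliceR (g.comp ((ContinuousLinearMap.mul ℂ B).flip b)) X * a)
    (by fun_prop) (by fun_prop) (fun X Y => by simp only [add_mul, map_add])
    (fun X Y => by simp only [map_add, add_mul]) (fun a' b' => ?_) X
  rw [minTmul_mul, sliceR_tmul hg, sliceR_tmul (hg.comp_mul_right b), smul_mul_assoc]
  rfl

lemma sliceR_left_mul {g : B →L[ℂ] ℂ} (hg : IsVecFunctional g) (a : A) (X : MinTensor A B) :
    sliceR g (minTmul a (1 : B) * X) = a * sliceR g X := by
  rw [sliceR_mul_left hg]
  have h1 : g.comp (ContinuousLinearMap.mul ℂ B 1) = g :=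
    ContinuousLinearMap.ext fun x => congrArg g (one_mul x)
  rw [h1]

lemma sliceR_right_mul {g : B →L[ℂ] ℂ} (hg : IsVecFunctional g) (a : A) (X : MinTensor A B) :
    sliceR g (X * minTmul a (1 : B)) = sliceR g X * a := by
  rw [sliceR_mul_right hg]
  have h1 : g.comp ((ContinuousLinearMap.mul ℂ B).flip 1) = g :=
    ContinuousLinearMap.ext fun x => congrArg g (mul_one x)
  rw [h1]

lemma sliceL_mul_left {f : A →L[ℂ] ℂ} (hf : IsVecFunctional f) (a : A) (b : B) (X : MinTensor A B) :
    sliceL f (minTmul a b * X) = b * sliceL (f.comp (ContinuousLinearMap.mul ℂ A a)) X := by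
  refine MinTensor.eq_of_tmul
    (F := fun X => sliceL f (minTmul a b * X))
    (G := fun X => b * sliceL (f.comp (ContinuousLinearMap.mul ℂ A a)) X)
    (by fun_prop) (by fun_prop) (fun X Y => by simp only [mul_add, map_add])
    (fun X Y => by simp only [map_add, mul_add]) (fun a' b' => ?_) X
  rw [minTmul_mul, sliceL_tmul hf, sliceL_tmul (hf.comp_mul_left a), mul_smul_comm]
  rfl

lemma sliceL_mul_right {f : A →L[ℂ] ℂ} (hf : IsVecFunctional f)
    (a : A) (b : B) (X : MinTensor A B) :
    sliceL f (X * minTmul a b) =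
      sliceL (f.comp ((ContinuousLinearMap.mul ℂ A).flip a)) X * b := by
  refine MinTensor.eq_of_tmul
    (F := fun X => sliceL f (X * minTmul a b))
    (G := fun X => sliceL (f.comp ((ContinuousLinearMap.mul ℂ A).flip a)) X * b)
    (by fun_prop) (by fun_prop) (fun X Y => by simp only [add_mul, map_add])
    (fun X Y => by simp only [map_add, add_mul]) (fun a' b' => ?_) X
  rw [minTmul_mul, sliceL_tmul hf, sliceL_tmul (hf.comp_mul_right a), smul_mul_assoc]
  rfl

lemma sliceL_left_mul {f : A →L[ℂ] ℂ} (hf : IsVecFunctional f) (b : B) (X : MinTensor A B) :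
    sliceL f (minTmul (1 : A) b * X) = b * sliceL f X := by
  rw [sliceL_mul_left hf]
  have h1 : f.comp (ContinuousLinearMap.mul ℂ A 1) = f :=
    ContinuousLinearMap.ext fun x => congrArg f (one_mul x)
  rw [h1]

lemma sliceL_right_mul {f : A →L[ℂ] ℂ} (hf : IsVecFunctional f) (b : B) (X : MinTensor A B) :
    sliceL f (X * minTmul (1 : A) b) = sliceL f X * b := by
  rw [sliceL_mul_right hf]
  have h1 : f.comp ((ContinuousLinearMap.mul ℂ A).flip 1) = f :=
    ContinuousLinearMap.ext fun x => congrArg f (mul_one x)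
  rw [h1]

lemma sliceR_star {g : B →L[ℂ] ℂ} (hg : IsPosFunctional g) (X : MinTensor A B) :
    sliceR g (star X) = star (sliceR g X) := by
  refine MinTensor.eq_of_tmul
    (F := fun X => sliceR g (star X))
    (G := fun X => star (sliceR g X))
    (by fun_prop) (by fun_prop) (fun X Y => by simp only [star_add, map_add])
    (fun X Y => by simp only [map_add, star_add]) (fun a b => ?_) X
  rw [star_minTmul, sliceR_tmul hg.isVecFunctional, sliceR_tmul hg.isVecFunctional, star_smul,
    hg.apply_star]
  rfl

lemma sliceL_star {f : A →L[ℂ] ℂ} (hf : IsPosFunctional f) (X : MinTensor A B) :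
    sliceL f (star X) = star (sliceL f X) := by
  refine MinTensor.eq_of_tmul
    (F := fun X => sliceL f (star X))
    (G := fun X => star (sliceL f X))
    (by fun_prop) (by fun_prop) (fun X Y => by simp only [star_add, map_add])
    (fun X Y => by simp only [map_add, star_add]) (fun a b => ?_) X
  rw [star_minTmul, sliceL_tmul hf.isVecFunctional, sliceL_tmul hf.isVecFunctional, star_smul,
    hf.apply_star]
  rfl

end Slices
end

noncomputable section

/-! ### The Haar state -/

section Haar

attribute [local instance] CStarAlgebra.spectralOrder CStarAlgebra.spectralOrderedRing
open scoped ComplexOrder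

variable {A : Type*} [CStarAlgebra A]

/-- States have pointwise limits along ultrafilters. -/
lemma exists_state_tendsto {ι : Type*} (U : Ultrafilter ι) {s : ι → A →L[ℂ] ℂ}
    (hs : ∀ i, IsState (s i)) :
    ∃ h : A →L[ℂ] ℂ, IsState h ∧ ∀ a, Filter.Tendsto (fun i => s i a) U (nhds (h a)) := by
  have hlim : ∀ a, ∃ z : ℂ, Filter.Tendsto (fun i => s i a) U (nhds z) := by
    intro a
    -- States are contractive, so their values at a stay in the compact disc of radius ‖a‖, where
    -- every ultrafilter converges.
    obtain ⟨z, -, hz⟩ := (isCompact_closedBall (0 : ℂ) ‖a‖).ultrafilter_le_nhds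
      (U.map fun i => s i a) (by
        rw [Ultrafilter.coe_map, Filter.le_principal_iff, Filter.mem_map]
        exact Filter.Eventually.of_forall fun i => by simpa using (hs i).norm_apply_le a)
    exact ⟨z, hz⟩
  choose f hf using hlim
  let h : A →L[ℂ] ℂ := LinearMap.mkContinuous
    { toFun := f
      map_add' := fun a b => tendsto_nhds_unique
        ((hf (a + b)).congr fun i => map_add (s i) a b) ((hf a).add (hf b))
      map_smul' := fun c a => tendsto_nhds_unique
        ((hf (c • a)).congr fun i => map_smul (s i) c a) ((hf a).const_smul c) } 1 fun a => by
      rw [one_mul]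
      exact le_of_tendsto' (hf a).norm fun i => (hs i).norm_apply_le a
  refine ⟨h, ⟨?_, fun a => ge_of_tendsto' (hf _) fun i => (hs i).2 a⟩, hf⟩
  exact tendsto_nhds_unique (hf 1) (tendsto_const_nhds.congr fun i => (hs i).1.symm)

/-- Without states, `ext_state` would hold vacuously and identify 1 with 0. -/
lemma exists_state [Nontrivial A] : ∃ f : A →L[ℂ] ℂ, IsState f := by
  by_contra hne
  push Not at hne
  exact one_ne_zero (ext_state (A := A) (a := 1) (b := 0) fun f hf => (hne f hf).elim)

/-- The limit points of the Cesàro means of a convolution operator are invariant. -/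
lemma exists_state_invariant {P : A →L[ℂ] A} (hP : ∀ f : A →L[ℂ] ℂ, IsState f → IsState (f.comp P))
    {ω : A →L[ℂ] ℂ} (hω : IsState ω) {Q : A →L[ℂ] A}
    (hPQ : ∀ k a, ω ((P ^ k) (Q a)) = ω ((P ^ (k + 1)) a)) :
    ∃ h : A →L[ℂ] ℂ, IsState h ∧ (∀ a, h (P a) = h a) ∧ ∀ a, h (Q a) = h a := by
  have hk : ∀ k, IsState (ω.comp (P ^ k)) := by
    intro k
    induction k with
    | zero => exact hω
    | succ k ih => rw [pow_succ]; exact hP _ ih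
  -- Cesàro means over k = 0, …, n; with n + 1 terms the denominator is nonzero for every n.
  let s : ℕ → A →L[ℂ] ℂ := fun n => ((n : ℂ) + 1)⁻¹ • ∑ k ∈ Finset.range (n + 1), ω.comp (P ^ k)
  have hsa : ∀ n a, s n a = ((n : ℂ) + 1)⁻¹ * ∑ k ∈ Finset.range (n + 1), ω ((P ^ k) a) := by
    intro n a
    simp [s]
  have hs : ∀ n, IsState (s n) := by
    intro n
    have hn : (n : ℂ) + 1 ≠ 0 := by exact_mod_cast n.succ_ne_zero
    constructor
    · rw [hsa]
      have : ∀ k, ω ((P ^ k) 1) = 1 := fun k => (hk k).1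
      rw [Finset.sum_congr rfl fun k _ => this k]
      simp [hn]
    · intro a
      rw [hsa]
      refine mul_nonneg ?_ (Finset.sum_nonneg fun k _ => (hk k).2 a)
      have : (0 : ℝ) ≤ ((n : ℝ) + 1)⁻¹ := by positivity
      have h1 : ((n : ℂ) + 1)⁻¹ = (((n : ℝ) + 1)⁻¹ : ℝ) := by push_cast; rfl
      rw [h1]
      exact Complex.zero_le_real.mpr this
  obtain ⟨h, hh, hlim⟩ := exists_state_tendsto (Filter.hyperfilter ℕ) hs
  have hPa : ∀ a, h (P a) = h a := by
    intro a
    -- The difference telescopes to two boundary terms of modulus at most ‖a‖ each, divided by n +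
    -- 1.
    have h1 : ∀ n, s n (P a) - s n a = ((n : ℂ) + 1)⁻¹ * (ω ((P ^ (n + 1)) a) - ω a) := by
      intro n
      rw [hsa, hsa, ← mul_sub, ← Finset.sum_sub_distrib]
      congr 1
      have := Finset.sum_range_sub (fun k => ω ((P ^ k) a)) (n + 1)
      rw [pow_zero] at this
      rw [← show ω ((1 : A →L[ℂ] A) a) = ω a from rfl, ← this]
      refine Finset.sum_congr rfl fun k _ => ?_
      rw [pow_succ]
      rfl
    have h2 : Filter.Tendsto (fun n => s n (P a) - s n a) (Filter.hyperfilter ℕ) (nhds 0) := by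
      refine Filter.Tendsto.mono_left (f := _) ?_ (Nat.hyperfilter_le_atTop)
      have hz : Filter.Tendsto (fun n : ℕ => 2 * ‖a‖ * (1 / ((n : ℝ) + 1))) Filter.atTop
          (nhds 0) := by
        simpa using tendsto_one_div_add_atTop_nhds_zero_nat.const_mul (2 * ‖a‖)
      refine squeeze_zero_norm (fun n => ?_) hz
      rw [h1, norm_mul, mul_comm]
      have h3 : ‖ω ((P ^ (n + 1)) a) - ω a‖ ≤ 2 * ‖a‖ := by
        refine (norm_sub_le _ _).trans ?_
        have := (hk (n + 1)).norm_apply_le a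
        have := hω.norm_apply_le a
        simp only [ContinuousLinearMap.comp_apply] at *
        linarith
      have h4 : ‖((n : ℂ) + 1)⁻¹‖ = 1 / ((n : ℝ) + 1) := by
        rw [norm_inv, one_div, ← Nat.cast_succ, Complex.norm_natCast, Nat.cast_succ]
      rw [h4]
      gcongr
    exact sub_eq_zero.mp (tendsto_nhds_unique ((hlim (P a)).sub (hlim a)) h2)
  refine ⟨h, hh, hPa, fun a => ?_⟩
  -- By `hPQ` the means at Q a and at P a agree term by term, so invariance under Q follows from
  -- invariance under P.
  rw [← hPa a]
  refine tendsto_nhds_unique ((hlim (Q a)).congr fun n => ?_) (hlim (P a))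
  rw [hsa, hsa]
  congr 1
  refine Finset.sum_congr rfl fun k _ => ?_
  rw [hPQ, pow_succ]
  rfl

/-- Van Daele's argument: invariance under a state passes to the states it dominates.  It is
stated for abstract slice maps, so that it applies to both legs of the coproduct. -/
lemma invariant_of_dominated {E : Type*} [CStarAlgebra E] {Δ ι κ : A →⋆ₐ[ℂ] E}
    (hdense : Dense (Submodule.span ℂ {x : E | ∃ b c : A, x = ι b * Δ c} : Set E))
    {h ρ : A →L[ℂ] ℂ} {Sω Sρ Sh S'h : E →L[ℂ] A}
    (hω : ∀ c X, Sω (ι c * X) = c * Sω X) (hω' : ∀ c X, Sω (X * ι c) = Sω X * c)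
    (hω1 : Sω 1 = 1) (hρ : ∀ c X, Sρ (ι c * X) = c * Sρ X) (hρ1 : Sρ 1 = 1)
    (hωs : ∀ X, Sω (star X) = star (Sω X))
    (hpos : IsPosFunctional (h.comp Sρ)) {ε : ℝ} (hε : 0 < ε)
    (hdom : ∀ Y, (ε : ℂ) * h (Sρ (star Y * Y)) ≤ h (Sω (star Y * Y)))
    (hinv : ∀ a, h (Sω (Δ a)) = h a) (hfix : ∀ a, Sω (Δ (Sh (Δ a))) = Sh (Δ a))
    (hκ : ∀ y, S'h (κ y) = y)
    (hco : ∀ c a, ρ (Sh (Δ (S'h (ι c * Δ a)))) = h (c * Sρ (Δ (Sh (Δ a)))))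
    (hco' : ∀ c a, h (S'h (ι c * Δ a)) = h (c * Sh (Δ a))) (y : A) :
    ρ (Sh (Δ y)) = h y := by
  have hΔ : Continuous Δ := AddMonoidHomClass.continuous_of_bound Δ 1 fun x => by
    rw [one_mul]; exact NonUnitalStarAlgHom.norm_apply_le Δ x
  have hSρι : ∀ c, Sρ (ι c) = c := fun c => by
    have := hρ c 1
    rwa [mul_one, hρ1, mul_one] at this
  have hSωι : ∀ c, Sω (ι c) = c := fun c => by
    have := hω c 1
    rwa [mul_one, hω1, mul_one] at this
  -- Let b be the h-slice of Δ(a) and Y = Δ(b) − ι(b). Then h(Sω(Y^*Y)) = 0: by `hfix` both cross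
  -- terms slice to b^*b, and by `hinv` the term Δ(b^*b) contributes h(b^*b). Domination transfers
  -- the vanishing to Sρ, and Cauchy–Schwarz allows Y^* to be replaced by ι(c).
  have key : ∀ c a, h (c * Sρ (Δ (Sh (Δ a)))) = h (c * Sh (Δ a)) := by
    intro c a
    have hb := hfix a
    set b := Sh (Δ a)
    set Y := Δ b - ι b with hY
    have hYω : h (Sω (star Y * Y)) = 0 := by
      have : star Y * Y = Δ (star b * b) - star (Δ b) * ι b - ι (star b) * Δ b
          + ι (star b * b) := by
        rw [hY, star_sub, ← map_star Δ, ← map_star ι, map_mul, map_mul]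
        noncomm_ring
      rw [this, map_add, map_sub, map_sub, hω', hωs, hb, hω, hb, hSωι, sub_add_cancel, map_sub,
        hinv, sub_self]
    have hYρ : h (Sρ (star Y * Y)) = 0 := by
      have h1 := hdom Y
      rw [hYω] at h1
      have h2 : (0 : ℂ) ≤ h (Sρ (star Y * Y)) := hpos Y
      have hε' : (0 : ℂ) < (ε : ℂ) := by exact_mod_cast hε
      have h3 := le_antisymm h1 (mul_nonneg hε'.le h2)
      exact (mul_eq_zero.mp h3).resolve_left hε'.ne'
    have h4 : h (Sρ (ι c * Y)) = 0 := hpos.mul_eq_zero hYρ (ι c)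
    rw [hρ, hY, map_sub, hSρι, mul_sub, map_sub, sub_eq_zero] at h4
    exact h4
  -- For X = ι(c)Δ(a), the relations `hco` and `hco'` turn `key` into the desired equality. Density
  -- extends it to all X, and X = κ(y) then reaches an arbitrary y.
  have hall : ∀ X, ρ (Sh (Δ (S'h X))) = h (S'h X) := by
    let F : E →ₗ[ℂ] ℂ := ρ.toLinearMap ∘ₗ Sh.toLinearMap ∘ₗ Δ.toLinearMap ∘ₗ S'h.toLinearMap -
      h.toLinearMap ∘ₗ S'h.toLinearMap
    have hF : ∀ X, F X = ρ (Sh (Δ (S'h X))) - h (S'h X) := fun X => rfl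
    have hFc : Continuous F :=
      (ρ.continuous.comp (Sh.continuous.comp (hΔ.comp S'h.continuous))).sub
        (h.continuous.comp S'h.continuous)
    have hF0 : ∀ X ∈ Submodule.span ℂ {x : E | ∃ b c : A, x = ι b * Δ c}, F X = 0 := by
      intro X hX
      have hle : Submodule.span ℂ {x : E | ∃ b c : A, x = ι b * Δ c} ≤ LinearMap.ker F := by
        refine Submodule.span_le.mpr ?_
        rintro _ ⟨c, a, rfl⟩
        change F _ = 0
        rw [hF, hco, hco', key, sub_self]
      exact hle hX
    intro X
    have : F = (fun _ => 0 : E → ℂ) :=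
      hFc.ext_on hdense continuous_const hF0
    exact sub_eq_zero.mp ((hF X).symm.trans (congrFun this X))
  have := hall (κ y)
  rwa [hκ] at this

end Haar
end

/-! ### Convolution operators and the existence of the Haar state -/

noncomputable section

section Haar

attribute [local instance] CStarAlgebra.spectralOrder CStarAlgebra.spectralOrderedRing
open scoped ComplexOrder

variable {A : Type*} [CStarAlgebra A]

lemma StarAlgHom.continuous_cstar {B E : Type*} [CStarAlgebra B] [CStarAlgebra E] (φ : B →⋆ₐ[ℂ] E) :
    Continuous φ :=
  AddMonoidHomClass.continuous_of_bound φ 1 fun x => by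
    rw [one_mul]; exact NonUnitalStarAlgHom.norm_apply_le φ x

variable (A) in
/-- The embedding `a ↦ a ⊗ 1`. -/
def minInclL : A →⋆ₐ[ℂ] MinTensor A A :=
  toMin.comp { (Algebra.TensorProduct.includeLeft : A →ₐ[ℂ] A ⊗[ℂ] A) with
    map_star' := fun x => by simp [TensorProduct.star_tmul] }

variable (A) in
/-- The embedding `a ↦ 1 ⊗ a`. -/
def minInclR : A →⋆ₐ[ℂ] MinTensor A A :=
  toMin.comp { (Algebra.TensorProduct.includeRight : A →ₐ[ℂ] A ⊗[ℂ] A) with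
    map_star' := fun x => by simp [TensorProduct.star_tmul] }

lemma minInclL_apply (a : A) : minInclL A a = minTmul a 1 := rfl
lemma minInclR_apply (a : A) : minInclR A a = minTmul 1 a := rfl

lemma minTmul_one : (minTmul 1 1 : MinTensor A A) = 1 := map_one toMin

namespace CompactQuantumGroup

variable (G : CompactQuantumGroup A)

/-- The convolution operator `(ι ⊗ g) ∘ Δ`. -/
def convR (g : A →L[ℂ] ℂ) : A →L[ℂ] A :=
  (sliceR g).comp ⟨G.comul.toLinearMap, G.comul.continuous_cstar⟩

/-- The convolution operator `(f ⊗ ι) ∘ Δ`. -/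
def convL (f : A →L[ℂ] ℂ) : A →L[ℂ] A :=
  (sliceL f).comp ⟨G.comul.toLinearMap, G.comul.continuous_cstar⟩

lemma convR_apply (g : A →L[ℂ] ℂ) (a : A) : G.convR g a = sliceR g (G.comul a) := rfl
lemma convL_apply (f : A →L[ℂ] ℂ) (a : A) : G.convL f a = sliceL f (G.comul a) := rfl

variable {G} {f g k : A →L[ℂ] ℂ}

lemma apply_convR (hf : IsVecFunctional f) (hg : IsVecFunctional g) (a : A) :
    f (G.convR g a) = g (G.convL f a) := apply_sliceR_eq_apply_sliceL hf hg _

/-- Coassociativity in terms of functionals: both sides are f ⊗ g ⊗ k applied to the iterated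
coproduct of a. Vector functionals fit because `IsCoaction` compares matrix elements between
elementary tensors. -/
lemma apply_convR_convR (hf : IsVecFunctional f) (hg : IsVecFunctional g) (hk : IsVecFunctional k)
    (a : A) : f (G.convR g (G.convR k a)) = g (G.convR k (G.convL f a)) := by
  obtain ⟨ζ, ζ', hf'⟩ := hf
  obtain ⟨η, η', hg'⟩ := hg
  obtain ⟨θ, θ', hk'⟩ := hk
  have hcont : ∀ {H : Type _} [NormedAddCommGroup H] [InnerProductSpace ℂ H]
      (Φ : MinTensor A A →L[ℂ] (H →L[ℂ] H)) (v w : H), Continuous fun X => ⟪v, Φ X w⟫_ℂ := by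
    intro H _ _ Φ v w
    have := Φ.continuous
    fun_prop
  have h1 : ∀ X : MinTensor A A, f (G.convR g (sliceR k X)) =
      ⟪HTensor.tmul (HTensor.tmul ζ η) θ,
        minRep ((minTensorSubalgebra A A).subtype.comp G.comul) (univRep A) X
          (HTensor.tmul (HTensor.tmul ζ' η') θ')⟫_ℂ := by
    refine MinTensor.eq_of_tmul ((f.comp (G.convR g)).comp (sliceR k)).continuous
      (hcont _ _ _)
      (map_add ((f.comp (G.convR g)).comp (sliceR k)))
      (fun X Y => by rw [map_add, add_apply, inner_add_right]) fun a b => ?_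
    rw [sliceR_tmul ⟨θ, θ', hk'⟩, map_smul, map_smul, smul_eq_mul, minTmul, minRep_toMin,
      spatialHom_tmul, HTensor.map_tmul, HTensor.inner_tmul, ← hk', mul_comm, convR_apply,
      apply_sliceR hf' hg']
    rfl
  have h2 : ∀ X : MinTensor A A, g (G.convR k (sliceL f X)) =
      ⟪HTensor.tmul ζ (HTensor.tmul η θ),
        minRep (univRep A) ((minTensorSubalgebra A A).subtype.comp G.comul) X
          (HTensor.tmul ζ' (HTensor.tmul η' θ'))⟫_ℂ := by
    refine MinTensor.eq_of_tmul ((g.comp (G.convR k)).comp (sliceL f)).continuous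
      (hcont _ _ _)
      (map_add ((g.comp (G.convR k)).comp (sliceL f)))
      (fun X Y => by rw [map_add, add_apply, inner_add_right]) fun a b => ?_
    rw [sliceL_tmul ⟨ζ, ζ', hf'⟩, map_smul, map_smul, smul_eq_mul, minTmul, minRep_toMin,
      spatialHom_tmul, HTensor.map_tmul, HTensor.inner_tmul, ← hf', convR_apply,
      apply_sliceR hg' hk']
    rfl
  rw [G.convR_apply k a, G.convL_apply f a, h1, h2]
  exact G.coassoc a ζ ζ' η η' θ θ'

/-- Tested on a vector functional g, both orders evaluate f ⊗ g ⊗ k on the iterated coproduct. -/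
lemma convL_convR (hf : IsVecFunctional f) (hk : IsVecFunctional k) (a : A) :
    G.convL f (G.convR k a) = G.convR k (G.convL f a) :=
  ext_vecFunctional fun g hg => by
    rw [← apply_convR hf hg, apply_convR_convR hf hg hk]

lemma convR_one (hg : IsState g) : G.convR g 1 = 1 := by
  rw [convR_apply, map_one, ← minTmul_one, sliceR_tmul hg.isVecFunctional, hg.1, one_smul]

lemma isState_comp_convR (hf : IsState f) (hg : IsState g) : IsState (f.comp (G.convR g)) := by
  refine ⟨?_, fun a => ?_⟩
  · change f (G.convR g 1) = 1
    rw [convR_one hg, hf.1]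
  · have := isPosFunctional_comp_sliceR hf.2 hg.2 (G.comul a)
    rw [← map_star, ← map_mul] at this
    exact this

variable (G) in
-- The Cesàro argument is run with P = `convR ω` and Q = `convL ω`. These commute and ω ∘ Q = ω ∘ P,
-- so ω ∘ P^k ∘ Q = ω ∘ P^{k+1}, and a single limit state is invariant on both sides.
lemma exists_state_invariant_conv {ω : A →L[ℂ] ℂ} (hω : IsState ω) :
    ∃ h : A →L[ℂ] ℂ, IsState h ∧ (∀ a, h (G.convR ω a) = h a) ∧ ∀ a, h (G.convL ω a) = h a := by
  refine exists_state_invariant (fun f hf => isState_comp_convR hf hω) hω fun k a => ?_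
  have h1 : (G.convR ω ^ k) (G.convL ω a) = G.convL ω ((G.convR ω ^ k) a) := by
    induction k generalizing a with
    | zero => rfl
    | succ k ih =>
      rw [pow_succ']
      change G.convR ω ((G.convR ω ^ k) _) = G.convL ω (G.convR ω ((G.convR ω ^ k) a))
      rw [ih, convL_convR hω.isVecFunctional hω.isVecFunctional]
  rw [h1, pow_succ', ← apply_convR hω.isVecFunctional hω.isVecFunctional]
  rfl

variable {h ω ρ : A →L[ℂ] ℂ}

/-- Both invariances under ω enter Van Daele's argument: the right one gives the vanishing of h on
the slice of Y^*Y, and the left one makes (ι ⊗ h)Δ(a) a fixed point of `convR ω`. -/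
lemma apply_convL_of_dominated (hh : IsState h) (hω : IsState ω) (hρ : IsState ρ) {ε : ℝ}
    (hε : 0 < ε) (hdom : IsPosFunctional (ω - (ε : ℂ) • ρ)) (hR : ∀ a, h (G.convR ω a) = h a)
    (hL : ∀ a, h (G.convL ω a) = h a) (a : A) : h (G.convL ρ a) = h a := by
  have hhv := hh.isVecFunctional
  have hωv := hω.isVecFunctional
  have hρv := hρ.isVecFunctional
  rw [← apply_convR hρv hhv]
  have hc : ∀ c x, h (c * x) = h.comp (ContinuousLinearMap.mul ℂ A c) x := fun _ _ => rfl
  refine invariant_of_dominated (Δ := G.comul) (ι := minInclL A) (κ := minInclR A)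
    (Sω := sliceR ω) (Sρ := sliceR ρ) (Sh := sliceR h) (S'h := sliceL h) G.dense_left
    (sliceR_left_mul hωv) (sliceR_right_mul hωv) ?_ (sliceR_left_mul hρv) ?_ (sliceR_star hω.2)
    (isPosFunctional_comp_sliceR hh.2 hρ.2) hε (fun Y => ?_) hR (fun a => ?_) (fun y => ?_)
    (fun c a => ?_) (fun c a => ?_) a
  · rw [← minTmul_one, sliceR_tmul hωv, hω.1, one_smul]
  · rw [← minTmul_one, sliceR_tmul hρv, hρ.1, one_smul]
  · have := isPosFunctional_comp_sliceL hh.2 hdom Y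
    change 0 ≤ ω _ - ε * ρ _ at this
    rwa [apply_sliceR_eq_apply_sliceL hhv hρv, apply_sliceR_eq_apply_sliceL hhv hωv, ← sub_nonneg]
  · change G.convR ω (G.convR h a) = G.convR h a
    refine ext_vecFunctional fun f hf => ?_
    rw [apply_convR_convR hf hωv hhv, apply_convR hωv hhv, hL, ← apply_convR hf hhv]
  · rw [minInclR_apply, sliceL_tmul hhv, hh.1, one_smul]
  · rw [minInclL_apply, sliceL_mul_left hhv, one_mul, hc]
    exact (apply_convR_convR (hhv.comp_mul_left c) hρv hhv a).symm
  · rw [minInclL_apply, sliceL_mul_left hhv, one_mul, hc]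
    exact (apply_convR (hhv.comp_mul_left c) hhv a).symm

/-- The mirror image of the previous argument: the legs are exchanged and the other density
condition is used. -/
lemma apply_convR_of_dominated (hh : IsState h) (hω : IsState ω) (hρ : IsState ρ) {ε : ℝ}
    (hε : 0 < ε) (hdom : IsPosFunctional (ω - (ε : ℂ) • ρ)) (hR : ∀ a, h (G.convR ω a) = h a)
    (hL : ∀ a, h (G.convL ω a) = h a) (a : A) : h (G.convR ρ a) = h a := by
  have hhv := hh.isVecFunctional
  have hωv := hω.isVecFunctional
  have hρv := hρ.isVecFunctional
  rw [apply_convR hhv hρv]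
  have hc : ∀ c x, h (c * x) = h.comp (ContinuousLinearMap.mul ℂ A c) x := fun _ _ => rfl
  refine invariant_of_dominated (Δ := G.comul) (ι := minInclR A) (κ := minInclL A)
    (Sω := sliceL ω) (Sρ := sliceL ρ) (Sh := sliceL h) (S'h := sliceR h) G.dense_right
    (sliceL_left_mul hωv) (sliceL_right_mul hωv) ?_ (sliceL_left_mul hρv) ?_ (sliceL_star hω.2)
    (isPosFunctional_comp_sliceL hρ.2 hh.2) hε (fun Y => ?_) hL (fun a => ?_) (fun y => ?_)
    (fun c a => ?_) (fun c a => ?_) a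
  · rw [← minTmul_one, sliceL_tmul hωv, hω.1, one_smul]
  · rw [← minTmul_one, sliceL_tmul hρv, hρ.1, one_smul]
  · have := isPosFunctional_comp_sliceR hdom hh.2 Y
    change 0 ≤ ω _ - ε * ρ _ at this
    rwa [← apply_sliceR_eq_apply_sliceL hρv hhv, ← apply_sliceR_eq_apply_sliceL hωv hhv,
      ← sub_nonneg]
  · change G.convL ω (G.convL h a) = G.convL h a
    refine ext_vecFunctional fun f hf => ?_
    rw [← apply_convR hωv hf, ← convL_convR hhv hf, ← apply_convR hhv hωv, hR, apply_convR hhv hf]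
  · rw [minInclL_apply, sliceR_tmul hhv, hh.1, one_smul]
  · rw [minInclR_apply, sliceR_mul_left hhv, one_mul, hc]
    change ρ (G.convL h (G.convR _ a)) = _
    rw [convL_convR hhv (hhv.comp_mul_left c), apply_convR hρv (hhv.comp_mul_left c)]
    rfl
  · rw [minInclR_apply, sliceR_mul_left hhv, one_mul, hc]
    exact (apply_convR hhv (hhv.comp_mul_left c) a)

/-- A state dominates another one if it is bounded below by a positive multiple of it. -/
def Dominates (ω ρ : A →L[ℂ] ℂ) : Prop := ∃ ε : ℝ, 0 < ε ∧ IsPosFunctional (ω - (ε : ℂ) • ρ)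

lemma Dominates.trans {ω ρ σ : A →L[ℂ] ℂ} (h₁ : Dominates ω ρ) (h₂ : Dominates ρ σ) :
    Dominates ω σ := by
  obtain ⟨ε, hε, h₁⟩ := h₁
  obtain ⟨δ, hδ, h₂⟩ := h₂
  refine ⟨ε * δ, mul_pos hε hδ, ?_⟩
  have h := h₁.add (h₂.smul (Complex.zero_le_real.mpr hε.le))
  rwa [smul_sub, sub_add_sub_cancel, smul_smul, ← Complex.ofReal_mul] at h

/-- The midpoint of two states dominates each of them with constant 1/2, so domination is directed.
-/
lemma exists_dominates {ρ σ : A →L[ℂ] ℂ} (hρ : IsState ρ) (hσ : IsState σ) :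
    ∃ ω, IsState ω ∧ Dominates ω ρ ∧ Dominates ω σ := by
  have h2 : (0 : ℂ) ≤ ((1 / 2 : ℝ) : ℂ) := Complex.zero_le_real.mpr (by norm_num)
  refine ⟨((1 / 2 : ℝ) : ℂ) • ρ + ((1 / 2 : ℝ) : ℂ) • σ,
    ⟨?_, (hρ.2.smul h2).add (hσ.2.smul h2)⟩, ⟨1 / 2, by norm_num, ?_⟩, ⟨1 / 2, by norm_num, ?_⟩⟩
  · simp only [add_apply, smul_apply, hρ.1, hσ.1]
    norm_num
  · rw [add_sub_cancel_left]; exact hσ.2.smul h2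
  · rw [add_sub_cancel_right]; exact hρ.2.smul h2

variable (G) in
/-- The existence of the Haar state. -/
theorem exists_haar [Nontrivial A] :
    ∃ h : A →L[ℂ] ℂ, IsState h ∧ (∀ a, sliceR h (G.comul a) = h a • (1 : A)) ∧
      ∀ a, sliceL h (G.comul a) = h a • (1 : A) := by
  have := fun ω : {ω : A →L[ℂ] ℂ // IsState ω} => G.exists_state_invariant_conv ω.2
  choose s hs hsR hsL using this
  -- The sets of states dominating a given ρ are nonempty and directed, so they generate a proper
  -- filter. Along a finer ultrafilter every ρ is eventually dominated, which replaces a single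
  -- state dominating all others.
  let F : {ω : A →L[ℂ] ℂ // IsState ω} → Filter {ω : A →L[ℂ] ℂ // IsState ω} :=
    fun ρ => Filter.principal {ω | Dominates ω.1 ρ.1}
  have hne : Nonempty {ω : A →L[ℂ] ℂ // IsState ω} :=
    let ⟨f, hf⟩ := exists_state (A := A); ⟨⟨f, hf⟩⟩
  have : (⨅ ρ, F ρ).NeBot := by
    refine Filter.iInf_neBot_of_directed (fun ρ σ => ?_) fun ρ => ?_
    · obtain ⟨ω, hω, h1, h2⟩ := exists_dominates ρ.2 σ.2
      exact ⟨⟨ω, hω⟩, Filter.principal_mono.mpr fun τ hτ => Dominates.trans hτ h1,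
        Filter.principal_mono.mpr fun τ hτ => Dominates.trans hτ h2⟩
    · obtain ⟨ω, hω, h1, -⟩ := exists_dominates ρ.2 ρ.2
      exact Filter.principal_neBot_iff.mpr ⟨⟨ω, hω⟩, h1⟩
  let U := Ultrafilter.of (⨅ ρ, F ρ)
  obtain ⟨h, hh, hlim⟩ := exists_state_tendsto U hs
  have hev : ∀ ρ : {ω : A →L[ℂ] ℂ // IsState ω},
      {ω : {ω : A →L[ℂ] ℂ // IsState ω} | Dominates ω.1 ρ.1} ∈ U :=
    fun ρ => (Ultrafilter.of_le _).trans (iInf_le F ρ) (Filter.mem_principal_self _)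
  have hR : ∀ ρ, IsState ρ → ∀ a, h (G.convR ρ a) = h a := by
    intro ρ hρ a
    refine tendsto_nhds_unique (hlim _) ((hlim a).congr' ?_)
    filter_upwards [hev ⟨ρ, hρ⟩] with ω ⟨ε, hε, hd⟩
    exact (apply_convR_of_dominated (hs ω) ω.2 hρ hε hd (hsR ω) (hsL ω) a).symm
  have hL : ∀ ρ, IsState ρ → ∀ a, h (G.convL ρ a) = h a := by
    intro ρ hρ a
    refine tendsto_nhds_unique (hlim _) ((hlim a).congr' ?_)
    filter_upwards [hev ⟨ρ, hρ⟩] with ω ⟨ε, hε, hd⟩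
    exact (apply_convL_of_dominated (hs ω) ω.2 hρ hε hd (hsR ω) (hsL ω) a).symm
  have hhv := hh.isVecFunctional
  -- Invariance of h under convolution by ρ says that ρ takes the value h(a) on the corresponding
  -- h-slice of Δ(a); as ρ varies over all states, the slice must be h(a) I.
  refine ⟨h, hh, fun a => ext_state fun ρ hρ => ?_, fun a => ext_state fun ρ hρ => ?_⟩
  · rw [map_smul, hρ.1, smul_eq_mul, mul_one, ← hL ρ hρ a]
    exact apply_convR hρ.isVecFunctional hhv a
  · rw [map_smul, hρ.1, smul_eq_mul, mul_one, ← hR ρ hρ a]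
    exact (apply_convR hhv hρ.isVecFunctional a).symm

end CompactQuantumGroup
end Haar
end

noncomputable section

/-! ### Orthogonality relations -/

section Orthogonality

attribute [local instance] CStarAlgebra.spectralOrder CStarAlgebra.spectralOrderedRing
open scoped ComplexOrder

variable {A : Type*} [CStarAlgebra A] {G : CompactQuantumGroup A}

namespace UnitaryRep

variable (u : UnitaryRep G)

/-- The sesquilinear form `∑ h(u_{φ,i}^* u_{ψ,i})` on the space of a representation. -/
def haarForm (h : A →L[ℂ] ℂ) (φ ψ : u.H) : ℂ :=
  ∑ i, h (star (coeff u.u φ (stdOrthonormalBasis ℂ u.H i)) *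
    coeff u.u ψ (stdOrthonormalBasis ℂ u.H i))

variable {u}

lemma haarForm_eq (h : A →L[ℂ] ℂ) {ι : Type*} [Fintype ι] (e : OrthonormalBasis ι ℂ u.H)
    (φ ψ : u.H) :
    u.haarForm h φ ψ = ∑ i, h (star (coeff u.u φ (e i)) * coeff u.u ψ (e i)) :=
  sum_onb_eq (fun x y => h (star (coeff u.u φ x) * coeff u.u ψ y))
    (by intros; simp only [coeff_add_right, star_add, add_mul, map_add])
    (by intros; simp only [coeff_smul_right, star_smul, smul_mul_assoc, map_smul]; rfl)
    (by intros; simp only [coeff_add_right, mul_add, map_add])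
    (by intros; simp only [coeff_smul_right, mul_smul_comm, map_smul]) _ e

lemma conj_haarForm {h : A →L[ℂ] ℂ} (hh : IsState h) (φ ψ : u.H) :
    conj (u.haarForm h φ ψ) = u.haarForm h ψ φ := by
  rw [haarForm, haarForm, map_sum]
  refine Finset.sum_congr rfl fun i _ => ?_
  rw [← hh.2.apply_star, star_mul, star_star]

/-- The positive operator representing the form `haarForm`. -/
def haarOp (u : UnitaryRep G) (h : A →L[ℂ] ℂ) : u.H →ₗ[ℂ] u.H where
  toFun ψ := ∑ j, u.haarForm h ψ (stdOrthonormalBasis ℂ u.H j) • stdOrthonormalBasis ℂ u.H j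
  map_add' ψ ψ' := by
    rw [← Finset.sum_add_distrib]
    refine Finset.sum_congr rfl fun j _ => ?_
    rw [← add_smul, haarForm, haarForm, haarForm, ← Finset.sum_add_distrib]
    simp only [coeff_add_left, star_add, add_mul, map_add]
  map_smul' c ψ := by
    rw [Finset.smul_sum]
    refine Finset.sum_congr rfl fun j _ => ?_
    rw [smul_smul, haarForm, haarForm, RingHom.id_apply, Finset.mul_sum]
    simp [coeff_smul_left]

/-- The arguments are exchanged because `haarForm` is linear in its first variable: coefficients are
antilinear there, and so is the adjoint. -/
lemma inner_haarOp (h : A →L[ℂ] ℂ) (φ ψ : u.H) :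
    ⟪φ, u.haarOp h ψ⟫_ℂ = u.haarForm h ψ φ := by
  let e := stdOrthonormalBasis ℂ u.H
  change ⟪φ, ∑ j, u.haarForm h ψ (e j) • e j⟫_ℂ = _
  simp only [haarForm]
  rw [inner_sum]
  simp_rw [inner_smul_right, Finset.sum_mul]
  rw [Finset.sum_comm]
  refine Finset.sum_congr rfl fun i _ => ?_
  rw [coeff_expand_left u.u e φ, Finset.mul_sum, map_sum]
  refine Finset.sum_congr rfl fun j _ => ?_
  rw [mul_smul_comm, map_smul, smul_eq_mul, mul_comm]

lemma haarOp_isSymmetric {h : A →L[ℂ] ℂ} (hh : IsState h) : (u.haarOp h).IsSymmetric := by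
  intro φ ψ
  rw [inner_haarOp, ← inner_conj_symm, inner_haarOp, conj_haarForm hh]

lemma comul_star_mul {ι : Type*} [Fintype ι] (e : OrthonormalBasis ι ℂ u.H) (φ ψ φ' ψ' : u.H) :
    G.comul (star (coeff u.u φ ψ) * coeff u.u φ' ψ') =
      ∑ p, ∑ q, minTmul (star (coeff u.u φ (e p)) * coeff u.u φ' (e q))
        (star (coeff u.u (e p) ψ) * coeff u.u (e q) ψ') := by
  have h1 : ∀ φ ψ, G.comul (coeff u.u φ ψ) =
      ∑ i, minTmul (coeff u.u φ (e i)) (coeff u.u (e i) ψ) := u.sum_comul e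
  rw [map_mul, map_star, h1, h1, star_sum, Finset.sum_mul_sum]
  simp only [star_minTmul, minTmul_mul]

variable {h : A →L[ℂ] ℂ}

/-- The first orthogonality relation, from the right invariance of the Haar state. -/
lemma sum_haarForm (hh : IsState h) (hR : ∀ a, sliceR h (G.comul a) = h a • (1 : A))
    {ι : Type*} [Fintype ι] (e : OrthonormalBasis ι ℂ u.H) (φ ψ : u.H) :
    ∑ p, ∑ q, u.haarForm h (e p) (e q) • (star (coeff u.u φ (e p)) * coeff u.u ψ (e q)) =
      u.haarForm h φ ψ • (1 : A) := by
  -- Right invariance replaces the scalar by the h-slice of a coproduct, which expands over pairs of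
  -- basis vectors.
  have h1 : ∀ i, h (star (coeff u.u φ (e i)) * coeff u.u ψ (e i)) • (1 : A) =
      ∑ p, ∑ q, h (star (coeff u.u (e p) (e i)) * coeff u.u (e q) (e i)) •
        (star (coeff u.u φ (e p)) * coeff u.u ψ (e q)) := by
    intro i
    rw [← hR, comul_star_mul e, map_sum]
    refine Finset.sum_congr rfl fun p _ => ?_
    rw [map_sum]
    exact Finset.sum_congr rfl fun q _ => sliceR_tmul hh.isVecFunctional _ _
  rw [haarForm_eq h e, Finset.sum_smul, Finset.sum_congr rfl fun i _ => h1 i]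
  conv_rhs => rw [Finset.sum_comm]
  refine Finset.sum_congr rfl fun p _ => ?_
  conv_rhs => rw [Finset.sum_comm]
  refine Finset.sum_congr rfl fun q _ => ?_
  rw [haarForm_eq h e, Finset.sum_smul]

/-- Unitarity collapses the second leg, doing the work of an antipode: it lets an adjoint
coefficient in the first leg be exchanged for products of the form (1 ⊗ b)Δ(c). -/
lemma sum_comul_mul_star {ι : Type*} [Fintype ι] (e : OrthonormalBasis ι ℂ u.H) (φ ψ : u.H) :
    ∑ l, minTmul 1 (coeff u.u ψ (e l)) * G.comul (star (coeff u.u φ (e l))) =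
      minTmul (star (coeff u.u φ ψ)) (1 : A) := by
  have h1 : ∀ φ ψ, G.comul (coeff u.u φ ψ) =
      ∑ i, minTmul (coeff u.u φ (e i)) (coeff u.u (e i) ψ) := u.sum_comul e
  have h2 : ∀ (a : A) (b : ι → A), ∑ i, minTmul a (b i) = minTmul a (∑ i, b i) := fun a b => by
    simp only [minTmul, TensorProduct.tmul_sum, map_sum]
  have h3 : ∀ (a b : A) (c : ℂ), minTmul a (c • b) = minTmul (c • a) b := fun a b c => by
    rw [minTmul, minTmul, TensorProduct.smul_tmul]
  have h4 : ∀ (b : A) (a : ι → A), ∑ i, minTmul (a i) b = minTmul (∑ i, a i) b := fun b a => by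
    simp only [minTmul, TensorProduct.sum_tmul, map_sum]
  simp only [map_star, h1, star_sum, star_minTmul, Finset.mul_sum, minTmul_mul, one_mul]
  rw [Finset.sum_comm]
  have h5 : ∀ p, ∑ l, minTmul (star (coeff u.u φ (e p)))
      (coeff u.u ψ (e l) * star (coeff u.u (e p) (e l))) =
      minTmul (⟪ψ, e p⟫_ℂ • star (coeff u.u φ (e p))) (1 : A) := fun p => by
    rw [h2, u.sum_coisometry e, h3]
  rw [Finset.sum_congr rfl fun p _ => h5 p, h4]
  congr 1
  rw [coeff_expand_right u.u e φ ψ, star_sum]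
  refine Finset.sum_congr rfl fun p _ => ?_
  rw [star_smul, RCLike.star_def, inner_conj_symm]

/-- The Haar state need not be faithful, so nonvanishing takes an argument. If the form vanished at
e_s, Cauchy–Schwarz would give h(z u_{sl}) = 0 for all z and l. By `sum_comul_mul_star` and left
invariance, X ↦ (h ⊗ h)((u_{ks}^* ⊗ 1)X) would then vanish on the dense span of the elements (1 ⊗
b)Δ(c), hence everywhere. At X = u_{ks} ⊗ 1 this yields h(u_{ks}^*u_{ks}) = 0, and summing over k
contradicts the isometry relation. -/
lemma haarForm_self_ne_zero [Nontrivial A] (hh : IsState h)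
    (hL : ∀ a, sliceL h (G.comul a) = h a • (1 : A)) {ι : Type*} [Fintype ι]
    (e : OrthonormalBasis ι ℂ u.H) (s : ι) : u.haarForm h (e s) (e s) ≠ 0 := by
  intro h0
  have hhv := hh.isVecFunctional
  rw [haarForm_eq h e, Finset.sum_eq_zero_iff_of_nonneg fun i _ => hh.2 _] at h0
  have hz : ∀ l z, h (z * coeff u.u (e s) (e l)) = 0 := fun l z =>
    hh.2.mul_eq_zero (h0 l (Finset.mem_univ l)) z
  have hk : ∀ k, h (star (coeff u.u (e k) (e s)) * coeff u.u (e k) (e s)) = 0 := by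
    intro k
    let F : MinTensor A A →ₗ[ℂ] ℂ := h.toLinearMap ∘ₗ (sliceL h).toLinearMap ∘ₗ
      LinearMap.mulLeft ℂ (minTmul (star (coeff u.u (e k) (e s))) (1 : A))
    have hF : ∀ X, F X = h (sliceL h (minTmul (star (coeff u.u (e k) (e s))) 1 * X)) :=
      fun X => rfl
    have hFc : Continuous F := (h.comp (sliceL h)).continuous.comp (continuous_const_mul _)
    have hF0 : ∀ X ∈ Submodule.span ℂ
        {x : MinTensor A A | ∃ b c : A, x = toMin ((1 : A) ⊗ₜ[ℂ] b) * G.comul c}, F X = 0 := by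
      intro X hX
      have hle : Submodule.span ℂ
          {x : MinTensor A A | ∃ b c : A, x = toMin ((1 : A) ⊗ₜ[ℂ] b) * G.comul c} ≤
          LinearMap.ker F := by
        refine Submodule.span_le.mpr ?_
        rintro _ ⟨b, c, rfl⟩
        change F (minTmul 1 b * G.comul c) = 0
        have h1 : minTmul (star (coeff u.u (e k) (e s))) 1 * (minTmul 1 b * G.comul c) =
            ∑ l, minTmul 1 (b * coeff u.u (e s) (e l)) *
              G.comul (star (coeff u.u (e k) (e l)) * c) := by
          have h2 : minTmul (star (coeff u.u (e k) (e s))) 1 * minTmul 1 b =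
              minTmul 1 b * minTmul (star (coeff u.u (e k) (e s))) (1 : A) := by
            simp only [minTmul_mul, one_mul, mul_one]
          rw [← mul_assoc, h2, ← sum_comul_mul_star e, Finset.mul_sum, Finset.sum_mul]
          refine Finset.sum_congr rfl fun l _ => ?_
          rw [map_mul, ← mul_assoc, minTmul_mul, one_mul, mul_assoc]
        rw [hF, h1, map_sum, map_sum]
        refine Finset.sum_eq_zero fun l _ => ?_
        rw [sliceL_left_mul hhv, hL, mul_smul_comm, mul_one, map_smul, hz, smul_zero]
      exact hle hX
    have hall : F = (fun _ => 0 : MinTensor A A → ℂ) :=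
      hFc.ext_on G.dense_right continuous_const hF0
    have := congrFun hall (minTmul (coeff u.u (e k) (e s)) 1)
    rwa [hF, minTmul_mul, one_mul, sliceL_tmul hhv, map_smul, hh.1, smul_eq_mul, mul_one] at this
  have h1 := congrArg h (u.sum_isometry e (e s) (e s))
  rw [map_sum, Finset.sum_eq_zero fun k _ => hk k, e.inner_eq_one, one_smul, hh.1] at h1
  exact zero_ne_one h1

variable (u) in
/-- Woronowicz' orthogonality relations: in a suitable orthonormal basis there are weights that
make the transpose of the matrix of coefficients a weighted isometry. -/
theorem exists_weights [Nontrivial A] :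
    ∃ (e : OrthonormalBasis (Fin (Module.finrank ℂ u.H)) ℂ u.H)
      (f : Fin (Module.finrank ℂ u.H) → ℝ), (∀ i, 0 < f i) ∧
      ∀ k l, ∑ p, (f p : ℂ) • (star (coeff u.u (e k) (e p)) * coeff u.u (e l) (e p)) =
        if k = l then (f k : ℂ) • (1 : A) else 0 := by
  obtain ⟨h, hh, hR, hL⟩ := G.exists_haar
  -- In an eigenbasis the double sum of `sum_haarForm` becomes a single weighted sum. The weights
  -- are the eigenvalues, nonnegative since h is positive and nonzero by `haarForm_self_ne_zero`.
  let hQ := haarOp_isSymmetric (u := u) hh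
  let e := hQ.eigenvectorBasis rfl
  let f := hQ.eigenvalues rfl
  have hef : ∀ k l, u.haarForm h (e k) (e l) = if k = l then (f k : ℂ) else 0 := by
    intro k l
    rw [← inner_haarOp]
    change ⟪e l, u.haarOp h (hQ.eigenvectorBasis rfl k)⟫_ℂ = _
    rw [hQ.apply_eigenvectorBasis rfl k, inner_smul_right]
    change (f k : ℂ) * ⟪e l, e k⟫_ℂ = _
    rw [e.inner_eq_ite]
    simp [eq_comm]
  refine ⟨e, f, fun i => ?_, fun k l => ?_⟩
  · have h1 := haarForm_self_ne_zero hh hL e i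
    have h2 : 0 ≤ u.haarForm h (e i) (e i) := by
      rw [haarForm]; exact Finset.sum_nonneg fun _ _ => hh.2 _
    rw [hef, if_pos rfl] at h1 h2
    exact lt_of_le_of_ne (Complex.zero_le_real.mp h2) fun h3 => h1 (by rw [← h3]; simp)
  · have h1 := sum_haarForm hh hR e (e k) (e l)
    simp only [hef, ite_smul, zero_smul, Finset.sum_ite_eq, Finset.mem_univ, if_true] at h1
    exact h1

end UnitaryRep
end Orthogonality
end

noncomputable section

/-! ### Finite dimensionality of the spectral spaces -/

namespace ConjSpace

variable {E : Type*} [NormedAddCommGroup E] [InnerProductSpace ℂ E]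

/-- The identity map to the conjugate space, as an antilinear equivalence. -/
def mkₛₗ : E ≃ₛₗ[starRingEnd ℂ] ConjSpace E where
  toFun := mk
  invFun := mk.symm
  left_inv _ := rfl
  right_inv _ := rfl
  map_add' _ _ := rfl
  map_smul' c x := by
    change mk (c • x) = mk (conj (conj c) • x)
    rw [Complex.conj_conj]

end ConjSpace

/-- Rank is preserved by bijections that are semilinear over a field automorphism, here complex
conjugation. -/
lemma finrank_eq_of_antilinear {E F : Type*} [AddCommGroup E] [Module ℂ E] [AddCommGroup F]
    [Module ℂ F] (j : E ≃ₛₗ[starRingEnd ℂ] F) : Module.finrank ℂ E = Module.finrank ℂ F := by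
  have := lift_rank_eq_of_equiv_equiv (starRingEnd ℂ) j.toAddEquiv
    (starRingAut : ℂ ≃+* ℂ).bijective fun c x => j.map_smulₛₗ c x
  simpa [Module.finrank] using congrArg Cardinal.toNat this

/-- A Hilbert space with a bound on the size of orthonormal families is finite dimensional. -/
lemma finiteDimensional_of_orthonormal_le {E : Type*} [NormedAddCommGroup E]
    [InnerProductSpace ℂ E] [CompleteSpace E] (C : ℝ)
    (h : ∀ (N : ℕ) (T : Fin N → E), Orthonormal ℂ T → (N : ℝ) ≤ C) : FiniteDimensional ℂ E := by
  obtain ⟨w, b, hb⟩ := exists_hilbertBasis ℂ E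
  have hw : w.Finite := by
    by_contra hinf
    -- An infinite Hilbert basis contains ⌊C⌋₊ + 1 orthonormal vectors, more than the bound C
    -- permits.
    obtain ⟨t, ht, hcard⟩ := Set.Infinite.exists_subset_card_eq hinf (⌊C⌋₊ + 1)
    let g : Fin (⌊C⌋₊ + 1) → w := fun i => ⟨(t.equivFin.symm (Fin.cast hcard.symm i)).1,
      ht (t.equivFin.symm (Fin.cast hcard.symm i)).2⟩
    have hg : Function.Injective g := fun i j hij => by
      have := t.equivFin.symm.injective (Subtype.ext
        (show (g i).1 = (g j).1 from congrArg Subtype.val hij))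
      simpa using this
    have := h _ _ (b.orthonormal.comp g hg)
    push_cast at this
    exact absurd this (not_le.mpr (Nat.lt_floor_add_one C))
  have := hw.fintype
  exact Module.Finite.of_basis b.toOrthonormalBasis.toBasis

namespace QAction

attribute [local instance] CStarAlgebra.spectralOrder CStarAlgebra.spectralOrderedRing

variable {A B : Type*} [CStarAlgebra A] [CStarAlgebra B] {G : CompactQuantumGroup A}
variable {η : QAction G B} {u : UnitaryRep G}

/-- The weighted form `∑ f_i T(e_i)^* T(e_i)`. -/
def L.weighted {ι : Type*} [Fintype ι] (e : OrthonormalBasis ι ℂ u.H) (f : ι → ℝ) (T : η.L u) : B :=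
  ∑ i, (f i : ℂ) • (star (T.1 (e i)) * T.1 (e i))

/-- With the factors in the order T^*T, the action produces sums of u_{ki}^*u_{li} over i, which the
coisometry relation does not control. The weights are chosen so that these sums reduce to f_k δ_{kl}
I. -/
lemma L.weighted_fixed {ι : Type*} [Fintype ι] [DecidableEq ι] {e : OrthonormalBasis ι ℂ u.H}
    {f : ι → ℝ}
    (hf : ∀ k l, ∑ p, (f p : ℂ) • (star (coeff u.u (e k) (e p)) * coeff u.u (e l) (e p)) =
      if k = l then (f k : ℂ) • (1 : A) else 0) (T : η.L u) :
    η.toHom (L.weighted e f T) = toMin (L.weighted e f T ⊗ₜ[ℂ] (1 : A)) := by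
  have h1 : ∀ i, η.toHom (T.1 (e i)) = ∑ k, minTmul (T.1 (e k)) (coeff u.u (e k) (e i)) :=
    fun i => L.apply_eq e T (e i)
  have hsm : ∀ (c : ℂ) (b : B) (a : A), c • minTmul b a = minTmul b (c • a) := fun c b a => by
    rw [minTmul, minTmul, TensorProduct.tmul_smul, map_smul]
  have hsum : ∀ (b : B) (a : ι → A), ∑ i, minTmul b (a i) = minTmul b (∑ i, a i) := fun b a => by
    simp only [minTmul, TensorProduct.tmul_sum, map_sum]
  have hsum' : ∀ (a : A) (b : ι → B), ∑ i, minTmul (b i) a = minTmul (∑ i, b i) a := fun a b => by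
    simp only [minTmul, TensorProduct.sum_tmul, map_sum]
  have h2 : ∀ i, η.toHom ((f i : ℂ) • (star (T.1 (e i)) * T.1 (e i))) =
      ∑ k, ∑ l, minTmul (star (T.1 (e k)) * T.1 (e l))
        ((f i : ℂ) • (star (coeff u.u (e k) (e i)) * coeff u.u (e l) (e i))) := by
    intro i
    rw [map_smul, map_mul, map_star, h1, star_sum, Finset.sum_mul_sum]
    simp only [star_minTmul, minTmul_mul, Finset.smul_sum, hsm]
  rw [L.weighted, map_sum, Finset.sum_congr rfl fun i _ => h2 i, Finset.sum_comm]
  change _ = minTmul _ _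
  rw [← hsum']
  refine Finset.sum_congr rfl fun k _ => ?_
  rw [Finset.sum_comm, Finset.sum_congr rfl fun l _ => hsum _ _]
  simp only [hf]
  rw [Finset.sum_eq_single k]
  · rw [if_pos rfl, minTmul, minTmul, TensorProduct.smul_tmul]
  · intro l _ hl
    rw [if_neg hl.symm, minTmul, TensorProduct.tmul_zero, map_zero]
  · simp

variable [η.IsErgodic] [Nontrivial B]

/-- Ergodicity makes the fixed element a scalar c. It is a sum of positive terms, so each term has
norm at most c. -/
lemma L.exists_weighted_eq {ι : Type*} [Fintype ι] [DecidableEq ι]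
    {e : OrthonormalBasis ι ℂ u.H} {f : ι → ℝ} (hpos : ∀ i, 0 < f i)
    (hf : ∀ k l, ∑ p, (f p : ℂ) • (star (coeff u.u (e k) (e p)) * coeff u.u (e l) (e p)) =
      if k = l then (f k : ℂ) • (1 : A) else 0) (T : η.L u) :
    ∃ c : ℝ, 0 ≤ c ∧ L.weighted e f T = (c : ℂ) • (1 : B) ∧ ∀ i, f i * ‖T.1 (e i)‖ ^ 2 ≤ c := by
  have hterm : ∀ i, (0 : B) ≤ (f i : ℂ) • (star (T.1 (e i)) * T.1 (e i)) := by
    intro i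
    have h2 : (f i : ℂ) • (star (T.1 (e i)) * T.1 (e i)) =
        star (((Real.sqrt (f i) : ℝ) : ℂ) • T.1 (e i)) *
          (((Real.sqrt (f i) : ℝ) : ℂ) • T.1 (e i)) := by
      rw [star_smul, smul_mul_smul_comm]
      congr 1
      simp only [RCLike.star_def, Complex.conj_ofReal]
      rw [← Complex.ofReal_mul, Real.mul_self_sqrt (hpos i).le]
    rw [h2]
    exact star_mul_self_nonneg _
  have hnn : (0 : B) ≤ L.weighted e f T := Finset.sum_nonneg fun i _ => hterm i
  obtain ⟨c, hc⟩ := IsErgodic.fixed_scalar _ (L.weighted_fixed hf T)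
  have hcr : ((c.re : ℝ) : ℂ) = c := by
    refine Complex.conj_eq_iff_re.mp (smul_one_inj (B := B) ?_)
    have := (IsSelfAdjoint.of_nonneg hnn).star_eq
    rw [hc, star_smul, star_one] at this
    exact this
  rw [← hcr] at hc
  have hc0 : 0 ≤ c.re := nonneg_of_smul_one_nonneg (B := B) (by rw [← hc]; exact hnn)
  refine ⟨c.re, hc0, hc, fun i => ?_⟩
  have h1 : (f i : ℂ) • (star (T.1 (e i)) * T.1 (e i)) ≤ L.weighted e f T :=
    Finset.single_le_sum (f := fun i => (f i : ℂ) • (star (T.1 (e i)) * T.1 (e i)))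
      (fun i _ => hterm i) (Finset.mem_univ i)
  have h2 := CStarAlgebra.norm_le_norm_of_nonneg_of_le (hterm i) h1
  rw [hc, norm_smul, norm_smul, norm_one, CStarRing.norm_star_mul_self, mul_one, ← sq] at h2
  simpa [abs_of_nonneg (hpos i).le, abs_of_nonneg hc0] using h2

/-- For an orthonormal family in `L_u`, the elements `∑ T_n(ψ)^* T_n(ψ)` are contractions if
`ψ` belongs to an orthonormal basis. -/
lemma L.norm_sum_star_mul_le {ι : Type*} [Fintype ι] (e : OrthonormalBasis ι ℂ u.H) {N : ℕ}
    {T : Fin N → η.L u} (hT : Orthonormal ℂ T) (i : ι) :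
    ‖∑ n, star ((T n).1 (e i)) * (T n).1 (e i)‖ ≤ 1 := by
  -- These form the i-th column of the matrix with entries ∑_n T_n(e_j)^*T_n(e_i). Orthonormality
  -- makes that matrix a projection, whence `hz`, then z_i^*z_i ≤ z_i and ‖z_i‖² ≤ ‖z_i‖.
  let z : ι → B := fun j => ∑ n, star ((T n).1 (e j)) * (T n).1 (e i)
  have hpair : ∀ n m, ∑ j, (T n).1 (e j) * star ((T m).1 (e j)) = if n = m then (1 : B) else 0 := by
    intro n m
    rw [← L.pairing_eq e (T m) (T n), ← L.inner_smul_one, orthonormal_iff_ite.mp hT]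
    by_cases h : n = m
    · subst h; simp
    · rw [if_neg h, if_neg (Ne.symm h), zero_smul]
  have hz : ∑ j, star (z j) * z j = z i := by
    have h1 : ∀ j, star (z j) * z j = ∑ n, ∑ m, star ((T n).1 (e i)) *
        ((T n).1 (e j) * star ((T m).1 (e j))) * (T m).1 (e i) := by
      intro j
      simp only [z, star_sum, Finset.sum_mul_sum, star_mul, star_star, mul_assoc]
    rw [Finset.sum_congr rfl fun j _ => h1 j, Finset.sum_comm]
    refine Finset.sum_congr rfl fun n _ => ?_
    rw [Finset.sum_comm]
    simp only [← Finset.sum_mul, ← Finset.mul_sum, hpair]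
    simp
  have h2 : star (z i) * z i ≤ z i := by
    conv_rhs => rw [← hz]
    exact Finset.single_le_sum (f := fun j => star (z j) * z j)
      (fun j _ => star_mul_self_nonneg _) (Finset.mem_univ i)
  have h3 := CStarAlgebra.norm_le_norm_of_nonneg_of_le (star_mul_self_nonneg _) h2
  rw [CStarRing.norm_star_mul_self] at h3
  change ‖z i‖ ≤ 1
  nlinarith [norm_nonneg (z i)]

variable (η u) in
/-- The spectral spaces are finite dimensional. -/
theorem finiteDimensional_L [Nontrivial A] : FiniteDimensional ℂ (η.L u) := by
  obtain ⟨e, f, hpos, hf⟩ := u.exists_weights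
  -- The constant combines a lower bound 1/∑ f_i^{-1} for each scalar c_n with the upper bound ∑ f_i
  -- for their sum.
  refine finiteDimensional_of_orthonormal_le ((∑ i, (f i)⁻¹) * ∑ i, f i) fun N T hT => ?_
  choose c hc0 hc hci using fun n => L.exists_weighted_eq hpos hf (T n)
  have hlow : ∀ n, 1 ≤ (∑ i, (f i)⁻¹) * c n := by
    intro n
    have h1 : ‖L.pairing (T n) (T n)‖ = 1 := by
      rw [← L.norm_sq, hT.1 n, one_pow]
    rw [← h1, L.pairing_eq e, Finset.sum_mul]
    refine (norm_sum_le _ _).trans (Finset.sum_le_sum fun i _ => ?_)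
    rw [CStarRing.norm_self_mul_star, ← sq, ← div_eq_inv_mul, le_div_iff₀ (hpos i), mul_comm]
    exact hci n i
  -- After exchanging the sums, f_i multiplies ∑_n T_n(e_i)^*T_n(e_i), which is a contraction.
  have hup : ∑ n, c n ≤ ∑ i, f i := by
    have h1 : ((∑ n, c n : ℝ) : ℂ) • (1 : B) =
        ∑ i, (f i : ℂ) • ∑ n, star ((T n).1 (e i)) * (T n).1 (e i) := by
      rw [Complex.ofReal_sum, Finset.sum_smul, Finset.sum_congr rfl fun n _ => (hc n).symm]
      simp only [L.weighted, Finset.smul_sum]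
      exact Finset.sum_comm
    have h2 := congrArg norm h1
    rw [norm_smul, norm_one, mul_one, Complex.norm_real, Real.norm_of_nonneg
      (Finset.sum_nonneg fun n _ => hc0 n)] at h2
    rw [h2]
    refine (norm_sum_le _ _).trans (Finset.sum_le_sum fun i _ => ?_)
    rw [norm_smul, Complex.norm_real, Real.norm_of_nonneg (hpos i).le]
    exact mul_le_of_le_one_right (hpos i).le (L.norm_sum_star_mul_le e hT i)
  have hinv : 0 ≤ ∑ i, (f i)⁻¹ := Finset.sum_nonneg fun i _ => inv_nonneg.mpr (hpos i).le
  calc (N : ℝ) = ∑ _n : Fin N, (1 : ℝ) := by simp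
    _ ≤ ∑ n, (∑ i, (f i)⁻¹) * c n := Finset.sum_le_sum fun n _ => hlow n
    _ = (∑ i, (f i)⁻¹) * ∑ n, c n := by rw [Finset.mul_sum]
    _ ≤ _ := mul_le_mul_of_nonneg_left hup hinv

variable (η u) in
theorem finiteDimensional_Lbar [Nontrivial A] : FiniteDimensional ℂ (η.Lbar u) := by
  have := η.finiteDimensional_L u
  exact Module.Finite.of_surjective (ConjSpace.mkₛₗ (E := η.L u)).toLinearMap
    (ConjSpace.mkₛₗ (E := η.L u)).surjective

end QAction
end

noncomputable section

/-! ### Products, contractions and conjugates of spectral elements -/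

namespace QAction

variable {A B : Type*} [CStarAlgebra A] [CStarAlgebra B] {G : CompactQuantumGroup A}
variable {η : QAction G B} {u v w : UnitaryRep G}

lemma L.apply_eq_minTmul {ι : Type*} [Fintype ι] (e : OrthonormalBasis ι ℂ u.H) (T : η.L u)
    (ψ : u.H) : η.toHom (T.1 ψ) = ∑ i, minTmul (T.1 (e i)) (coeff u.u (e i) ψ) :=
  L.apply_eq e T ψ

lemma L.mem_of_forall {ι : Type*} [Fintype ι] (e : OrthonormalBasis ι ℂ u.H) {T : u.H →ₗ[ℂ] B}
    (h : ∀ ψ, η.toHom (T ψ) = ∑ i, minTmul (T (e i)) (coeff u.u (e i) ψ)) : T ∈ η.L u := by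
  intro ψ
  rw [h, rTensor_eq_sum e, map_sum]
  rfl

/-- The product `ψ ⊗ ψ' ↦ S(ψ) T(ψ')`. -/
def L.mul (S : η.L u) (T : η.L v) : η.L (u.tensor v) :=
  ⟨LinearMap.mul' ℂ B ∘ₗ TensorProduct.map S.1 T.1, by
    let e := stdOrthonormalBasis ℂ u.H
    let f := stdOrthonormalBasis ℂ v.H
    intro (ψ : u.H ⊗[ℂ] v.H)
    induction ψ with
    | zero => simp only [map_zero]
    | add ψ ψ' h h' => simp only [map_add, h, h']
    | tmul ψ ψ' =>
      rw [rTensor_eq_sum (u := u.tensor v) (e.tensorProduct f), map_sum]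
      change η.toHom (S.1 ψ * T.1 ψ') = _
      rw [map_mul, L.apply_eq_minTmul e, L.apply_eq_minTmul f, Finset.sum_mul_sum,
        Fintype.sum_prod_type]
      refine Finset.sum_congr rfl fun i _ => Finset.sum_congr rfl fun j _ => ?_
      rw [minTmul_mul, OrthonormalBasis.tensorProduct_apply, UnitaryRep.coeff_tensorCoact]
      rfl⟩

@[simp] lemma L.mul_tmul (S : η.L u) (T : η.L v) (ψ : u.H) (ψ' : v.H) :
    (L.mul S T).1 (ψ ⊗ₜ[ℂ] ψ') = S.1 ψ * T.1 ψ' := rfl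

lemma L.ext_tmul {S T : η.L (u.tensor v)}
    (h : ∀ (ψ : u.H) (ψ' : v.H), S.1 (ψ ⊗ₜ[ℂ] ψ') = T.1 (ψ ⊗ₜ[ℂ] ψ')) : S = T :=
  Subtype.ext (TensorProduct.ext' h)

lemma L.mul_add_left (S S' : η.L u) (T : η.L v) : L.mul (S + S') T = L.mul S T + L.mul S' T :=
  L.ext_tmul fun _ _ => add_mul _ _ _

lemma L.mul_add_right (S : η.L u) (T T' : η.L v) : L.mul S (T + T') = L.mul S T + L.mul S T' :=
  L.ext_tmul fun _ _ => mul_add _ _ _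

lemma L.mul_smul_left (c : ℂ) (S : η.L u) (T : η.L v) : L.mul (c • S) T = c • L.mul S T :=
  L.ext_tmul fun _ _ => smul_mul_assoc _ _ _

lemma L.mul_smul_right (c : ℂ) (S : η.L u) (T : η.L v) : L.mul S (c • T) = c • L.mul S T :=
  L.ext_tmul fun _ _ => mul_smul_comm _ _ _

lemma L.pairing_tensor (S T : η.L (u.tensor v)) :
    L.pairing S T = ∑ i, ∑ j,
      T.1 (stdOrthonormalBasis ℂ u.H i ⊗ₜ[ℂ] stdOrthonormalBasis ℂ v.H j) *
        star (S.1 (stdOrthonormalBasis ℂ u.H i ⊗ₜ[ℂ] stdOrthonormalBasis ℂ v.H j)) := by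
  rw [L.pairing_eq (u := u.tensor v)
    ((stdOrthonormalBasis ℂ u.H).tensorProduct (stdOrthonormalBasis ℂ v.H)), Fintype.sum_prod_type]
  simp only [OrthonormalBasis.tensorProduct_apply]

/-- The contraction `ψ ↦ ∑ Y(ψ ⊗ g_k) Z(g_k)^*`. -/
def L.contract (Y : η.L (v.tensor w)) (Z : η.L w) : η.L v :=
  ⟨∑ k, LinearMap.mulRight ℂ (star (Z.1 (stdOrthonormalBasis ℂ w.H k))) ∘ₗ Y.1 ∘ₗ
      (TensorProduct.mk ℂ v.H w.H).flip (stdOrthonormalBasis ℂ w.H k), by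
    let f := stdOrthonormalBasis ℂ v.H
    let g := stdOrthonormalBasis ℂ w.H
    refine L.mem_of_forall f fun ψ => ?_
    simp only [LinearMap.sum_apply]
    change η.toHom (∑ k, Y.1 (ψ ⊗ₜ[ℂ] g k) * star (Z.1 (g k))) =
      ∑ j, minTmul (∑ k, Y.1 (f j ⊗ₜ[ℂ] g k) * star (Z.1 (g k))) (coeff v.u (f j) ψ)
    have h1 : ∀ k, η.toHom (Y.1 (ψ ⊗ₜ[ℂ] g k)) = ∑ j, ∑ l,
        minTmul (Y.1 (f j ⊗ₜ[ℂ] g l)) (coeff v.u (f j) ψ * coeff w.u (g l) (g k)) := by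
      intro k
      rw [L.apply_eq_minTmul (u := v.tensor w) (f.tensorProduct g), Fintype.sum_prod_type]
      simp only [OrthonormalBasis.tensorProduct_apply, UnitaryRep.coeff_tensorCoact]
    have hsum : ∀ {κ : Type} [Fintype κ] (b : B) (a : κ → A),
        ∑ i, minTmul b (a i) = minTmul b (∑ i, a i) := fun b a => by
      simp only [minTmul, TensorProduct.tmul_sum, map_sum]
    have hsum' : ∀ {κ : Type} [Fintype κ] (a : A) (b : κ → B),
        ∑ i, minTmul (b i) a = minTmul (∑ i, b i) a := fun a b => by
      simp only [minTmul, TensorProduct.sum_tmul, map_sum]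
    have h2 : ∀ k, η.toHom (Y.1 (ψ ⊗ₜ[ℂ] g k) * star (Z.1 (g k))) = ∑ j, ∑ l, ∑ m,
        minTmul (Y.1 (f j ⊗ₜ[ℂ] g l) * star (Z.1 (g m)))
          (coeff v.u (f j) ψ * (coeff w.u (g l) (g k) * star (coeff w.u (g m) (g k)))) := by
      intro k
      rw [map_mul, map_star, h1, L.apply_eq_minTmul g Z, star_sum]
      simp only [Finset.sum_mul, Finset.mul_sum, star_minTmul, minTmul_mul, mul_assoc]
      rw [Finset.sum_comm]
      exact Finset.sum_congr rfl fun j _ => Finset.sum_comm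
    rw [map_sum, Finset.sum_congr rfl fun k _ => h2 k, Finset.sum_comm]
    refine Finset.sum_congr rfl fun j _ => ?_
    rw [Finset.sum_comm, ← hsum']
    refine Finset.sum_congr rfl fun l _ => ?_
    -- The coisometry relation for w reduces the sum over k to δ_{lm}. The coefficients of w
    -- disappear and those of v remain, so the contraction lies in L_v.
    rw [Finset.sum_comm, Finset.sum_eq_single l]
    · rw [hsum, ← Finset.mul_sum, w.sum_coisometry g, g.inner_eq_one, one_smul, mul_one]
    · intro m _ hm
      rw [hsum, ← Finset.mul_sum, w.sum_coisometry g, g.inner_eq_zero hm.symm, zero_smul, mul_zero,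
        minTmul, TensorProduct.tmul_zero, map_zero]
    · simp⟩

lemma L.contract_apply (Y : η.L (v.tensor w)) (Z : η.L w) (ψ : v.H) :
    (L.contract Y Z).1 ψ = ∑ k, Y.1 (ψ ⊗ₜ[ℂ] stdOrthonormalBasis ℂ w.H k) *
      star (Z.1 (stdOrthonormalBasis ℂ w.H k)) := by
  simp only [contract, LinearMap.sum_apply]
  rfl

/-- Contraction is antilinear in Z because Z enters through adjoints; in the conjugate spaces the
scalars reappear without conjugation. -/
lemma L.contract_sum_smul (Y : η.L (v.tensor w)) {ι : Type*} (s : Finset ι) (c : ι → ℂ)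
    (Z : ι → η.L w) :
    L.contract Y (∑ k ∈ s, c k • Z k) = ∑ k ∈ s, conj (c k) • L.contract Y (Z k) := by
  let F : η.L w →ₗ⋆[ℂ] η.L v :=
    { toFun := L.contract Y
      map_add' := fun Z Z' => Subtype.ext <| LinearMap.ext fun ψ => by
        change (L.contract Y (Z + Z')).1 ψ = (L.contract Y Z).1 ψ + (L.contract Y Z').1 ψ
        simp only [L.contract_apply, ← Finset.sum_add_distrib, ← mul_add, ← star_add]
        rfl
      map_smul' := fun c Z => Subtype.ext <| LinearMap.ext fun ψ => by
        change (L.contract Y (c • Z)).1 ψ = conj c • (L.contract Y Z).1 ψ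
        simp only [L.contract_apply, Finset.smul_sum, ← mul_smul_comm]
        refine Finset.sum_congr rfl fun k _ => ?_
        congr 1
        exact star_smul c (Z.1 (stdOrthonormalBasis ℂ w.H k)) }
  change F _ = ∑ k ∈ s, conj (c k) • F (Z k)
  rw [map_sum]
  simp only [LinearMap.map_smulₛₗ]

/-- The transport of spectral elements to a conjugate representation. -/
def L.conj {j : u.H ≃ₛₗ[starRingEnd ℂ] v.H} {jstar : v.H ≃ₛₗ[starRingEnd ℂ] u.H}
    (h1 : ∀ (φ : u.H) (χ : v.H), ⟪j φ, χ⟫_ℂ = ⟪jstar χ, φ⟫_ℂ)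
    (h2 : ∀ φ ψ : u.H, coeff v.u (j φ) (jstar.symm ψ) = star (coeff u.u φ ψ)) (T : η.L u) :
    η.L v :=
  ⟨{ toFun := fun χ => star (T.1 (jstar χ))
     map_add' := fun χ χ' => by rw [map_add, map_add, star_add]
     map_smul' := fun c χ => by
       rw [jstar.map_smulₛₗ, map_smul, star_smul, RingHom.id_apply, RCLike.star_def,
         Complex.conj_conj] }, by
    let e := stdOrthonormalBasis ℂ u.H
    let f := stdOrthonormalBasis ℂ v.H
    refine L.mem_of_forall f fun χ => ?_
    change η.toHom (star (T.1 (jstar χ))) =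
      ∑ k, minTmul (star (T.1 (jstar (f k)))) (coeff v.u (f k) χ)
    -- In `h3` and `h4` the two legs expand with the same scalars ⟪j e_i, f_k⟫, which can be moved
    -- across the tensor sign. The defining relation of a conjugate enters in `h4`.
    have h3 : ∀ k, star (T.1 (jstar (f k))) = ∑ i, ⟪j (e i), f k⟫_ℂ • star (T.1 (e i)) := by
      intro k
      conv_lhs => rw [← e.sum_repr' (jstar (f k))]
      rw [map_sum, star_sum]
      refine Finset.sum_congr rfl fun i _ => ?_
      rw [map_smul, star_smul, h1, RCLike.star_def, inner_conj_symm]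
    have h4 : ∀ i, star (coeff u.u (e i) (jstar χ)) =
        ∑ k, ⟪j (e i), f k⟫_ℂ • coeff v.u (f k) χ := by
      intro i
      rw [← h2, jstar.symm_apply_apply, coeff_expand_left v.u f]
    have h5 : ∀ (c : ℂ) (b : B) (a : A), minTmul (c • b) a = minTmul b (c • a) := fun c b a => by
      rw [minTmul, minTmul, TensorProduct.smul_tmul]
    rw [map_star, L.apply_eq_minTmul e, star_sum]
    simp only [star_minTmul, h3, h4]
    have hsum : ∀ {κ : Type} [Fintype κ] (b : B) (a : κ → A),
        minTmul b (∑ i, a i) = ∑ i, minTmul b (a i) := fun b a => by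
      simp only [minTmul, TensorProduct.tmul_sum, map_sum]
    have hsum' : ∀ {κ : Type} [Fintype κ] (a : A) (b : κ → B),
        minTmul (∑ i, b i) a = ∑ i, minTmul (b i) a := fun a b => by
      simp only [minTmul, TensorProduct.sum_tmul, map_sum]
    simp only [hsum, hsum', h5]
    exact Finset.sum_comm⟩

lemma L.conj_apply {j : u.H ≃ₛₗ[starRingEnd ℂ] v.H} {jstar : v.H ≃ₛₗ[starRingEnd ℂ] u.H}
    (h1 : ∀ (φ : u.H) (χ : v.H), ⟪j φ, χ⟫_ℂ = ⟪jstar χ, φ⟫_ℂ)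
    (h2 : ∀ φ ψ : u.H, coeff v.u (j φ) (jstar.symm ψ) = star (coeff u.u φ ψ)) (T : η.L u)
    (χ : v.H) : (L.conj h1 h2 T).1 χ = star (T.1 (jstar χ)) := rfl

/-- Being a conjugate is a symmetric relation: j^{-1}, with adjoint (j^*)^{-1}, satisfies the same
identities, and its transport map inverts that of j. -/
theorem finrank_L_eq_of_isConjugate (h : u.IsConjugate v) :
    Module.finrank ℂ (η.L u) = Module.finrank ℂ (η.L v) := by
  obtain ⟨j, jstar, h1, h2⟩ := h
  have h1' : ∀ (χ : v.H) (φ : u.H), ⟪j.symm χ, φ⟫_ℂ = ⟪jstar.symm φ, χ⟫_ℂ := by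
    intro χ φ
    obtain ⟨φ', rfl⟩ := j.surjective χ
    rw [j.symm_apply_apply, ← inner_conj_symm, ← inner_conj_symm (jstar.symm φ), h1,
      jstar.apply_symm_apply]
  have h2' : ∀ χ χ' : v.H, coeff u.u (j.symm χ) (jstar.symm.symm χ') =
      star (coeff v.u χ χ') := by
    intro χ χ'
    obtain ⟨φ, rfl⟩ := j.surjective χ
    obtain ⟨ψ, rfl⟩ := jstar.symm.surjective χ'
    rw [h2, star_star, j.symm_apply_apply, LinearEquiv.symm_symm, jstar.apply_symm_apply]
  exact finrank_eq_of_antilinear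
    { toFun := L.conj (η := η) h1 h2
      invFun := L.conj (η := η) h1' h2'
      left_inv := fun T => Subtype.ext <| LinearMap.ext fun ψ => by
        rw [L.conj_apply, L.conj_apply, star_star, jstar.apply_symm_apply]
      right_inv := fun T => Subtype.ext <| LinearMap.ext fun χ => by
        rw [L.conj_apply, L.conj_apply, star_star, jstar.symm_apply_apply]
      map_add' := fun S T => Subtype.ext <| LinearMap.ext fun χ => star_add (S.1 _) (T.1 _)
      map_smul' := fun c T => Subtype.ext <| LinearMap.ext fun χ => star_smul c (T.1 _) }

theorem finrank_Lbar_eq_of_isConjugate [η.IsErgodic] [Nontrivial B] (h : u.IsConjugate v) :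
    Module.finrank ℂ (η.Lbar u) = Module.finrank ℂ (η.Lbar v) := by
  rw [← finrank_eq_of_antilinear (ConjSpace.mkₛₗ (E := η.L u)),
    ← finrank_eq_of_antilinear (ConjSpace.mkₛₗ (E := η.L v)), finrank_L_eq_of_isConjugate h]

end QAction
end

noncomputable section

/-! ### Hilbert space preliminaries -/

section Hilbert

variable {H K E : Type*} [NormedAddCommGroup H] [InnerProductSpace ℂ H]
  [NormedAddCommGroup K] [InnerProductSpace ℂ K] [NormedAddCommGroup E] [InnerProductSpace ℂ E]

/-- The extension of an isometry to the Hilbert space tensor product. -/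
def HTensor.lift [CompleteSpace E] (Φ : H ⊗[ℂ] K →ₗᵢ[ℂ] E) : HTensor H K →ₗᵢ[ℂ] E :=
  { Φ.toLinearMap.extendOfNorm (HTensor.incl : H ⊗[ℂ] K →ₗᵢ[ℂ] HTensor H K).toLinearMap with
    norm_map' := fun z => by
      change ‖Φ.toLinearMap.extendOfNorm
        (HTensor.incl : H ⊗[ℂ] K →ₗᵢ[ℂ] HTensor H K).toLinearMap z‖ = ‖z‖
      induction z using HTensor.denseRange_incl.induction_on with
      | hp => exact isClosed_eq (by fun_prop) (by fun_prop)
      | ih x =>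
        have h := LinearMap.extendOfNorm_eq (f := Φ.toLinearMap)
          (e := (HTensor.incl : H ⊗[ℂ] K →ₗᵢ[ℂ] HTensor H K).toLinearMap) HTensor.denseRange_incl
          ⟨1, fun x => by simp⟩ x
        simp only [LinearIsometry.coe_toLinearMap] at h
        rw [h, LinearIsometry.norm_map, LinearIsometry.norm_map] }

lemma HTensor.lift_incl [CompleteSpace E] (Φ : H ⊗[ℂ] K →ₗᵢ[ℂ] E) (x : H ⊗[ℂ] K) :
    HTensor.lift Φ (HTensor.incl x) = Φ x :=
  LinearMap.extendOfNorm_eq (f := Φ.toLinearMap)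
    (e := (HTensor.incl : H ⊗[ℂ] K →ₗᵢ[ℂ] HTensor H K).toLinearMap) HTensor.denseRange_incl
    ⟨1, fun x => by simp⟩ x

/-- In finite dimension the dense range is also closed, so elements of the completion are still
finite sums of elementary tensors. -/
lemma HTensor.incl_surjective [FiniteDimensional ℂ H] [FiniteDimensional ℂ K] :
    Function.Surjective (HTensor.incl : H ⊗[ℂ] K →ₗᵢ[ℂ] HTensor H K) := by
  have h1 : IsClosed (Set.range (HTensor.incl : H ⊗[ℂ] K →ₗᵢ[ℂ] HTensor H K)) :=
    (LinearMap.range (HTensor.incl :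
      H ⊗[ℂ] K →ₗᵢ[ℂ] HTensor H K).toLinearMap).closed_of_finiteDimensional
  rw [← Set.range_eq_univ, ← h1.closure_eq]
  exact HTensor.denseRange_incl.closure_range

instance [FiniteDimensional ℂ H] [FiniteDimensional ℂ K] : FiniteDimensional ℂ (HTensor H K) :=
  Module.Finite.of_surjective (HTensor.incl : H ⊗[ℂ] K →ₗᵢ[ℂ] HTensor H K).toLinearMap
    HTensor.incl_surjective

lemma HTensor.induction_tmul [FiniteDimensional ℂ H] [FiniteDimensional ℂ K]
    {p : HTensor H K → Prop} (zero : p 0) (add : ∀ x y, p x → p y → p (x + y))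
    (tmul : ∀ h k, p (HTensor.tmul h k)) (z : HTensor H K) : p z := by
  obtain ⟨x, rfl⟩ := HTensor.incl_surjective z
  induction x with
  | zero => rwa [map_zero]
  | add x y hx hy => rw [map_add]; exact add _ _ hx hy
  | tmul h k => exact tmul h k

lemma adjoint_apply_self_of_norm [CompleteSpace H] [CompleteSpace K] {J : H →L[ℂ] K}
    (hJ : ∀ z, ‖J z‖ = ‖z‖) (z : H) : J.adjoint (J z) = z := by
  have h := (J.norm_map_iff_adjoint_comp_self).mp hJ
  exact DFunLike.congr_fun h z

/-- A criterion for a product of projections to be a range projection. -/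
lemma rangeProj_comp_eq {H₀ H₁ H₂ K K' : Type*}
    [NormedAddCommGroup H₀] [InnerProductSpace ℂ H₀] [CompleteSpace H₀]
    [NormedAddCommGroup H₁] [InnerProductSpace ℂ H₁] [CompleteSpace H₁]
    [NormedAddCommGroup H₂] [InnerProductSpace ℂ H₂] [CompleteSpace H₂]
    [NormedAddCommGroup K] [InnerProductSpace ℂ K] [CompleteSpace K]
    [NormedAddCommGroup K'] [InnerProductSpace ℂ K'] [CompleteSpace K']
    {V : H₁ →L[ℂ] K} {J : H₀ →L[ℂ] H₁} {W : H₂ →L[ℂ] K'} {a : K →L[ℂ] K'}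
    (hJ : ∀ z, J.adjoint (J z) = z) (hW : ∀ y, W.adjoint (W y) = y)
    (ha : ∀ k, a.adjoint (a k) = k) (h1 : ∀ z, ∃ y, a (V (J z)) = W y)
    (h2 : ∀ y, ∃ z, V.adjoint (a.adjoint (W y)) = J z) :
    rangeProj (V ∘L J) = rangeProj V ∘L (a.adjoint ∘L rangeProj W ∘L a) := by
  -- With Q = a^*WW^*a, hypothesis `h1` says that Q fixes the range of VJ; `hUQ` is the adjoint
  -- statement J^*V^*Q = J^*V^*.
  have hQU : ∀ z, a.adjoint (W (W.adjoint (a (V (J z))))) = V (J z) := by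
    intro z
    obtain ⟨y, hy⟩ := h1 z
    rw [hy, hW, ← hy, ha]
  have hUQ : ∀ k, J.adjoint (V.adjoint (a.adjoint (W (W.adjoint (a k))))) =
      J.adjoint (V.adjoint k) := by
    intro k
    refine ext_inner_left ℂ fun z => ?_
    simp only [ContinuousLinearMap.adjoint_inner_right]
    conv_rhs => rw [← hQU z]
    simp only [ContinuousLinearMap.adjoint_inner_left]
    rw [← ContinuousLinearMap.adjoint_inner_left W, ContinuousLinearMap.adjoint_inner_right W]
  ext k
  simp only [rangeProj, ContinuousLinearMap.comp_apply, ContinuousLinearMap.adjoint_comp]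
  rw [← hUQ k]
  -- By `h2` the vector V^*Qk already lies in the range of J, on which JJ^* is the identity.
  obtain ⟨z, hz⟩ := h2 (W.adjoint (a k))
  rw [hz, hJ]

end Hilbert

/-! ### Adjoints of the associativity and unit constraints -/

section Constraints

variable {A : Type*} [CStarAlgebra A] {G : CompactQuantumGroup A} {u v w : UnitaryRep G}

/-- The associator is unitary, so its adjoint is its inverse. Adjoints matter because the spectral
functor sends T to composition with T^*. -/
lemma UnitaryRep.Hom.adj_assoc_tmul (ψ : u.H) (ψ' : v.H) (ψ'' : w.H) :
    (UnitaryRep.Hom.adj (UnitaryRep.Hom.assoc u v w)).1 (ψ ⊗ₜ[ℂ] (ψ' ⊗ₜ[ℂ] ψ'')) =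
      (ψ ⊗ₜ[ℂ] ψ') ⊗ₜ[ℂ] ψ'' := by
  refine ext_inner_right ℂ fun (y : (u.H ⊗[ℂ] v.H) ⊗[ℂ] w.H) => ?_
  refine (LinearMap.adjoint_inner_left (UnitaryRep.Hom.assoc u v w).1 _ _).trans ?_
  exact (TensorProduct.inner_assoc_assoc ((ψ ⊗ₜ[ℂ] ψ') ⊗ₜ[ℂ] ψ'') y)

lemma UnitaryRep.Hom.adj_tensor_tmul {u' v' : UnitaryRep G} (T : UnitaryRep.Hom u u')
    (T' : UnitaryRep.Hom v v') (ψ : u'.H) (ψ' : v'.H) :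
    (UnitaryRep.Hom.adj (UnitaryRep.Hom.tensor T T')).1 (ψ ⊗ₜ[ℂ] ψ') =
      (UnitaryRep.Hom.adj T).1 ψ ⊗ₜ[ℂ] (UnitaryRep.Hom.adj T').1 ψ' :=
  LinearMap.congr_fun (TensorProduct.adjoint_map T.1 T'.1) _

lemma UnitaryRep.Hom.adj_lunit_apply (ψ : u.H) :
    (UnitaryRep.Hom.adj (UnitaryRep.Hom.lunit u)).1 ψ = (1 : ℂ) ⊗ₜ[ℂ] ψ := by
  have h : (TensorProduct.lid ℂ u.H).symm.toLinearMap =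
      LinearMap.adjoint (TensorProduct.lid ℂ u.H).toLinearMap := by
    rw [LinearMap.eq_adjoint_iff]
    intro x y
    obtain ⟨x', rfl⟩ := (TensorProduct.lid ℂ u.H).surjective x
    simp
  exact LinearMap.congr_fun h.symm _

lemma UnitaryRep.Hom.adj_runit_apply (ψ : u.H) :
    (UnitaryRep.Hom.adj (UnitaryRep.Hom.runit u)).1 ψ = ψ ⊗ₜ[ℂ] (1 : ℂ) := by
  have h : (TensorProduct.rid ℂ u.H).symm.toLinearMap =
      LinearMap.adjoint (TensorProduct.rid ℂ u.H).toLinearMap := by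
    rw [LinearMap.eq_adjoint_iff]
    intro x y
    obtain ⟨x', rfl⟩ := (TensorProduct.rid ℂ u.H).surjective x
    simp
  exact LinearMap.congr_fun h.symm _

end Constraints

/-! ### The quasitensor structure of the spectral functor -/

namespace QAction

variable {A B : Type*} [CStarAlgebra A] [CStarAlgebra B] [Nontrivial B] {G : CompactQuantumGroup A}
variable {η : QAction G B} [η.IsErgodic] {u v w : UnitaryRep G}

/-- The antilinear identification of `L_u` with the space of the spectral functor. -/
def L.bar : η.L u ≃ₛₗ[starRingEnd ℂ] η.spectralFunctor.obj u := ConjSpace.mkₛₗ (E := η.L u)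

lemma L.inner_bar_smul_one (S T : η.L u) : ⟪L.bar S, L.bar T⟫_ℂ • (1 : B) = L.pairing T S :=
  L.inner_smul_one T S

lemma L.map_bar (T : UnitaryRep.Hom u v) (S : η.L u) :
    η.spectralFunctor.map T (L.bar S) = L.bar (L.map (UnitaryRep.Hom.adj T) S) := rfl

/-- Since (ST)(S'T')^* = S(TT'^*)S'^*, the sum over the basis of H_v sits in the middle. It is a
scalar by ergodicity, so it comes out and leaves the sum for S and S'. -/
lemma L.inner_mul (S S' : η.L u) (T T' : η.L v) :
    ⟪L.bar (L.mul S T), L.bar (L.mul S' T')⟫_ℂ =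
      ⟪L.bar S, L.bar S'⟫_ℂ * ⟪L.bar T, L.bar T'⟫_ℂ := by
  refine smul_one_inj (B := B) ?_
  rw [L.inner_bar_smul_one, L.pairing_tensor]
  change ∑ i, ∑ j, S.1 (stdOrthonormalBasis ℂ u.H i) * T.1 (stdOrthonormalBasis ℂ v.H j) *
    star (S'.1 (stdOrthonormalBasis ℂ u.H i) * T'.1 (stdOrthonormalBasis ℂ v.H j)) = _
  simp only [star_mul]
  have h1 : ∀ i, ∑ j, S.1 (stdOrthonormalBasis ℂ u.H i) * T.1 (stdOrthonormalBasis ℂ v.H j) *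
      (star (T'.1 (stdOrthonormalBasis ℂ v.H j)) * star (S'.1 (stdOrthonormalBasis ℂ u.H i))) =
      ⟪L.bar T, L.bar T'⟫_ℂ • (S.1 (stdOrthonormalBasis ℂ u.H i) *
        star (S'.1 (stdOrthonormalBasis ℂ u.H i))) := by
    intro i
    have h2 : S.1 (stdOrthonormalBasis ℂ u.H i) * (⟪L.bar T, L.bar T'⟫_ℂ • (1 : B)) *
        star (S'.1 (stdOrthonormalBasis ℂ u.H i)) =
        ⟪L.bar T, L.bar T'⟫_ℂ • (S.1 (stdOrthonormalBasis ℂ u.H i) *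
        star (S'.1 (stdOrthonormalBasis ℂ u.H i))) := by
      rw [mul_smul_comm, mul_one, smul_mul_assoc]
    rw [← h2, L.inner_bar_smul_one, L.pairing, Finset.mul_sum, Finset.sum_mul]
    simp only [mul_assoc]
  rw [Finset.sum_congr rfl fun i _ => h1 i, ← Finset.smul_sum, mul_comm, ← smul_smul,
    L.inner_bar_smul_one]
  rfl

variable (η u v) in
/-- The product map on the algebraic tensor product of conjugate spectral spaces. -/
def mulLin : η.spectralFunctor.obj u ⊗[ℂ] η.spectralFunctor.obj v →ₗ[ℂ]
    η.spectralFunctor.obj (u.tensor v) :=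
  TensorProduct.lift (LinearMap.mk₂ ℂ (fun x y => L.bar (L.mul (L.bar.symm x) (L.bar.symm y)))
    (fun x x' y => by rw [map_add, L.mul_add_left, map_add])
    (fun c x y => by rw [L.bar.symm.map_smulₛₗ, L.mul_smul_left, L.bar.map_smulₛₗ]; simp)
    (fun x y y' => by rw [map_add, L.mul_add_right, map_add])
    (fun c x y => by rw [L.bar.symm.map_smulₛₗ, L.mul_smul_right, L.bar.map_smulₛₗ]; simp))

lemma mulLin_tmul (S : η.L u) (T : η.L v) :
    mulLin η u v (L.bar S ⊗ₜ[ℂ] L.bar T) = L.bar (L.mul S T) := rfl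

variable (η u v) in
/-- The isometry `L̄_u ⊗ L̄_v → L̄_{u ⊗ v}`. -/
def mulIsometry : HTensor (η.spectralFunctor.obj u) (η.spectralFunctor.obj v) →ₗᵢ[ℂ]
    η.spectralFunctor.obj (u.tensor v) :=
  HTensor.lift ((mulLin η u v).isometryOfInner fun x y => by
    induction x with
    | zero => simp only [map_zero, inner_zero_left]
    | add x x' hx hx' => simp only [map_add, inner_add_left, hx, hx']
    | tmul a b =>
      induction y with
      | zero => simp only [map_zero, inner_zero_right]
      | add y y' hy hy' => simp only [map_add, inner_add_right, hy, hy']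
      | tmul c d =>
        obtain ⟨a, rfl⟩ := L.bar.surjective a
        obtain ⟨b, rfl⟩ := L.bar.surjective b
        obtain ⟨c, rfl⟩ := L.bar.surjective c
        obtain ⟨d, rfl⟩ := L.bar.surjective d
        rw [TensorProduct.inner_tmul, mulLin_tmul, mulLin_tmul, L.inner_mul])

lemma mulIsometry_tmul (S : η.L u) (T : η.L v) :
    mulIsometry η u v (HTensor.tmul (L.bar S) (L.bar T)) = L.bar (L.mul S T) :=
  HTensor.lift_incl _ _

end QAction
end

/-! ### Units, coherence and the range projections of the multiplication isometries -/

noncomputable section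

namespace QAction

variable {A B : Type*} [CStarAlgebra A] [CStarAlgebra B] [Nontrivial B] {G : CompactQuantumGroup A}
variable {η : QAction G B} [η.IsErgodic] {u v w : UnitaryRep G}

instance [Nontrivial A] : FiniteDimensional ℂ (η.spectralFunctor.obj u) :=
  η.finiteDimensional_Lbar u

/-- The spectral element `c ↦ c d I` of the trivial representation. -/
def L.unit (η : QAction G B) (d : ℂ) : η.L (.trivial G) :=
  ⟨LinearMap.toSpanSingleton ℂ B (d • (1 : B)), fun (c : ℂ) => by
    change η.toHom (c • d • (1 : B)) = toMin ((c • d • (1 : B)) ⊗ₜ[ℂ] (1 : A))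
    have h1 : (toMin ((1 : B) ⊗ₜ[ℂ] (1 : A)) : MinTensor B A) = 1 := map_one toMin
    rw [← TensorProduct.smul_tmul', ← TensorProduct.smul_tmul', map_smul, map_smul, map_smul,
      map_smul, h1, map_one]⟩

/-- For T in the space of the trivial representation, T(1) is a fixed point of η, hence a scalar. -/
lemma L.unit_surjective : Function.Surjective (L.unit η) := by
  intro T
  obtain ⟨d, hd⟩ := IsErgodic.fixed_scalar (T.1 (1 : ℂ)) (T.2 (1 : ℂ))
  refine ⟨d, Subtype.ext (LinearMap.ext_ring ?_)⟩
  change (1 : ℂ) • d • (1 : B) = T.1 (1 : ℂ)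
  rw [one_smul, hd]

lemma L.norm_unit (d : ℂ) : ‖L.bar (L.unit η d)‖ = ‖d‖ := by
  have h : ⟪L.bar (L.unit η d), L.bar (L.unit η d)⟫_ℂ = d * conj d := by
    refine smul_one_inj (B := B) ?_
    rw [L.inner_bar_smul_one, L.pairing_eq (u := .trivial G) (OrthonormalBasis.singleton (Fin 1) ℂ)]
    simp only [Finset.univ_unique, Finset.sum_singleton, OrthonormalBasis.singleton_apply]
    change (1 : ℂ) • d • (1 : B) * star ((1 : ℂ) • d • (1 : B)) = _
    rw [one_smul, star_smul, star_one, smul_mul_smul_comm, one_mul]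
    rfl
  rw [inner_self_eq_norm_sq_to_K, RCLike.ofReal_eq_complex_ofReal, Complex.mul_conj,
    Complex.normSq_eq_norm_sq] at h
  exact (sq_eq_sq₀ (norm_nonneg _) (norm_nonneg _)).mp (by exact_mod_cast h)

variable (η) in
/-- The identification of the spectral space of the trivial representation with `ℂ`. -/
def unitIso : ℂ ≃ₗᵢ[ℂ] η.spectralFunctor.obj (.trivial G) :=
  LinearIsometryEquiv.ofSurjective
    -- `L.bar` is antilinear, so conjugating c makes the identification linear.
    { toFun := fun c => L.bar (L.unit η (conj c))
      map_add' := fun c d => by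
        rw [← map_add]
        refine congrArg L.bar (Subtype.ext (LinearMap.ext_ring ?_))
        change (1 : ℂ) • conj (c + d) • (1 : B) =
          (1 : ℂ) • conj c • (1 : B) + (1 : ℂ) • conj d • (1 : B)
        rw [map_add, add_smul, smul_add]
      map_smul' := fun c d => by
        have h : L.unit η (conj (c • d)) = conj c • L.unit η (conj d) := by
          refine Subtype.ext (LinearMap.ext_ring ?_)
          change (1 : ℂ) • conj (c * d) • (1 : B) = conj c • (1 : ℂ) • conj d • (1 : B)
          rw [map_mul, one_smul, one_smul, smul_smul]
        rw [h, L.bar.map_smulₛₗ, Complex.conj_conj, RingHom.id_apply]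
      norm_map' := fun c => by
        change ‖L.bar (L.unit η (conj c))‖ = ‖c‖
        rw [L.norm_unit, RCLike.norm_conj] }
    fun x => by
      obtain ⟨T, rfl⟩ := L.bar.surjective x
      obtain ⟨d, rfl⟩ := L.unit_surjective T
      exact ⟨conj d, congrArg (fun c => L.bar (L.unit η c)) (Complex.conj_conj d)⟩

lemma unitIso_apply (c : ℂ) : unitIso η c = L.bar (L.unit η (conj c)) := rfl

lemma mulIsometry_unit_right (x : η.spectralFunctor.obj u) (c : ℂ) :
    η.spectralFunctor.map (UnitaryRep.Hom.runit u)
      (mulIsometry η u (.trivial G) (HTensor.tmul x (unitIso η c))) = c • x := by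
  obtain ⟨S, rfl⟩ := L.bar.surjective x
  have hc : c • L.bar S = L.bar (conj c • S) := by rw [L.bar.map_smulₛₗ, Complex.conj_conj]
  rw [unitIso_apply, mulIsometry_tmul, L.map_bar, hc]
  refine congrArg L.bar (Subtype.ext (LinearMap.ext fun ψ => ?_))
  rw [L.map_apply, UnitaryRep.Hom.adj_runit_apply]
  change S.1 ψ * ((1 : ℂ) • conj c • (1 : B)) = conj c • S.1 ψ
  rw [one_smul, mul_smul_comm, mul_one]

lemma mulIsometry_unit_left (x : η.spectralFunctor.obj u) (c : ℂ) :
    η.spectralFunctor.map (UnitaryRep.Hom.lunit u)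
      (mulIsometry η (.trivial G) u (HTensor.tmul (unitIso η c) x)) = c • x := by
  obtain ⟨S, rfl⟩ := L.bar.surjective x
  have hc : c • L.bar S = L.bar (conj c • S) := by rw [L.bar.map_smulₛₗ, Complex.conj_conj]
  rw [unitIso_apply, mulIsometry_tmul, L.map_bar, hc]
  refine congrArg L.bar (Subtype.ext (LinearMap.ext fun ψ => ?_))
  rw [L.map_apply, UnitaryRep.Hom.adj_lunit_apply]
  change ((1 : ℂ) • conj c • (1 : B)) * S.1 ψ = conj c • S.1 ψ
  rw [one_smul, smul_mul_assoc, one_mul]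

/-- Once the adjoint of the associator has rebracketed the arguments, this is associativity of the
product in `B`. -/
lemma mulIsometry_assoc (x : η.spectralFunctor.obj u) (y : η.spectralFunctor.obj v)
    (z : η.spectralFunctor.obj w) :
    η.spectralFunctor.map (UnitaryRep.Hom.assoc u v w)
      (mulIsometry η (u.tensor v) w (HTensor.tmul (mulIsometry η u v (HTensor.tmul x y)) z)) =
    mulIsometry η u (v.tensor w) (HTensor.tmul x (mulIsometry η v w (HTensor.tmul y z))) := by
  obtain ⟨X, rfl⟩ := L.bar.surjective x
  obtain ⟨Y, rfl⟩ := L.bar.surjective y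
  obtain ⟨Z, rfl⟩ := L.bar.surjective z
  rw [mulIsometry_tmul, mulIsometry_tmul, mulIsometry_tmul, mulIsometry_tmul, L.map_bar]
  refine congrArg L.bar (Subtype.ext (TensorProduct.ext ?_))
  refine LinearMap.ext fun ψ => TensorProduct.ext' fun ψ' ψ'' => ?_
  change (L.map (UnitaryRep.Hom.adj (UnitaryRep.Hom.assoc u v w)) (L.mul (L.mul X Y) Z)).1
    (ψ ⊗ₜ[ℂ] (ψ' ⊗ₜ[ℂ] ψ'')) =
    X.1 ψ * (Y.1 ψ' * Z.1 ψ'')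
  rw [L.map_apply, UnitaryRep.Hom.adj_assoc_tmul]
  exact mul_assoc _ _ _

lemma mulIsometry_natural {u' v' : UnitaryRep G} (T : UnitaryRep.Hom u u')
    (T' : UnitaryRep.Hom v v') :
    η.spectralFunctor.map (UnitaryRep.Hom.tensor T T') ∘L
        (mulIsometry η u v).toContinuousLinearMap =
      (mulIsometry η u' v').toContinuousLinearMap ∘L
        HTensor.map (η.spectralFunctor.map T) (η.spectralFunctor.map T') := by
  refine HTensor.ext_incl fun x => ?_
  induction x with
  | zero => simp only [map_zero]
  | add x y hx hy => simp only [map_add, hx, hy]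
  | tmul x y =>
    obtain ⟨X, rfl⟩ := L.bar.surjective x
    obtain ⟨Y, rfl⟩ := L.bar.surjective y
    change η.spectralFunctor.map (UnitaryRep.Hom.tensor T T')
      (mulIsometry η u v (HTensor.tmul (L.bar X) (L.bar Y))) =
      mulIsometry η u' v' (HTensor.map _ _ (HTensor.tmul (L.bar X) (L.bar Y)))
    rw [HTensor.map_tmul, mulIsometry_tmul, L.map_bar, L.map_bar, L.map_bar, mulIsometry_tmul]
    refine congrArg L.bar (L.ext_tmul fun ψ ψ' => ?_)
    rw [L.map_apply, UnitaryRep.Hom.adj_tensor_tmul]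
    rfl

lemma map_adj_assoc_bar (N : η.L (u.tensor (v.tensor w))) :
    (η.spectralFunctor.map (UnitaryRep.Hom.assoc u v w)).adjoint (L.bar N) =
      L.bar (L.map (UnitaryRep.Hom.assoc u v w) N) := by
  rw [← HilbFunctor.map_adj, L.map_bar]
  refine congrArg L.bar (Subtype.ext (LinearMap.ext fun ψ => ?_))
  rw [L.map_apply, L.map_apply]
  exact congrArg N.1 (LinearMap.congr_fun (LinearMap.adjoint_adjoint _) ψ)

lemma adjoint_map_assoc_map_assoc (x : η.spectralFunctor.obj ((u.tensor v).tensor w)) :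
    (η.spectralFunctor.map (UnitaryRep.Hom.assoc u v w)).adjoint
      (η.spectralFunctor.map (UnitaryRep.Hom.assoc u v w) x) = x := by
  obtain ⟨M, rfl⟩ := L.bar.surjective x
  rw [L.map_bar, map_adj_assoc_bar]
  refine congrArg L.bar (Subtype.ext (TensorProduct.ext_threefold fun ψ ψ' ψ'' => ?_))
  change M.1 ((UnitaryRep.Hom.adj (UnitaryRep.Hom.assoc u v w)).1 (ψ ⊗ₜ[ℂ] (ψ' ⊗ₜ[ℂ] ψ''))) = _
  rw [UnitaryRep.Hom.adj_assoc_tmul]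

/-- Contraction in the last variable is adjoint to multiplication. -/
lemma L.inner_mul_map_assoc (M : η.L (u.tensor v)) (Z : η.L w) (X : η.L u)
    (Y : η.L (v.tensor w)) :
    ⟪L.bar (L.mul M Z), L.bar (L.map (UnitaryRep.Hom.assoc u v w) (L.mul X Y))⟫_ℂ =
      ⟪L.bar M, L.bar (L.mul X (L.contract Y Z))⟫_ℂ := by
  let e := stdOrthonormalBasis ℂ u.H
  let f := stdOrthonormalBasis ℂ v.H
  let g := stdOrthonormalBasis ℂ w.H
  refine smul_one_inj (B := B) ?_
  rw [L.inner_bar_smul_one, L.inner_bar_smul_one,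
    L.pairing_eq (u := (u.tensor v).tensor w) ((e.tensorProduct f).tensorProduct g),
    L.pairing_tensor (L.mul X (L.contract Y Z)) M, Fintype.sum_prod_type, Fintype.sum_prod_type]
  refine Finset.sum_congr rfl fun i _ => Finset.sum_congr rfl fun j _ => ?_
  simp only [OrthonormalBasis.tensorProduct_apply]
  change ∑ k, M.1 (e i ⊗ₜ[ℂ] f j) * Z.1 (g k) * star (X.1 (e i) * Y.1 (f j ⊗ₜ[ℂ] g k)) =
    M.1 (e i ⊗ₜ[ℂ] f j) * star (X.1 (e i) * (L.contract Y Z).1 (f j))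
  rw [L.contract_apply, star_mul, star_sum, Finset.sum_mul, Finset.mul_sum]
  refine Finset.sum_congr rfl fun k _ => ?_
  simp only [star_mul, star_star, mul_assoc]
  rfl

/-- By `L.inner_mul_map_assoc`, pairing the product XY with MZ contracts Y against Z and leaves X
alone. Expanding Z in an orthonormal basis b_k of L_w shows that the adjoint gives ∑ X·(Y contracted
with b_k) ⊗ b_k, visibly in the range of S_{u,v} ⊗ 1. Finite dimensionality of L_w makes the sum
finite. -/
lemma adjoint_mulIsometry_bar [Nontrivial A] (X : η.L u) (Y : η.L (v.tensor w)) :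
    ∃ z, (mulIsometry η (u.tensor v) w).toContinuousLinearMap.adjoint
      (L.bar (L.map (UnitaryRep.Hom.assoc u v w) (L.mul X Y))) =
      HTensor.map (mulIsometry η u v).toContinuousLinearMap
        (.id ℂ (η.spectralFunctor.obj w)) z := by
  have := η.finiteDimensional_L w
  let b := stdOrthonormalBasis ℂ (η.L w)
  refine ⟨∑ k, HTensor.tmul (HTensor.tmul (L.bar X) (L.bar (L.contract Y (b k)))) (L.bar (b k)),
    ext_inner_left ℂ fun t => ?_⟩
  rw [map_sum, ContinuousLinearMap.adjoint_inner_right]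
  simp only [HTensor.map_tmul]
  induction t using HTensor.induction_tmul with
  | zero => simp only [map_zero, inner_zero_left]
  | add s t hs ht => simp only [map_add, inner_add_left, hs, ht]
  | tmul m z =>
    obtain ⟨M, rfl⟩ := L.bar.surjective m
    obtain ⟨Z, rfl⟩ := L.bar.surjective z
    change ⟪mulIsometry η (u.tensor v) w (HTensor.tmul (L.bar M) (L.bar Z)), _⟫_ℂ =
      ⟪_, ∑ k, HTensor.tmul (mulIsometry η u v
        (HTensor.tmul (L.bar X) (L.bar (L.contract Y (b k))))) (L.bar (b k))⟫_ℂ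
    rw [inner_sum, mulIsometry_tmul, L.inner_mul_map_assoc]
    have hZ : Z = ∑ k, ⟪b k, Z⟫_ℂ • b k := (b.sum_repr' Z).symm
    have hX : L.bar (L.mul X (L.contract Y Z)) =
        ∑ k, ⟪b k, Z⟫_ℂ • L.bar (L.mul X (L.contract Y (b k))) := by
      conv_lhs => rw [hZ, L.contract_sum_smul]
      let F : η.L v →ₗ[ℂ] η.L (u.tensor v) :=
        { toFun := L.mul X
          map_add' := L.mul_add_right X
          map_smul' := fun c T => L.mul_smul_right c X T }
      change L.bar (F _) = ∑ k, _ • L.bar (F _)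
      rw [map_sum, map_sum]
      refine Finset.sum_congr rfl fun k _ => ?_
      rw [map_smul, L.bar.map_smulₛₗ, Complex.conj_conj]
    rw [hX, inner_sum]
    refine Finset.sum_congr rfl fun k _ => ?_
    rw [mulIsometry_tmul, HTensor.inner_tmul, inner_smul_right, mul_comm]
    rfl

/-- The inequality required of a quasitensor functor is an equality here. Of the two conditions in
`rangeProj_comp_eq`, the first is associativity of multiplication and the second is
`adjoint_mulIsometry_bar`; both need only be checked on elementary tensors. -/
lemma rangeProj_mulIsometry [Nontrivial A] (u v w : UnitaryRep G) :
    rangeProj ((mulIsometry η (u.tensor v) w).toContinuousLinearMap ∘L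
        HTensor.map (mulIsometry η u v).toContinuousLinearMap
          (.id ℂ (η.spectralFunctor.obj w))) =
      rangeProj (mulIsometry η (u.tensor v) w).toContinuousLinearMap ∘L
        ((η.spectralFunctor.map (UnitaryRep.Hom.assoc u v w)).adjoint ∘L
          rangeProj (mulIsometry η u (v.tensor w)).toContinuousLinearMap ∘L
            η.spectralFunctor.map (UnitaryRep.Hom.assoc u v w)) := by
  refine rangeProj_comp_eq
    (adjoint_apply_self_of_norm (HTensor.norm_map_isometry (mulIsometry η u v)))
    (adjoint_apply_self_of_norm (mulIsometry η u (v.tensor w)).norm_map)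
    adjoint_map_assoc_map_assoc (fun z => ?_) fun y => ?_
  · induction z using HTensor.induction_tmul with
    | zero => exact ⟨0, by simp only [map_zero]⟩
    | add z z' h h' =>
      obtain ⟨y, h⟩ := h
      obtain ⟨y', h'⟩ := h'
      exact ⟨y + y', by simp only [map_add, h, h']⟩
    | tmul m z =>
      rw [HTensor.map_tmul]
      induction m using HTensor.induction_tmul with
      | zero => exact ⟨0, by simp only [HTensor.tmul, map_zero, TensorProduct.zero_tmul]⟩
      | add m m' h h' =>
        obtain ⟨y, h⟩ := h
        obtain ⟨y', h'⟩ := h'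
        refine ⟨y + y', ?_⟩
        simp only [HTensor.tmul] at h h' ⊢
        simp only [map_add, TensorProduct.add_tmul, h, h']
      | tmul x y =>
        exact ⟨HTensor.tmul x (mulIsometry η v w (HTensor.tmul y z)), mulIsometry_assoc x y z⟩
  · induction y using HTensor.induction_tmul with
    | zero => exact ⟨0, by simp only [map_zero]⟩
    | add y y' h h' =>
      obtain ⟨z, h⟩ := h
      obtain ⟨z', h'⟩ := h'
      exact ⟨z + z', by simp only [map_add, h, h']⟩
    | tmul x y =>
      obtain ⟨X, rfl⟩ := L.bar.surjective x
      obtain ⟨Y, rfl⟩ := L.bar.surjective y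
      obtain ⟨z, hz⟩ := adjoint_mulIsometry_bar (w := w) X Y
      refine ⟨z, Eq.trans (congrArg _ ?_) hz⟩
      rw [LinearIsometry.coe_toContinuousLinearMap, mulIsometry_tmul, map_adj_assoc_bar]

variable (η) in
/-- The spectral functor of an ergodic action is quasitensor. -/
theorem isQuasitensor_spectralFunctor [Nontrivial A] : η.spectralFunctor.IsQuasitensor :=
  ⟨{ unit := unitIso η
     S := mulIsometry η
     S_unit_right := fun _ => mulIsometry_unit_right
     S_unit_left := fun _ => mulIsometry_unit_left
     S_assoc := fun _ _ _ => mulIsometry_assoc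
     proj_le := fun u v w => by
       rw [rangeProj_mulIsometry, sub_self]
       exact ContinuousLinearMap.isPositive_zero
     natural := mulIsometry_natural }⟩

end QAction
end

theorem theorem7p3 {A B : Type*} [CStarAlgebra A] [Nontrivial A] [CStarAlgebra B] [Nontrivial B]
    (G : CompactQuantumGroup A) (η : QAction G B) [η.IsErgodic] (hη : η.IsNondegenerate) :
    η.spectralFunctor.IsQuasitensor ∧
    ∀ u : UnitaryRep G,
      FiniteDimensional ℂ (η.Lbar u) ∧
      ∀ ubar : UnitaryRep G, u.IsConjugate ubar →
        Module.finrank ℂ (η.Lbar u) = Module.finrank ℂ (η.Lbar ubar) :=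
  ⟨η.isQuasitensor_spectralFunctor, fun u => ⟨η.finiteDimensional_Lbar u,
    fun _ h => QAction.finrank_Lbar_eq_of_isConjugate h⟩⟩
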